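/- Conventions. A domain $D\subset\mathbb R^3$ is *uniformly $C^3$ with constants* $K$ and $r>0$ if for every $x_0\in\partial D$ there are Cartesian coordinates with origin $x_0$ and a $C^3$ function $g$ on the disc $\{|x'|<r\}$, where $x'=(x_1,x_2)$, with $g(0)=0$, $\nabla g(0)=0$ and $|\nabla^2 g|,|\nabla^3 g|\le K$ there, such that $D$ coincides with $\{x_3>g(x')\}$ inside the cylinder $\{|x'|<r,\ |x_3|<r\}$. It is uniformly $C^3$ if this holds for some $K$ and some $r>0$. Let $\Omega\subset\mathbb R^3$ be a domain, $S\subset\Omega$ a bounded domain, and $F=\Omega\setminus\overline S$. The space $W^{1,2}_0(S,\Omega)$ consists of the $u\in W^{1,2}_0(\Omega;\mathbb R^3)$ such that for some vectors $u_*,\omega\in\mathbb R^3$ and some point $x_*\in\overline S$ we have $u(x)=u_*+\omega\times(x-x_*)$ for a.e. $x\in S$. Let $h=\operatorname{dist}(S,\partial\Omega)=|PQ|$, where $P\in\partial S$ and $Q\in\partial\Omega$ realize the distance. Use Cartesian coordinates with origin $Q$ in which the plane $x_3=0$ is tangent to $\partial\Omega$ at $Q$ and $P=(0,0,h)$. Let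 $u_{P3}$ be the third component of the velocity $u_P=u_*+\omega\times(P-x_*)$ of the body at $P$. For $\sigma\ge0$ put $$\mathcal C_\sigma=\{|x'|<\sigma,\ -K\sigma^2<x_3<h+2K\sigma^2\}.$$ **Theorem.** For all $K$ and $r>0$ there are positive constants $H_*$, $C_s$, $c_0$, depending only on $K$ and $r$ (in particular not on $u$, nor on the position of $S$ in $\Omega$), such that the following holds. Let $\Omega$ be a domain and $S\subset\Omega$ a bounded domain, both uniformly $C^3$ with constants $K$ and $r$; no symmetry of $S$ or $\Omega$ is assumed. Let $u\in W^{1,2}_0(S,\Omega)$ satisfy $\operatorname{div}u=0$ in $\Omega$, and let the weak second derivatives of $u$ in $F$ satisfy $\nabla^2u\in L^2(F)$. If $h<H_*$ and $\sigma_h=c_0h^{1/2}$, then, for every choice of $P$, $Q$ and the coordinates as above, $$|u_{P3}|\le C_s\left(h^{3/2}\,\|\nabla^2u\|_{L^2(\mathcal C_{\sigma_h}\cap F)}+h\,\|\nabla u\|_{L^2(\mathcal C_{\sigma_h}\cap F)}\right).$$ -/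

import Mathlib

open MeasureTheory Filter Topology Asymptotics Matrix
open scoped ContDiff RealInnerProductSpace

/-- Three-dimensional Euclidean space. -/
abbrev E3 : Type := EuclideanSpace ℝ (Fin 3)

/-- The Euclidean plane. -/
abbrev E2 : Type := EuclideanSpace ℝ (Fin 2)

/-- The cross product on Euclidean 3-space. -/
def cross (a b : E3) : E3 := WithLp.toLp 2 (crossProduct a.ofLp b.ofLp)

/-- A domain: a nonempty connected open subset of `ℝ³`. -/
def IsRegion (D : Set E3) : Prop := IsOpen D ∧ IsConnected D

/-- The horizontal part `x' = (x₁, x₂)` of a point of `ℝ³`. -/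
def horiz (x : E3) : E2 := !₂[x 0, x 1]

/-- `D` is uniformly `C³` with constants `K` and `r`: around every boundary point `x₀` there are
Cartesian coordinates with origin `x₀` in which, inside the cylinder `|x'| < r`, `|x₃| < r`, the
set `D` is the part `x₃ > g(x')` above the graph of a `C³` function `g` with `g(0) = 0`,
`∇g(0) = 0`, whose second and third derivatives are bounded by `K`. A domain is uniformly `C³`
if this holds for some `K` and some `r > 0`. -/
def UniformC3With (K r : ℝ) (D : Set E3) : Prop :=
  ∀ x₀ ∈ frontier D, ∃ (R : E3 ≃ᵃⁱ[ℝ] E3) (g : E2 → ℝ),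
    R 0 = x₀ ∧
    ContDiffOn ℝ 3 g (Metric.ball 0 r) ∧ g 0 = 0 ∧ fderiv ℝ g 0 = 0 ∧
    (∀ y ∈ Metric.ball (0 : E2) r,
      ‖iteratedFDeriv ℝ 2 g y‖ ≤ K ∧ ‖iteratedFDeriv ℝ 3 g y‖ ≤ K) ∧
    ∀ x : E3, ‖horiz x‖ < r → |x 2| < r → (R x ∈ D ↔ g (horiz x) < x 2)

/-- `φ` is smooth with compact support contained in `D`. -/
def IsTest {V : Type*} [NormedAddCommGroup V] [NormedSpace ℝ V]
    (D : Set E3) (φ : E3 → V) : Prop :=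
  ContDiff ℝ ∞ φ ∧ HasCompactSupport φ ∧ tsupport φ ⊆ D

/-- `G` is the weak (distributional) gradient of `v` on the open set `D`; the value `G x a` is
the weak derivative in the direction `a`. -/
def HasWeakGradient {V : Type*} [NormedAddCommGroup V] [NormedSpace ℝ V]
    (D : Set E3) (v : E3 → V) (G : E3 → E3 →L[ℝ] V) : Prop :=
  LocallyIntegrableOn v D ∧ LocallyIntegrableOn G D ∧
  ∀ φ : E3 → ℝ, IsTest D φ → ∀ a : E3,
    ∫ x in D, (fderiv ℝ φ x a) • v x = - ∫ x in D, φ x • G x a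

/-- `u` belongs to `W^{1,2}_0(Ω)`, with weak gradient `Du`: both are in `L²(Ω)`, and `u` is the
limit in `W^{1,2}(Ω)` of smooth vector fields with compact support in `Ω`. -/
def MemW120 (Ω : Set E3) (u : E3 → E3) (Du : E3 → E3 →L[ℝ] E3) : Prop :=
  HasWeakGradient Ω u Du ∧
  MemLp u 2 (volume.restrict Ω) ∧ MemLp Du 2 (volume.restrict Ω) ∧
  ∃ φ : ℕ → E3 → E3, (∀ n, IsTest Ω (φ n)) ∧
    Tendsto (fun n => eLpNorm (fun x => u x - φ n x) 2 (volume.restrict Ω)) atTop (𝓝 0) ∧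
    Tendsto (fun n => eLpNorm (fun x => Du x - fderiv ℝ (φ n) x) 2 (volume.restrict Ω))
      atTop (𝓝 0)

/-- The rigid velocity field `x ↦ u_* + w × (x - x_*)` with angular velocity `w`. -/
def rigidVelocity (ustar w xstar x : E3) : E3 := ustar + cross w (x - xstar)

/-- `u`, with weak gradient `Du`, belongs to `W^{1,2}_0(S, Ω)`, its values (almost everywhere) on
the body `S` being those of the rigid velocity field given by `ustar`, `w` and `xstar ∈ S̄`. -/
def MemW120Rigid (S Ω : Set E3) (u : E3 → E3) (Du : E3 → E3 →L[ℝ] E3)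
    (ustar w xstar : E3) : Prop :=
  MemW120 Ω u Du ∧ xstar ∈ closure S ∧
  ∀ᵐ x ∂(volume.restrict S), u x = rigidVelocity ustar w xstar x

/-- `div u = 0` almost everywhere in `Ω`, in terms of the weak gradient `Du` of `u`. -/
def DivFree (Ω : Set E3) (Du : E3 → E3 →L[ℝ] E3) : Prop :=
  ∀ᵐ x ∂(volume.restrict Ω), ∑ i : Fin 3, (Du x (EuclideanSpace.single i 1)) i = 0

/-- `P ∈ ∂S` and `Q ∈ ∂Ω` realize the distance `h` of `S` and `∂Ω`, and the unit vector `e` is the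
direction of the `x₃`-axis of coordinates with origin `Q` in which the plane `x₃ = 0` is tangent
to `∂Ω` at `Q` and in which `P = (0, 0, h)`. -/
structure IsGapFrame (Ω S : Set E3) (P Q e : E3) (h : ℝ) : Prop where
  mem_body : P ∈ frontier S
  mem_wall : Q ∈ frontier Ω
  dist_eq : dist P Q = h
  minimal : ∀ x ∈ S, ∀ y ∈ frontier Ω, h ≤ dist x y
  unit : ‖e‖ = 1
  tangent : (fun x : E3 => ⟪x - Q, e⟫) =o[𝓝[frontier Ω] Q] (fun x : E3 => x - Q)
  axis : P = Q + h • e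

/-- The cylinder `|x'| < σ`, `-K σ² < x₃ < h + 2 K σ²` in coordinates with origin `Q` and
`x₃`-axis in the direction of the unit vector `e`. -/
def gapCylinder (Q e : E3) (K h σ : ℝ) : Set E3 :=
  {x | ‖(x - Q) - ⟪x - Q, e⟫ • e‖ < σ ∧
    -(K * σ ^ 2) < ⟪x - Q, e⟫ ∧ ⟪x - Q, e⟫ < h + 2 * K * σ ^ 2}

/-- The `L²` norm of `f` over `A`. -/
noncomputable def L2norm {V : Type*} [NormedAddCommGroup V] (f : E3 → V) (A : Set E3) : ℝ :=
  (eLpNorm f 2 (volume.restrict A)).toReal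

/-! ### Square integrable fields and weak gradients -/

/-! Let `V` be the velocity of the body at `P`, `A` the skew map `x ↦ w × x` and `e` the common
normal. Over the disc `‖y‖ < σ` the fluid fills the gap between the wall graph `a` and the body
graph `b`, with `|a|` and `|b - h|` at most `K‖y‖²`. Take a radial cutoff `η` with `∇η = κ(y) y`.
Incompressibility says that the fluid displaced by the body leaves through the sides of the gap. So
`⟪e, V⟫ ∫ η` equals the integral of `κ ⟪y, u⟫` over the gap, up to explicit terms from the curvature
of the body (`inner_vert_mul_integral_radialCutoff`).

On each vertical segment `u` vanishes at the wall and is rigid at the body, and the trapezoidal rule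
gives `∫ u dt = (b - a)/2 · u(b) - ∫ (t - a)(b - t)/2 · ∂ₜ²u dt`. Inserting this yields
`flux_identity`. The remainder is weighted by a factor of order `h²`, which produces the second
derivatives of `u`. In the boundary terms skewness removes `⟪y, A y⟫`, and `V` appears only through
the odd function `κ ⟪y, V⟫` times `(a + b)/2`. Without symmetry `a + b` need not be even, but
against an odd weight only its odd part counts, and bounded third derivatives make that part of
order `K‖y‖³` (`graph_bounds`). The remaining term carries `A e` with a factor of order `K σ² h`.

It remains to bound `V` and `A e` by the gradient. The vertical increment of `u` across the gap is
the rigid velocity `V + A y + (b - h) A e`. Tested with `η V` and with `η ⟪l, y⟫ e`, where `l`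
represents `A e`, it isolates `V` and `A e` by parity (`norm_mul_integral_radialCutoff_le`,
`norm_map_vert_mul_le`). With `h = s²` and `σ = c s` the gap has volume of order `s⁴`.
Cauchy–Schwarz then gives `|V| + s |A e| ≲ ‖∇u‖` and finally `|⟪e, V⟫| ≲ s³ ‖∇²u‖ + s² ‖∇u‖`, with
norms over the gap.

No traces are used. The zero value at the wall is encoded by testing on all of `Ω` with fields that
need not vanish on `∂Ω`, and the value at the body by the rigid field inside `S`. If `h = 0`,
shrinking the disc forces `V = 0` (`eq_zero_of_contact`). The geometric input is that both boundary
pieces are graphs over one plane with normal `e` when `h > 0` (`IsGapFrame.exists_isLocalGraph`). -/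

theorem integrable_inner_of_memLp_two {α : Type*} {m : MeasurableSpace α} {μ : Measure α}
    {f g : α → E3} (hf : MemLp f 2 μ) (hg : MemLp g 2 μ) :
    Integrable (fun x => ⟪f x, g x⟫) μ :=
  memLp_one_iff_integrable.1 <| MemLp.of_bilin (fun a b : E3 => ⟪a, b⟫) 1 hf hg
    (hf.1.inner hg.1)
    (Eventually.of_forall fun x => by simpa using nnnorm_inner_le_nnnorm (𝕜 := ℝ) (f x) (g x))

theorem tendsto_integral_inner {α : Type*} {m : MeasurableSpace α} {μ : Measure α}
    {f g : α → E3} {F : ℕ → α → E3} (hg : MemLp g 2 μ) (hf : MemLp f 2 μ)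
    (hF : ∀ n, MemLp (F n) 2 μ)
    (h : Tendsto (fun n => eLpNorm (fun x => f x - F n x) 2 μ) atTop (𝓝 0)) :
    Tendsto (fun n => ∫ x, ⟪g x, F n x⟫ ∂μ) atTop (𝓝 (∫ x, ⟪g x, f x⟫ ∂μ)) := by
  refine tendsto_integral_of_L1' _ (hg.1.inner hf.1)
    (Eventually.of_forall fun n => integrable_inner_of_memLp_two hg (hF n)) ?_
  have hb : ∀ n, eLpNorm ((fun x => ⟪g x, F n x⟫) - fun x => ⟪g x, f x⟫) 1 μ
      ≤ eLpNorm g 2 μ * eLpNorm (fun x => f x - F n x) 2 μ := by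
    intro n
    have := eLpNorm_le_eLpNorm_mul_eLpNorm_of_nnnorm (p := 2) (q := 2) (r := 1) hg.1
      (hf.sub (hF n)).1 (fun a b : E3 => ⟪a, b⟫) 1
      (Eventually.of_forall fun x => by
        simpa using nnnorm_inner_le_nnnorm (𝕜 := ℝ) (g x) ((f - F n) x))
    rw [eLpNorm_sub_comm]
    simpa [Pi.sub_def, inner_sub_right] using this
  have hz : Tendsto (fun n => eLpNorm g 2 μ * eLpNorm (fun x => f x - F n x) 2 μ) atTop (𝓝 0) := by
    simpa using ENNReal.Tendsto.const_mul h (Or.inr hg.2.ne)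
  exact tendsto_of_tendsto_of_tendsto_of_le_of_le tendsto_const_nhds hz (fun _ => zero_le) hb

theorem MeasureTheory.MemLp.clm_apply_const {α V W : Type*} {m : MeasurableSpace α}
    {μ : Measure α} [NormedAddCommGroup V] [NormedSpace ℝ V] [NormedAddCommGroup W]
    [NormedSpace ℝ W] {p : ENNReal} {G : α → W →L[ℝ] V} (hG : MemLp G p μ) (a : W) :
    MemLp (fun x => G x a) p μ :=
  MemLp.of_le_mul (c := ‖a‖) hG (hG.1.apply_continuousLinearMap a)
    (Eventually.of_forall fun x => by rw [mul_comm]; exact (G x).le_opNorm a)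

theorem ContDiff.memLp_fderiv_apply {V : Type*} [NormedAddCommGroup V] [NormedSpace ℝ V]
    {ψ : E3 → V} (hψ : ContDiff ℝ 1 ψ) (hc : HasCompactSupport ψ) (a : E3) (p : ENNReal)
    (μ : Measure E3) [IsFiniteMeasureOnCompacts μ] :
    MemLp (fun x => fderiv ℝ ψ x a) p μ :=
  ((hψ.continuous_fderiv one_ne_zero).clm_apply continuous_const).memLp_of_hasCompactSupport
    (hc.fderiv_apply ℝ a)

theorem ContDiff.integral_inner_fderiv_eq_neg {ψ φ : E3 → E3} (hψ : ContDiff ℝ 1 ψ)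
    (hφ : ContDiff ℝ 1 φ) (hcψ : HasCompactSupport ψ) (hc : HasCompactSupport φ) (a : E3) :
    ∫ x, ⟪fderiv ℝ ψ x a, φ x⟫ = - ∫ x, ⟪ψ x, fderiv ℝ φ x a⟫ := by
  have h1 : MemLp ψ 2 (volume : Measure E3) :=
    hψ.continuous.memLp_of_hasCompactSupport hcψ
  have h2 : MemLp φ 2 (volume : Measure E3) :=
    hφ.continuous.memLp_of_hasCompactSupport hc
  have : ∫ x, ⟪ψ x, fderiv ℝ φ x a⟫ = - ∫ x, ⟪fderiv ℝ ψ x a, φ x⟫ :=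
    integral_bilinear_fderiv_right_eq_neg_left_of_integrable (μ := (volume : Measure E3))
    (f := ψ) (g := φ) (v := a) (B := innerSL ℝ)
    (integrable_inner_of_memLp_two (hψ.memLp_fderiv_apply hcψ a 2 _) h2)
    (integrable_inner_of_memLp_two h1 (hφ.memLp_fderiv_apply hc a 2 _))
    (integrable_inner_of_memLp_two h1 h2)
    (fun x _ => (hψ.differentiable one_ne_zero) x) (fun x _ => (hφ.differentiable one_ne_zero) x)
  rw [this, neg_neg]

theorem setIntegral_eq_integral_of_tsupport_subset {V W : Type*} [Zero V]
    [NormedAddCommGroup W] [NormedSpace ℝ W] {D : Set E3} {φ : E3 → V} (hφ : tsupport φ ⊆ D)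
    {I : E3 → W} (hI : ∀ x, x ∉ tsupport φ → I x = 0) :
    ∫ x in D, I x = ∫ x, I x :=
  setIntegral_eq_integral_of_forall_compl_eq_zero fun x hx => hI x fun h => hx (hφ h)

/-- A field in `W^{1,2}_0(Ω)` can be integrated by parts against every `C¹` field with compact
support in the whole space. -/
theorem MemW120.integral_inner {Ω : Set E3} {u : E3 → E3} {Du : E3 → E3 →L[ℝ] E3}
    (h : MemW120 Ω u Du) {ψ : E3 → E3} (hψ : ContDiff ℝ 1 ψ) (hc : HasCompactSupport ψ) (a : E3) :
    ∫ x in Ω, ⟪fderiv ℝ ψ x a, u x⟫ = - ∫ x in Ω, ⟪ψ x, Du x a⟫ := by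
  obtain ⟨-, hu, hDu, φ, hφ, h0, h1⟩ := h
  have hmφ : ∀ n, MemLp (φ n) 2 (volume.restrict Ω) := fun n =>
    (hφ n).1.continuous.memLp_of_hasCompactSupport (hφ n).2.1
  have hφ1 : ∀ n, ContDiff ℝ 1 (φ n) := fun n => (hφ n).1.of_le (by simp)
  have hmd : ∀ n, MemLp (fun x => fderiv ℝ (φ n) x a) 2 (volume.restrict Ω) := fun n =>
    (hφ1 n).memLp_fderiv_apply (hφ n).2.1 a 2 _
  have hDua : MemLp (fun x => Du x a) 2 (volume.restrict Ω) :=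
    hDu.clm_apply_const a
  have h1a : Tendsto (fun n => eLpNorm (fun x => Du x a - fderiv ℝ (φ n) x a) 2
      (volume.restrict Ω)) atTop (𝓝 0) := by
    have hb : ∀ n, eLpNorm (fun x => Du x a - fderiv ℝ (φ n) x a) 2 (volume.restrict Ω)
        ≤ ENNReal.ofReal ‖a‖ * eLpNorm (fun x => Du x - fderiv ℝ (φ n) x) 2
          (volume.restrict Ω) := fun n =>
      eLpNorm_le_mul_eLpNorm_of_ae_le_mul (Eventually.of_forall fun x => by
        rw [mul_comm]; simpa using (Du x - fderiv ℝ (φ n) x).le_opNorm a) 2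
    have hz := ENNReal.Tendsto.const_mul h1 (Or.inr (ENNReal.ofReal_ne_top (r := ‖a‖)))
    rw [mul_zero] at hz
    exact tendsto_of_tendsto_of_tendsto_of_le_of_le tendsto_const_nhds hz (fun _ => zero_le) hb
  have hl := tendsto_integral_inner (hψ.memLp_fderiv_apply hc a 2 (volume.restrict Ω)) hu hmφ h0
  have hr := tendsto_integral_inner (hψ.continuous.memLp_of_hasCompactSupport (p := 2)
    (μ := volume.restrict Ω) hc) hDua hmd h1a
  -- For the approximants the identity is classical on the whole space, because they have compact
  -- support in `Ω`. No condition on `ψ` at `∂Ω` is needed, which is how the zero boundary value of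
  -- `u` enters.
  refine tendsto_nhds_unique hl (hr.neg.congr fun n => ?_)
  rw [setIntegral_eq_integral_of_tsupport_subset (hφ n).2.2 fun x hx => ?_,
    setIntegral_eq_integral_of_tsupport_subset (hφ n).2.2 fun x hx => ?_]
  · exact (hψ.integral_inner_fderiv_eq_neg (hφ1 n) hc (hφ n).2.1 a).symm
  · simp [image_eq_zero_of_notMem_tsupport hx]
  · simp [fderiv_of_notMem_tsupport ℝ hx]

/-- The weak form of `div u = 0`. -/
theorem MemW120.integral_fderiv_apply_eq_zero {Ω : Set E3} {u : E3 → E3}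
    {Du : E3 → E3 →L[ℝ] E3} (h : MemW120 Ω u Du) (hdiv : DivFree Ω Du) {ψ : E3 → ℝ}
    (hψ : ContDiff ℝ 1 ψ) (hc : HasCompactSupport ψ) :
    ∫ x in Ω, fderiv ℝ ψ x (u x) = 0 := by
  have hm : ∀ i : Fin 3, ContDiff ℝ 1 fun x => ψ x • EuclideanSpace.single i (1 : ℝ) :=
    fun i => hψ.smul contDiff_const
  have hcm : ∀ i : Fin 3, HasCompactSupport fun x => ψ x • EuclideanSpace.single i (1 : ℝ) :=
    fun i => hc.smul_right
  have hfd : ∀ (i : Fin 3) x, fderiv ℝ (fun x => ψ x • EuclideanSpace.single i (1 : ℝ)) x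
      (EuclideanSpace.single i 1) = fderiv ℝ ψ x (EuclideanSpace.single i 1) •
        EuclideanSpace.single i (1 : ℝ) := by
    intro i x
    rw [fderiv_smul_const (hψ.differentiable one_ne_zero x)]
    simp
  have hi : ∀ i : Fin 3, Integrable (fun x => ⟪fderiv ℝ (fun x => ψ x •
      EuclideanSpace.single i (1 : ℝ)) x (EuclideanSpace.single i 1), u x⟫)
      (volume.restrict Ω) := fun i =>
    integrable_inner_of_memLp_two ((hm i).memLp_fderiv_apply (hcm i) _ 2 _) h.2.1
  have hj : ∀ i : Fin 3, Integrable (fun x => ⟪ψ x • EuclideanSpace.single i (1 : ℝ),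
      Du x (EuclideanSpace.single i 1)⟫) (volume.restrict Ω) := fun i =>
    integrable_inner_of_memLp_two ((hm i).continuous.memLp_of_hasCompactSupport (hcm i))
      (h.2.2.1.clm_apply_const _)
  have key : ∀ x, fderiv ℝ ψ x (u x) = ∑ i : Fin 3, ⟪fderiv ℝ (fun x => ψ x •
      EuclideanSpace.single i (1 : ℝ)) x (EuclideanSpace.single i 1), u x⟫ := by
    intro x
    have hu : u x = ∑ i : Fin 3, u x i • EuclideanSpace.single i (1 : ℝ) := by
      ext j
      fin_cases j <;> simp [Fin.sum_univ_three]
    conv_lhs => rw [hu]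
    rw [map_sum]
    refine Finset.sum_congr rfl fun i _ => ?_
    rw [hfd, map_smul, real_inner_smul_left, EuclideanSpace.inner_single_left]
    simp [mul_comm]
  simp_rw [key]
  rw [integral_finsetSum _ fun i _ => hi i]
  simp_rw [h.integral_inner (hm _) (hcm _)]
  rw [Finset.sum_neg_distrib, ← integral_finsetSum _ fun i _ => hj i, neg_eq_zero]
  refine integral_eq_zero_of_ae ?_
  filter_upwards [hdiv] with x hx
  simp only [real_inner_smul_left, EuclideanSpace.inner_single_left, map_one, one_mul,
    ← Finset.mul_sum, hx, mul_zero, Pi.zero_apply]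

-- The mollification is an average of values of `g`, all within `2C` of `g x`. The crude factor 3
-- suffices, as the bound only serves as a dominating constant.
open scoped Convolution in
theorem norm_normed_convolution_le_of_forall_norm_le {W : Type*} [NormedAddCommGroup W]
    [NormedSpace ℝ W] [CompleteSpace W] (B : ContDiffBump (0 : E3)) {g : E3 → W} {C : ℝ}
    (hg : Continuous g) (hC : ∀ x, ‖g x‖ ≤ C) (x : E3) :
    ‖((B.normed volume ⋆[ContinuousLinearMap.lsmul ℝ ℝ, volume] g : E3 → W)) x‖ ≤ 3 * C := by
  have h := B.dist_normed_convolution_le (μ := volume) (g := g) (x₀ := x) (ε := 2 * C)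
    hg.aestronglyMeasurable (fun y _ => by
      rw [dist_eq_norm]
      linarith [norm_sub_le (g y) (g x), hC x, hC y])
  rw [dist_eq_norm] at h
  linarith [norm_le_norm_add_norm_sub'
    ((B.normed volume ⋆[ContinuousLinearMap.lsmul ℝ ℝ, volume] g :
    E3 → W) x) (g x), hC x]

open scoped Convolution in
/-- The identity defining a weak gradient extends to `C¹` test functions. -/
theorem HasWeakGradient.integral_smul_of_contDiff_one {V : Type*} [NormedAddCommGroup V]
    [NormedSpace ℝ V] {D : Set E3} {v : E3 → V} {G : E3 → E3 →L[ℝ] V} (hD : IsOpen D)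
    (h : HasWeakGradient D v G) {φ : E3 → ℝ} (hφ : ContDiff ℝ 1 φ) (hc : HasCompactSupport φ)
    (hs : tsupport φ ⊆ D) (a : E3) :
    ∫ x in D, (fderiv ℝ φ x a) • v x = - ∫ x in D, φ x • G x a := by
  obtain ⟨hv, hG, htest⟩ := h
  obtain ⟨δ, hδ, hδD⟩ := IsCompact.exists_cthickening_subset_open (s := tsupport φ) hc hD hs
  set K' := Metric.cthickening δ (tsupport φ) with hK'
  have hK'c : IsCompact K' := hc.isCompact.cthickening
  -- The outer radii tend to zero and never exceed `δ`, so every mollification of `φ` is supported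
  -- in the compact set `K'` inside `D`.
  let B : ℕ → ContDiffBump (0 : E3) := fun n =>
    ⟨δ / (2 * (n + 2)), δ / (n + 2), by positivity, by
      apply div_lt_div_of_pos_left hδ (by positivity); nlinarith⟩
  have hB0 : Tendsto (fun n => (B n).rOut) atTop (𝓝 0) := by
    have : Tendsto (fun n : ℕ => δ / ((n : ℝ) + 2)) atTop (𝓝 0) :=
      Tendsto.const_div_atTop (tendsto_atTop_add_const_right _ _ tendsto_natCast_atTop_atTop) _
    exact this
  have hBδ : ∀ n, (B n).rOut ≤ δ := fun n => by
    change δ / ((n : ℝ) + 2) ≤ δ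
    apply div_le_self hδ.le
    have : (0 : ℝ) ≤ n := n.cast_nonneg
    linarith
  let Φ : ℕ → E3 → ℝ := fun n =>
    ((B n).normed volume ⋆[ContinuousLinearMap.lsmul ℝ ℝ, volume] φ)
  have hcd : Continuous fun x => fderiv ℝ φ x a :=
    (hφ.continuous_fderiv one_ne_zero).clm_apply continuous_const
  have hli : ∀ n, LocallyIntegrable ((B n).normed (volume : Measure E3)) volume := fun n =>
    (B n).continuous_normed.locallyIntegrable
  have hder : ∀ n x, fderiv ℝ (Φ n) x a =
      ((B n).normed volume ⋆[ContinuousLinearMap.lsmul ℝ ℝ, volume] fun x => fderiv ℝ φ x a) x := by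
    intro n x
    have h1 := hc.hasFDerivAt_convolution_right (ContinuousLinearMap.lsmul ℝ ℝ) (hli n) hφ x
    rw [h1.fderiv, convolution_precompR_apply (L := ContinuousLinearMap.lsmul ℝ ℝ) (hli n)
      (hc.fderiv ℝ) (hφ.continuous_fderiv one_ne_zero)]
  have hsm : ∀ n, ContDiff ℝ ∞ (Φ n) := fun n =>
    (B n).hasCompactSupport_normed.contDiff_convolution_left _ (B n).contDiff_normed
      hφ.continuous.locallyIntegrable
  have hsupp : ∀ n, tsupport (Φ n) ⊆ K' := by
    intro n
    refine closure_minimal ?_ Metric.isClosed_cthickening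
    refine (support_convolution_subset _).trans ?_
    rw [(B n).support_normed_eq]
    rintro _ ⟨y, hy, z, hz, rfl⟩
    refine Metric.mem_cthickening_of_dist_le _ z _ _ (subset_tsupport _ hz) ?_
    rw [mem_ball_zero_iff] at hy
    simpa using hy.le.trans (hBδ n)
  have hΦtest : ∀ n, IsTest D (Φ n) := fun n =>
    ⟨hsm n, HasCompactSupport.of_support_subset_isCompact hK'c
      ((subset_tsupport _).trans (hsupp n)),
      (hsupp n).trans hδD⟩
  obtain ⟨C₀, hC₀⟩ := hφ.continuous.bounded_above_of_compact_support hc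
  obtain ⟨C₁, hC₁⟩ := hcd.bounded_above_of_compact_support (hc.fderiv_apply ℝ a)
  have hbint : ∀ {W : Type _} [NormedAddCommGroup W] (f : E3 → W) (C : ℝ),
      LocallyIntegrableOn f D → Integrable (K'.indicator fun x => C * ‖f x‖)
        (volume.restrict D) := by
    intro W _ f C hf
    have h2 : IntegrableOn (fun x => C * ‖f x‖) K' :=
      ((hf.integrableOn_compact_subset hδD hK'c).norm).const_mul C
    exact ((integrable_indicator_iff hK'c.measurableSet).2 h2).mono_measure Measure.restrict_le_self
  have hGa : LocallyIntegrableOn (fun x => G x a) D := fun x hx =>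
    (hG x hx).imp fun t ht => ⟨ht.1, ht.2.apply_continuousLinearMap a⟩
  have hlim1 : Tendsto (fun n => ∫ x in D, (fderiv ℝ (Φ n) x a) • v x) atTop
      (𝓝 (∫ x in D, (fderiv ℝ φ x a) • v x)) := by
    refine tendsto_integral_of_dominated_convergence _ (fun n => ?_) (hbint v (3 * C₁) hv)
      (fun n => Eventually.of_forall fun x => ?_) (Eventually.of_forall fun x => ?_)
    · exact (((hsm n).continuous_fderiv (by simp)).clm_apply
        continuous_const).aestronglyMeasurable.smul (hv.aestronglyMeasurable)
    · by_cases hx : x ∈ K'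
      · rw [Set.indicator_of_mem hx, norm_smul, hder]
        gcongr
        exact norm_normed_convolution_le_of_forall_norm_le (B n) hcd hC₁ x
      · rw [Set.indicator_of_notMem hx, fderiv_of_notMem_tsupport ℝ fun h => hx (hsupp n h)]
        simp
    · simp_rw [hder]
      exact (ContDiffBump.convolution_tendsto_right_of_continuous hB0 hcd x).smul_const _
  have hlim2 : Tendsto (fun n => ∫ x in D, (Φ n x) • G x a) atTop
      (𝓝 (∫ x in D, φ x • G x a)) := by
    refine tendsto_integral_of_dominated_convergence _ (fun n => ?_) (hbint _ (3 * C₀) hGa)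
      (fun n => Eventually.of_forall fun x => ?_) (Eventually.of_forall fun x => ?_)
    · exact (hsm n).continuous.aestronglyMeasurable.smul (hGa.aestronglyMeasurable)
    · by_cases hx : x ∈ K'
      · rw [Set.indicator_of_mem hx, norm_smul]
        gcongr
        exact norm_normed_convolution_le_of_forall_norm_le (B n) hφ.continuous hC₀ x
      · rw [Set.indicator_of_notMem hx,
          image_eq_zero_of_notMem_tsupport fun h => hx (hsupp n h)]
        simp
    · exact (ContDiffBump.convolution_tendsto_right_of_continuous hB0 hφ.continuous x).smul_const _
  exact tendsto_nhds_unique hlim1 (hlim2.neg.congr fun n => (htest _ (hΦtest n) a).symm)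

/-- The identity defining the weak gradient of `Du`, tested with a `C¹` vector field. -/
theorem HasWeakGradient.integral_inner_apply {D : Set E3} {Du : E3 → E3 →L[ℝ] E3}
    {D2u : E3 → E3 →L[ℝ] E3 →L[ℝ] E3} (hD : IsOpen D) (h : HasWeakGradient D Du D2u)
    (hDu : MemLp Du 2 (volume.restrict D)) (hD2u : MemLp D2u 2 (volume.restrict D))
    {ψ : E3 → E3} (hψ : ContDiff ℝ 1 ψ) (hc : HasCompactSupport ψ) (hs : tsupport ψ ⊆ D)
    (a b : E3) :
    ∫ x in D, ⟪fderiv ℝ ψ x a, Du x b⟫ = - ∫ x in D, ⟪ψ x, D2u x a b⟫ := by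
  have hm : ∀ i : Fin 3, ContDiff ℝ 1 fun x => ψ x i := fun i => by fun_prop
  have hci : ∀ i : Fin 3, HasCompactSupport fun x => ψ x i := fun i =>
    hc.comp_left (g := fun z : E3 => z i) rfl
  have hsi : ∀ i : Fin 3, tsupport (fun x => ψ x i) ⊆ D := fun i =>
    (closure_mono fun x hx => by
      simp only [Function.mem_support] at hx ⊢
      exact fun h0 => hx (by simp [h0])).trans hs
  have hfd : ∀ (i : Fin 3) x, fderiv ℝ (fun x => ψ x i) x a = (fderiv ℝ ψ x a) i := by
    intro i x
    have := ((EuclideanSpace.proj (𝕜 := ℝ) i).hasFDerivAt.comp x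
      (hψ.differentiable one_ne_zero x).hasFDerivAt).fderiv
    exact congrArg (fun T : E3 →L[ℝ] ℝ => T a) this
  have hDub : MemLp (fun x => Du x b) 2 (volume.restrict D) :=
    hDu.clm_apply_const b
  have hD2a : MemLp (fun x => D2u x a) 2 (volume.restrict D) :=
    hD2u.clm_apply_const a
  have hD2ab : MemLp (fun x => D2u x a b) 2 (volume.restrict D) :=
    hD2a.clm_apply_const b
  have hmi : ∀ (p : ENNReal) (i : Fin 3), MemLp (fun x => ψ x i) p (volume.restrict D) := fun p i =>
    (hm i).continuous.memLp_of_hasCompactSupport (hci i)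
  have hdi : ∀ i : Fin 3, MemLp (fun x => (fderiv ℝ (fun x => ψ x i) x a)) 2
    (volume.restrict D) := fun i => (hm i).memLp_fderiv_apply (hci i) a 2 _
  have i1 : ∀ i : Fin 3, Integrable (fun x => (fderiv ℝ (fun x => ψ x i) x a) * (Du x b) i)
      (volume.restrict D) := fun i =>
    (hdi i).integrable_mul ((EuclideanSpace.proj (𝕜 := ℝ) i).comp_memLp' hDub)
  have i2 : ∀ i : Fin 3, Integrable (fun x => ψ x i * (D2u x a b) i)
      (volume.restrict D) := fun i =>
    (hmi 2 i).integrable_mul ((EuclideanSpace.proj (𝕜 := ℝ) i).comp_memLp' hD2ab)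
  have e1 : ∀ x, ⟪fderiv ℝ ψ x a, Du x b⟫ =
      ∑ i : Fin 3, (fderiv ℝ (fun x => ψ x i) x a) * (Du x b) i := by
    intro x
    simp only [hfd, PiLp.inner_apply]
    simp [mul_comm]
  have e2 : ∀ x, ⟪ψ x, D2u x a b⟫ = ∑ i : Fin 3, ψ x i * (D2u x a b) i := by
    intro x
    simp only [PiLp.inner_apply]
    simp [mul_comm]
  simp_rw [e1, e2]
  rw [integral_finsetSum _ fun i _ => i1 i, integral_finsetSum _ fun i _ => i2 i,
    ← Finset.sum_neg_distrib]
  -- Componentwise the identity is the scalar one for `Du`, composed with the functional `T ↦ (T b)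
  -- i`.
  refine Finset.sum_congr rfl fun i _ => ?_
  have hid := h.integral_smul_of_contDiff_one hD (hm i) (hci i) (hsi i) a
  let Λ : (E3 →L[ℝ] E3) →L[ℝ] ℝ :=
    (EuclideanSpace.proj (𝕜 := ℝ) i).comp (ContinuousLinearMap.apply ℝ E3 b)
  have j1 : Integrable (fun x => (fderiv ℝ (fun x => ψ x i) x a) • Du x) (volume.restrict D) :=
    memLp_one_iff_integrable.1 (hDu.smul (hdi i))
  have j2 : Integrable (fun x => (ψ x i) • D2u x a) (volume.restrict D) :=
    memLp_one_iff_integrable.1 (hD2a.smul (hmi 2 i))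
  have := congrArg Λ hid
  rw [map_neg, ← Λ.integral_comp_comm j1, ← Λ.integral_comp_comm j2] at this
  simpa [Λ] using this

/-! ### Rigid velocity fields -/

/-- The cross product with a fixed vector, as a continuous linear map. -/
noncomputable def crossCLM (w : E3) : E3 →L[ℝ] E3 :=
  LinearMap.toContinuousLinearMap
    { toFun := cross w
      map_add' := fun x y => by simp [cross]
      map_smul' := fun c x => by simp [cross] }

theorem crossCLM_apply (w x : E3) : crossCLM w x = cross w x := rfl

theorem inner_crossCLM_self (w x : E3) : ⟪x, crossCLM w x⟫ = 0 := by
  simp only [crossCLM_apply, cross, PiLp.inner_apply, Fin.sum_univ_three, cross_apply]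
  simp
  ring

/-- Polarization of `inner_crossCLM_self`. Skewness is all that the later estimates use about the
angular velocity. -/
theorem inner_crossCLM_comm (w x y : E3) : ⟪x, crossCLM w y⟫ = -⟪y, crossCLM w x⟫ := by
  have h := inner_crossCLM_self w (x + y)
  simp only [map_add, inner_add_left, inner_add_right, inner_crossCLM_self] at h
  linarith

theorem rigidVelocity_eq_add (ustar w xstar P x : E3) :
    rigidVelocity ustar w xstar x = rigidVelocity ustar w xstar P + crossCLM w (x - P) := by
  simp only [rigidVelocity, ← crossCLM_apply, map_sub]
  abel

/-- Where a function agrees with an affine map, so does its weak gradient. -/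
theorem HasWeakGradient.ae_apply_eq_of_ae_eq_affine {Ω S : Set E3} {u : E3 → E3}
    {Du : E3 → E3 →L[ℝ] E3} (h : HasWeakGradient Ω u Du) (hS : IsOpen S) (hSΩ : S ⊆ Ω)
    {c : E3} {A : E3 →L[ℝ] E3} (hu : ∀ᵐ x ∂(volume.restrict S), u x = c + A x) (a : E3) :
    ∀ᵐ x ∂(volume.restrict S), Du x a = A a := by
  obtain ⟨-, hDu, htest⟩ := h
  have hDua : LocallyIntegrableOn (fun x => Du x a) S := fun x hx =>
    ((hDu.mono_set hSΩ) x hx).imp fun t ht => ⟨ht.1, ht.2.apply_continuousLinearMap a⟩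
  rw [ae_restrict_iff' hS.measurableSet]
  have hloc : LocallyIntegrableOn (fun x => Du x a - A a) S :=
    hDua.sub ((locallyIntegrable_const _).locallyIntegrableOn S)
  suffices hz : ∀ g : E3 → ℝ, ContDiff ℝ ∞ g → HasCompactSupport g → tsupport g ⊆ S →
      ∫ x, g x • (Du x a - A a) = 0 from
    (hS.ae_eq_zero_of_integral_contDiff_smul_eq_zero hloc hz).mono
      fun x hx hxS => sub_eq_zero.1 (hx hxS)
  intro g hg hgc hgS
  have hg1 : ContDiff ℝ 1 g := hg.of_le (by simp)
  have hi1 : Integrable fun x => g x • Du x a := by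
    have h1 : IntegrableOn (fun x => g x • Du x a) (tsupport g) :=
      ((hDua.integrableOn_compact_subset hgS hgc).continuousOn_smul
        hg.continuous.continuousOn hgc)
    rwa [integrableOn_iff_integrable_of_support_subset] at h1
    exact fun x hx => subset_tsupport _ fun h0 => hx (by simp [h0])
  have hi2 : Integrable fun x => g x • A a :=
    (hg.continuous.integrable_of_hasCompactSupport hgc).smul_const _
  simp_rw [smul_sub]
  rw [integral_sub hi1 hi2, sub_eq_zero]
  have e1 : ∫ x in Ω, g x • Du x a = ∫ x, g x • Du x a :=
    setIntegral_eq_integral_of_tsupport_subset (hgS.trans hSΩ) fun x hx => by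
      simp [image_eq_zero_of_notMem_tsupport hx]
  -- A test function supported in `S` sees only the affine values of `u`. The classical integration
  -- by parts for the affine map then identifies the weak gradient.
  have e2 : ∫ x in Ω, fderiv ℝ g x a • u x = ∫ x in S, fderiv ℝ g x a • u x := by
    rw [setIntegral_eq_integral_of_tsupport_subset (hgS.trans hSΩ),
      setIntegral_eq_integral_of_tsupport_subset hgS] <;>
    · intro x hx
      simp [fderiv_of_notMem_tsupport ℝ hx]
  have e3 : ∫ x in S, fderiv ℝ g x a • u x = ∫ x in S, fderiv ℝ g x a • (c + A x) :=
    integral_congr_ae (hu.mono fun x hx => by simp [hx])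
  have e4 : ∫ x in S, fderiv ℝ g x a • (c + A x) = ∫ x, fderiv ℝ g x a • (c + A x) :=
    setIntegral_eq_integral_of_tsupport_subset hgS fun x hx => by
      simp [fderiv_of_notMem_tsupport ℝ hx]
  have hUd : ∀ x, HasFDerivAt (fun x => c + A x) A x := fun x => A.hasFDerivAt.const_add c
  have hcU : Continuous fun x => c + A x := by fun_prop
  have e5 : ∫ x, g x • A a = - ∫ x, fderiv ℝ g x a • (c + A x) := by
    have := integral_smul_fderiv_eq_neg_fderiv_smul_of_integrable (μ := (volume : Measure E3))
      (f := g) (g := fun x => c + A x) (v := a)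
      ((((hg1.continuous_fderiv one_ne_zero).clm_apply continuous_const).smul
        hcU).integrable_of_hasCompactSupport (hgc.fderiv_apply ℝ a).smul_right)
      (by simpa only [(hUd _).fderiv] using hi2)
      ((hg.continuous.smul hcU).integrable_of_hasCompactSupport hgc.smul_right)
      (fun x _ => hg1.differentiable one_ne_zero x) (fun x _ => (hUd x).differentiableAt)
    simpa only [(hUd _).fderiv] using this
  rw [e5, ← e4, ← e3, ← e2, htest g ⟨hg, hgc, hgS.trans hSΩ⟩ a, neg_neg, e1]

/-! ### Cartesian coordinates `(y, t)` -/

/-- The point with horizontal part `y` and height `t`. -/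
noncomputable def ptEquiv : (E2 × ℝ) ≃L[ℝ] E3 :=
  LinearEquiv.toContinuousLinearEquiv
    { toFun := fun z => !₂[z.1 0, z.1 1, z.2]
      invFun := fun x => (horiz x, x 2)
      map_add' := fun y z => by ext i; fin_cases i <;> simp
      map_smul' := fun c z => by ext i; fin_cases i <;> simp
      left_inv := fun z => by
        ext i
        · fin_cases i <;> simp [horiz]
        · simp
      right_inv := fun x => by ext i; fin_cases i <;> simp [horiz] }

theorem ptEquiv_apply (z : E2 × ℝ) : ptEquiv z = !₂[z.1 0, z.1 1, z.2] := rfl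

theorem ptEquiv_symm_apply (x : E3) : ptEquiv.symm x = (horiz x, x 2) := rfl

theorem inner_ptEquiv (z z' : E2 × ℝ) :
    ⟪ptEquiv z, ptEquiv z'⟫ = ⟪z.1, z'.1⟫ + z.2 * z'.2 := by
  simp [ptEquiv_apply, PiLp.inner_apply, Fin.sum_univ_three, mul_comm]

theorem measurePreserving_ptEquiv : MeasurePreserving ptEquiv := by
  have h1 := (volume_preserving_piFinSuccAbove (fun _ : Fin 3 => ℝ) (Fin.last 2)).symm
  have h2 : MeasurePreserving (fun z : E2 × ℝ => ((z.2, z.1.ofLp) : ℝ × (Fin 2 → ℝ))) :=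
    (Measure.measurePreserving_swap (μ := (volume : Measure (Fin 2 → ℝ)))
      (ν := (volume : Measure ℝ))).comp
      ((PiLp.volume_preserving_ofLp (Fin 2)).prod (MeasurePreserving.id volume))
  have h3 := (PiLp.volume_preserving_toLp (Fin 3)).comp (h1.comp h2)
  convert h3 using 1
  ext z i
  fin_cases i <;> rfl

/-- The Cartesian coordinates with origin `Q` and axes given by `L`. -/
noncomputable def chart (Q : E3) (L : E3 ≃ₗᵢ[ℝ] E3) : (E2 × ℝ) ≃ₜ E3 :=
  (ptEquiv.toHomeomorph.trans L.toHomeomorph).trans (Homeomorph.addLeft Q)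

theorem chart_apply (Q : E3) (L : E3 ≃ₗᵢ[ℝ] E3) (z : E2 × ℝ) :
    chart Q L z = Q + L (ptEquiv z) := rfl

theorem measurePreserving_chart (Q : E3) (L : E3 ≃ₗᵢ[ℝ] E3) :
    MeasurePreserving (chart Q L) :=
  (measurePreserving_add_left volume Q).comp
    (L.measurePreserving.comp measurePreserving_ptEquiv)

theorem setIntegral_chart (Q : E3) (L : E3 ≃ₗᵢ[ℝ] E3) {V : Type*} [NormedAddCommGroup V]
    [NormedSpace ℝ V] (f : E3 → V) (s : Set E3) :
    ∫ x in s, f x = ∫ z in chart Q L ⁻¹' s, f (chart Q L z) :=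
  ((measurePreserving_chart Q L).setIntegral_preimage_emb
    (chart Q L).measurableEmbedding f s).symm

theorem contDiff_chart_symm (Q : E3) (L : E3 ≃ₗᵢ[ℝ] E3) {n : WithTop ℕ∞} :
    ContDiff ℝ n (chart Q L).symm :=
  ptEquiv.symm.contDiff.comp (L.symm.contDiff.comp (contDiff_const.add contDiff_id))

theorem fderiv_comp_chart_symm {V : Type*} [NormedAddCommGroup V] [NormedSpace ℝ V]
    (Q : E3) (L : E3 ≃ₗᵢ[ℝ] E3) {ψ : E2 × ℝ → V} (hψ : Differentiable ℝ ψ) (z v : E2 × ℝ) :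
    fderiv ℝ (ψ ∘ (chart Q L).symm) (chart Q L z) (L (ptEquiv v)) = fderiv ℝ ψ z v := by
  have h1 : HasFDerivAt (chart Q L).symm ((ptEquiv.symm : E3 →L[ℝ] E2 × ℝ).comp
      (L.symm.toContinuousLinearEquiv : E3 →L[ℝ] E3)) (chart Q L z) := by
    have := (ptEquiv.symm.hasFDerivAt (x := L.symm (-Q + chart Q L z))).comp (chart Q L z)
      ((L.symm.toContinuousLinearEquiv.hasFDerivAt (x := -Q + chart Q L z)).comp (chart Q L z)
        ((hasFDerivAt_id (𝕜 := ℝ) (chart Q L z)).const_add (-Q)))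
    exact this
  have h2 : HasFDerivAt ψ (fderiv ℝ ψ z) ((chart Q L).symm (chart Q L z)) := by
    rw [Homeomorph.symm_apply_apply]
    exact (hψ z).hasFDerivAt
  rw [(h2.comp _ h1).fderiv]
  simp

/-! ### The gap between two graphs -/

/-- The part over the disc `|y| < σ` of the region between the graphs of `a` and `b`. -/
def gapRegion (a b : E2 → ℝ) (σ : ℝ) : Set (E2 × ℝ) :=
  {z | ‖z.1‖ < σ ∧ a z.1 < z.2 ∧ z.2 < b z.1}

theorem isOpen_gapRegion {a b : E2 → ℝ} (ha : Continuous a) (hb : Continuous b) (σ : ℝ) :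
    IsOpen (gapRegion a b σ) :=
  (isOpen_lt continuous_fst.norm continuous_const).and
    ((isOpen_lt (ha.comp continuous_fst) continuous_snd).and
      (isOpen_lt continuous_snd (hb.comp continuous_fst)))

/-- In the coordinates `chart Q L`, inside the cylinder `|y| < σ`, `|t| < τ`, the sets `Ω` and `S`
lie above the graphs of `a` and `b`, which stay in `|t| ≤ τ'`. -/
structure IsGapChart (Ω S : Set E3) (Q : E3) (L : E3 ≃ₗᵢ[ℝ] E3) (a b : E2 → ℝ)
    (σ τ τ' : ℝ) : Prop where
  isOpen_wall : IsOpen Ω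
  isOpen_body : IsOpen S
  mem_wall : ∀ y t, ‖y‖ < σ → |t| < τ → (chart Q L (y, t) ∈ Ω ↔ a y < t)
  mem_body : ∀ y t, ‖y‖ < σ → |t| < τ → (chart Q L (y, t) ∈ S ↔ b y < t)
  contDiff_wall : ContDiff ℝ 1 a
  contDiff_body : ContDiff ℝ 1 b
  wall_le : ∀ y, ‖y‖ < σ → |a y| ≤ τ'
  body_le : ∀ y, ‖y‖ < σ → |b y| ≤ τ'
  lt : τ' < τ
  subset : S ⊆ Ω

namespace IsGapChart

variable {Ω S : Set E3} {Q : E3} {L : E3 ≃ₗᵢ[ℝ] E3} {a b : E2 → ℝ} {σ τ τ' : ℝ}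

/-- Otherwise the point of the wall graph over `y` would lie above the body graph, hence in `S ⊆ Ω`,
although it is not in `Ω`. -/
theorem wall_le_body (h : IsGapChart Ω S Q L a b σ τ τ') {y : E2} (hy : ‖y‖ < σ) :
    a y ≤ b y := by
  by_contra! hlt
  have ht : |a y| < τ := (h.wall_le y hy).trans_lt h.lt
  exact lt_irrefl _ ((h.mem_wall y _ hy ht).1 (h.subset ((h.mem_body y _ hy ht).2 hlt)))

theorem abs_lt_of_mem_gapRegion (h : IsGapChart Ω S Q L a b σ τ τ') {z : E2 × ℝ}
    (hz : z ∈ gapRegion a b σ) : |z.2| < τ' := by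
  obtain ⟨h1, h2, h3⟩ := hz
  have := abs_le.1 (h.wall_le _ h1)
  have := abs_le.1 (h.body_le _ h1)
  exact abs_lt.2 ⟨by linarith, by linarith⟩

theorem chart_mem_of_mem_gapRegion (h : IsGapChart Ω S Q L a b σ τ τ') {z : E2 × ℝ}
    (hz : z ∈ gapRegion a b σ) : chart Q L z ∈ Ω \ closure S := by
  have hτ := (h.abs_lt_of_mem_gapRegion hz).trans h.lt
  refine ⟨(h.mem_wall z.1 z.2 hz.1 hτ).2 hz.2.1, fun hc => ?_⟩
  -- The image of the gap is open, so if it met the closure of `S` it would meet `S`, whose points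
  -- in the cylinder lie above the graph of `b`.
  rw [mem_closure_iff] at hc
  obtain ⟨x, ⟨z', hz', rfl⟩, hxS⟩ := hc _ ((chart Q L).isOpenMap _
    (isOpen_gapRegion h.contDiff_wall.continuous h.contDiff_body.continuous σ)) ⟨z, hz, rfl⟩
  have := (h.mem_body z'.1 z'.2 hz'.1 ((h.abs_lt_of_mem_gapRegion hz').trans h.lt)).1 hxS
  exact lt_asymm this hz'.2.2

end IsGapChart

/-! ### Splitting integrals between the gap and the body -/

theorem volume_graph_eq_zero {b : E2 → ℝ} (hb : Continuous b) :
    volume {z : E2 × ℝ | z.2 = b z.1} = 0 := by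
  have hm : MeasurableSet {z : E2 × ℝ | z.2 = b z.1} :=
    (isClosed_eq continuous_snd (hb.comp continuous_fst)).measurableSet
  rw [Measure.volume_eq_prod, Measure.measure_prod_null hm]
  refine Eventually.of_forall fun y => ?_
  have : Prod.mk y ⁻¹' {z : E2 × ℝ | z.2 = b z.1} = {b y} := by ext t; simp
  simp [this]

theorem setIntegral_above {b : E2 → ℝ} (hb : Continuous b) {f : E2 × ℝ → ℝ} (hf : Integrable f) :
    ∫ z in {z : E2 × ℝ | b z.1 < z.2}, f z = ∫ y, ∫ t in Set.Ioi (b y), f (y, t) := by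
  have hm : MeasurableSet {z : E2 × ℝ | b z.1 < z.2} :=
    (isOpen_lt (hb.comp continuous_fst) continuous_snd).measurableSet
  rw [← integral_indicator hm, Measure.volume_eq_prod, integral_prod _ (hf.indicator hm)]
  refine integral_congr_ae (Eventually.of_forall fun y => ?_)
  simp only
  rw [← integral_indicator measurableSet_Ioi]
  rfl

/-- Fubini reduces this to the fundamental theorem of calculus on vertical half-lines. Compact
support removes the contribution at infinity. -/
theorem integral_above_fderiv {b : E2 → ℝ} (hb : Continuous b) {w : E2 × ℝ → ℝ}
    (hw : ContDiff ℝ 1 w) (hc : HasCompactSupport w) :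
    ∫ z in {z : E2 × ℝ | b z.1 < z.2}, fderiv ℝ w z (0, 1) = - ∫ y, w (y, b y) := by
  have hi : Integrable fun z => fderiv ℝ w z (0, 1) :=
    ((hw.continuous_fderiv one_ne_zero).clm_apply
      continuous_const).integrable_of_hasCompactSupport (hc.fderiv_apply ℝ _)
  rw [setIntegral_above hb hi, ← integral_neg]
  refine integral_congr_ae (Eventually.of_forall fun y => ?_)
  have h1 : ContDiff ℝ 1 fun t => w (y, t) := hw.comp (contDiff_const.prodMk contDiff_id)
  have h2 : HasCompactSupport fun t => w (y, t) := by
    refine HasCompactSupport.of_support_subset_isCompact (hc.isCompact.image continuous_snd) ?_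
    exact fun t ht => ⟨(y, t), subset_tsupport _ ht, rfl⟩
  simp only
  rw [← h2.integral_Ioi_deriv_eq h1]
  refine integral_congr_ae (Eventually.of_forall fun t => ?_)
  have := ((hw.differentiable one_ne_zero (y, t)).hasFDerivAt.comp_hasDerivAt t
    ((hasDerivAt_const t y).prodMk (hasDerivAt_id t))).deriv
  exact this.symm

/-- Inside the cylinder, `Ω` consists of the gap, the body and the graph of `b`, which is a null
set. The integrand vanishes elsewhere. -/
theorem IsGapChart.setIntegral_eq_add {Ω S : Set E3} {Q : E3} {L : E3 ≃ₗᵢ[ℝ] E3}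
    {a b : E2 → ℝ} {σ τ τ' : ℝ} (h : IsGapChart Ω S Q L a b σ τ τ') {I : E3 → ℝ}
    (hI : IntegrableOn I Ω)
    (h0 : ∀ z : E2 × ℝ, ¬(‖z.1‖ < σ ∧ |z.2| < τ) → I (chart Q L z) = 0) :
    ∫ x in Ω, I x = (∫ z in gapRegion a b σ, I (chart Q L z)) +
      ∫ z in chart Q L ⁻¹' S ∩ {z | ‖z.1‖ < σ ∧ |z.2| < τ}, I (chart Q L z) := by
  set C : Set (E2 × ℝ) := {z | ‖z.1‖ < σ ∧ |z.2| < τ} with hC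
  have hCo : IsOpen C := (isOpen_lt continuous_fst.norm continuous_const).and
    (isOpen_lt continuous_snd.abs continuous_const)
  have hbc := h.contDiff_body.continuous
  have hJ : IntegrableOn (fun z => I (chart Q L z)) (chart Q L ⁻¹' Ω) :=
    ((measurePreserving_chart Q L).integrableOn_comp_preimage
      (chart Q L).measurableEmbedding).2 hI
  have hG : gapRegion a b σ ⊆ chart Q L ⁻¹' Ω := fun z hz =>
    (h.chart_mem_of_mem_gapRegion hz).1
  have hH : chart Q L ⁻¹' S ∩ C ⊆ chart Q L ⁻¹' Ω := fun z hz => h.subset hz.1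
  have hHeq : chart Q L ⁻¹' S ∩ C = {z | b z.1 < z.2} ∩ C := by
    ext z
    simp only [Set.mem_inter_iff, Set.mem_preimage, Set.mem_ofPred_eq, hC]
    exact and_congr_left fun hz => h.mem_body z.1 z.2 hz.1 hz.2
  have hHm : MeasurableSet (chart Q L ⁻¹' S ∩ C) := by
    rw [hHeq]
    exact ((isOpen_lt (hbc.comp continuous_fst) continuous_snd).inter hCo).measurableSet
  have hdisj : Disjoint (gapRegion a b σ) (chart Q L ⁻¹' S ∩ C) := by
    rw [hHeq, Set.disjoint_left]
    exact fun z hz hz' => lt_asymm hz.2.2 hz'.1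
  rw [setIntegral_chart Q L, ← setIntegral_union hdisj hHm (hJ.mono_set hG) (hJ.mono_set hH),
    ← setIntegral_eq_of_subset_of_ae_sdiff_eq_zero (s := gapRegion a b σ ∪ chart Q L ⁻¹' S ∩ C)
      (t := chart Q L ⁻¹' Ω)]
  · exact (h.isOpen_wall.preimage (chart Q L).continuous).measurableSet.nullMeasurableSet
  · exact Set.union_subset hG hH
  · have hnull : ∀ᵐ z : E2 × ℝ, z.2 ≠ b z.1 := by
      rw [ae_iff]
      simpa using volume_graph_eq_zero hbc
    filter_upwards [hnull] with z hz hzd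
    refine h0 z fun hzC => hzd.2 ?_
    have ha := (h.mem_wall z.1 z.2 hzC.1 hzC.2).1 hzd.1
    rcases lt_or_gt_of_ne hz with hlt | hgt
    · exact Or.inl ⟨hzC.1, ha, hlt⟩
    · exact Or.inr ⟨(h.mem_body z.1 z.2 hzC.1 hzC.2).2 hgt, hzC⟩

/-- The horizontal plane of the coordinates `chart Q L`. -/
noncomputable def hor (L : E3 ≃ₗᵢ[ℝ] E3) : E2 →L[ℝ] E3 :=
  ((L.toContinuousLinearEquiv : E3 →L[ℝ] E3).comp (ptEquiv : E2 × ℝ →L[ℝ] E3)).comp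
    (ContinuousLinearMap.inl ℝ E2 ℝ)

/-- The unit vector of the vertical axis of the coordinates `chart Q L`. -/
noncomputable def vert (L : E3 ≃ₗᵢ[ℝ] E3) : E3 := L (ptEquiv (0, 1))

theorem map_ptEquiv (L : E3 ≃ₗᵢ[ℝ] E3) (z : E2 × ℝ) :
    L (ptEquiv z) = hor L z.1 + z.2 • vert L := by
  have : z = (z.1, 0) + z.2 • ((0 : E2), (1 : ℝ)) := by ext <;> simp
  conv_lhs => rw [this]
  rw [map_add, map_smul, map_add, map_smul]
  rfl

theorem chart_eq (Q : E3) (L : E3 ≃ₗᵢ[ℝ] E3) (z : E2 × ℝ) :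
    chart Q L z = Q + (hor L z.1 + z.2 • vert L) := by
  rw [chart_apply, map_ptEquiv]

theorem inner_hor_hor (L : E3 ≃ₗᵢ[ℝ] E3) (y y' : E2) : ⟪hor L y, hor L y'⟫ = ⟪y, y'⟫ := by
  change ⟪L (ptEquiv (y, 0)), L (ptEquiv (y', 0))⟫ = _
  simp [inner_ptEquiv]

theorem norm_hor (L : E3 ≃ₗᵢ[ℝ] E3) (y : E2) : ‖hor L y‖ = ‖y‖ := by
  rw [norm_eq_sqrt_real_inner, inner_hor_hor, ← norm_eq_sqrt_real_inner]

theorem inner_hor_vert (L : E3 ≃ₗᵢ[ℝ] E3) (y : E2) : ⟪hor L y, vert L⟫ = 0 := by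
  change ⟪L (ptEquiv (y, 0)), L (ptEquiv (0, 1))⟫ = _
  simp [inner_ptEquiv]

theorem inner_vert_vert (L : E3 ≃ₗᵢ[ℝ] E3) : ⟪vert L, vert L⟫ = 1 := by
  change ⟪L (ptEquiv (0, 1)), L (ptEquiv (0, 1))⟫ = _
  rw [L.inner_map_map, inner_ptEquiv]
  simp

theorem norm_vert (L : E3 ≃ₗᵢ[ℝ] E3) : ‖vert L‖ = 1 := by
  rw [norm_eq_sqrt_real_inner, inner_vert_vert, Real.sqrt_one]

theorem tsupport_comp_chart_symm {V : Type*} [Zero V] (Q : E3) (L : E3 ≃ₗᵢ[ℝ] E3)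
    (ψ : E2 × ℝ → V) : tsupport (ψ ∘ (chart Q L).symm) = chart Q L '' tsupport ψ := by
  rw [tsupport_comp_eq_preimage, (chart Q L).image_eq_preimage_symm]

theorem fderiv_inner_affine_chart (Q : E3) (L : E3 ≃ₗᵢ[ℝ] E3) {ψ : E2 × ℝ → E3} {z : E2 × ℝ}
    (hψ : DifferentiableAt ℝ ψ z) (V P : E3) (A : E3 →L[ℝ] E3) :
    fderiv ℝ (fun z => ⟪ψ z, V + A (chart Q L z - P)⟫) z (0, 1) =
      ⟪fderiv ℝ ψ z (0, 1), V + A (chart Q L z - P)⟫ + ⟪ψ z, A (vert L)⟫ := by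
  set B : E2 × ℝ →L[ℝ] E3 :=
    (L.toContinuousLinearEquiv : E3 →L[ℝ] E3).comp (ptEquiv : E2 × ℝ →L[ℝ] E3) with hB
  have hUd : HasFDerivAt (fun z => V + A (chart Q L z - P)) (A.comp B) z := by
    refine HasFDerivAt.const_add _ (A.hasFDerivAt.comp z (HasFDerivAt.sub_const _ ?_))
    exact B.hasFDerivAt.const_add Q
  rw [(hψ.hasFDerivAt.inner ℝ hUd).fderiv, ContinuousLinearMap.comp_apply, fderivInnerCLM_apply,
    add_comm]
  rfl

/-! ### Integration by parts across the gap -/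

namespace IsGapChart

variable {Ω S : Set E3} {Q : E3} {L : E3 ≃ₗᵢ[ℝ] E3} {a b : E2 → ℝ} {σ τ τ' : ℝ}
  {u : E3 → E3} {Du : E3 → E3 →L[ℝ] E3} {V P : E3} {A : E3 →L[ℝ] E3}

theorem ae_restrict_preimage (Q : E3) (L : E3 ≃ₗᵢ[ℝ] E3) {S : Set E3} (hS : IsOpen S)
    {p : E3 → Prop} (hp : ∀ᵐ x ∂(volume.restrict S), p x) (C : Set (E2 × ℝ)) :
    ∀ᵐ z ∂(volume.restrict (chart Q L ⁻¹' S ∩ C)), p (chart Q L z) :=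
  ae_mono (Measure.restrict_mono Set.inter_subset_left le_rfl) <|
    ((measurePreserving_chart Q L).restrict_preimage
      hS.measurableSet).quasiMeasurePreserving.ae hp

/-- Integration by parts across the gap in the vertical direction. -/
theorem integral_gap_vertical (h : IsGapChart Ω S Q L a b σ τ τ') (hu : MemW120 Ω u Du)
    (hrig : ∀ᵐ x ∂(volume.restrict S), u x = V + A (x - P)) {ψ : E2 × ℝ → E3}
    (hψ : ContDiff ℝ 1 ψ) (hc : HasCompactSupport ψ)
    (hs : ∀ z ∈ tsupport ψ, ‖z.1‖ < σ ∧ |z.2| < τ) :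
    ∫ z in gapRegion a b σ, (⟪fderiv ℝ ψ z (0, 1), u (chart Q L z)⟫ +
      ⟪ψ z, Du (chart Q L z) (vert L)⟫) =
    ∫ y, ⟪ψ (y, b y), V + A (chart Q L (y, b y) - P)⟫ := by
  set Φ : E3 → E3 := ψ ∘ (chart Q L).symm with hΦ
  have hΦ1 : ContDiff ℝ 1 Φ := hψ.comp (contDiff_chart_symm Q L)
  have hΦc : HasCompactSupport Φ := hc.comp_homeomorph _
  have hi1 : IntegrableOn (fun x => ⟪fderiv ℝ Φ x (vert L), u x⟫) Ω :=
    integrable_inner_of_memLp_two (hΦ1.memLp_fderiv_apply hΦc _ 2 _) hu.2.1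
  have hi2 : IntegrableOn (fun x => ⟪Φ x, Du x (vert L)⟫) Ω :=
    integrable_inner_of_memLp_two (hΦ1.continuous.memLp_of_hasCompactSupport hΦc)
      (hu.2.2.1.clm_apply_const _)
  -- The integral over all of `Ω` vanishes, with no wall term. The gap integral is therefore minus
  -- the integral over the body, where the field is explicit.
  have hzero : ∫ x in Ω, (⟪fderiv ℝ Φ x (vert L), u x⟫ + ⟪Φ x, Du x (vert L)⟫) = 0 := by
    rw [integral_add hi1 hi2, hu.integral_inner hΦ1 hΦc, neg_add_cancel]
  have hfd : ∀ z, fderiv ℝ Φ (chart Q L z) (vert L) = fderiv ℝ ψ z (0, 1) := fun z =>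
    fderiv_comp_chart_symm Q L (hψ.differentiable one_ne_zero) z (0, 1)
  have hΦa : ∀ z, Φ (chart Q L z) = ψ z := fun z => by simp [hΦ]
  rw [h.setIntegral_eq_add (I := fun x => ⟪fderiv ℝ Φ x (vert L), u x⟫ + ⟪Φ x, Du x (vert L)⟫)
    (hi1.add hi2)] at hzero
  swap
  · intro z hz
    have hz' : z ∉ tsupport ψ := fun hm => hz (hs z hm)
    simp only [hfd, hΦa, fderiv_of_notMem_tsupport ℝ hz',
      image_eq_zero_of_notMem_tsupport hz']
    simp
  simp only [hfd, hΦa] at hzero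
  rw [eq_neg_of_add_eq_zero_left hzero, neg_eq_iff_eq_neg]
  -- On the body the integrand is the exact vertical derivative of `w`, so integrating it leaves
  -- only the values of `w` on the graph of `b`.
  have hgrad : ∀ᵐ x ∂(volume.restrict S), Du x (vert L) = A (vert L) :=
    hu.1.ae_apply_eq_of_ae_eq_affine h.isOpen_body h.subset (c := V - A P)
      (hrig.mono fun x hx => by rw [hx, map_sub]; abel) _
  have hU1 : ContDiff ℝ 1 fun z => V + A (chart Q L z - P) := by
    refine contDiff_const.add (A.contDiff.comp (ContDiff.sub ?_ contDiff_const))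
    exact contDiff_const.add (L.contDiff.comp ptEquiv.contDiff)
  set w : E2 × ℝ → ℝ := fun z => ⟪ψ z, V + A (chart Q L z - P)⟫ with hw
  have hw1 : ContDiff ℝ 1 w := hψ.inner ℝ hU1
  have hwc : HasCompactSupport w := by
    refine HasCompactSupport.of_support_subset_isCompact hc.isCompact fun z hz => ?_
    exact subset_tsupport _ fun h0 => hz (by simp [hw, h0])
  have hwd : ∀ z, fderiv ℝ w z (0, 1) =
      ⟪fderiv ℝ ψ z (0, 1), V + A (chart Q L z - P)⟫ + ⟪ψ z, A (vert L)⟫ :=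
    fun z => fderiv_inner_affine_chart Q L (hψ.differentiable one_ne_zero z) V P A
  rw [← integral_above_fderiv h.contDiff_body.continuous hw1 hwc]
  have hH : ∫ z in chart Q L ⁻¹' S ∩ {z | ‖z.1‖ < σ ∧ |z.2| < τ},
      (⟪fderiv ℝ ψ z (0, 1), u (chart Q L z)⟫ + ⟪ψ z, Du (chart Q L z) (vert L)⟫) =
      ∫ z in chart Q L ⁻¹' S ∩ {z | ‖z.1‖ < σ ∧ |z.2| < τ}, fderiv ℝ w z (0, 1) := by
    refine integral_congr_ae ?_
    filter_upwards [ae_restrict_preimage Q L h.isOpen_body hrig _,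
      ae_restrict_preimage Q L h.isOpen_body hgrad _] with z h1 h2
    rw [hwd, h1, h2]
  rw [hH]
  have hsub : chart Q L ⁻¹' S ∩ {z | ‖z.1‖ < σ ∧ |z.2| < τ} ⊆ {z | b z.1 < z.2} :=
    fun z hz => (h.mem_body z.1 z.2 hz.2.1 hz.2.2).1 hz.1
  refine (setIntegral_eq_of_subset_of_forall_sdiff_eq_zero
    (isOpen_lt (h.contDiff_body.continuous.comp continuous_fst) continuous_snd).measurableSet
    hsub fun z hz => ?_).symm
  have hz' : z ∉ tsupport ψ := fun hm =>
    hz.2 ⟨(h.mem_body z.1 z.2 (hs z hm).1 (hs z hm).2).2 hz.1, hs z hm⟩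
  rw [hwd, fderiv_of_notMem_tsupport ℝ hz', image_eq_zero_of_notMem_tsupport hz']
  simp

/-- The flux through the gap of a divergence-free field which is affine above the gap. -/
theorem integral_gap_flux (h : IsGapChart Ω S Q L a b σ τ τ') (hu : MemW120 Ω u Du)
    (hdiv : DivFree Ω Du) (hrig : ∀ᵐ x ∂(volume.restrict S), u x = V + A (x - P))
    {ψ : E2 × ℝ → ℝ} (hψ : ContDiff ℝ 1 ψ) (hc : HasCompactSupport ψ)
    (hs : ∀ z ∈ tsupport ψ, ‖z.1‖ < σ ∧ |z.2| < τ) :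
    (∫ z in gapRegion a b σ, fderiv ℝ ψ z (ptEquiv.symm (L.symm (u (chart Q L z))))) +
    ∫ z in {z | b z.1 < z.2}, fderiv ℝ ψ z (ptEquiv.symm (L.symm (V + A (chart Q L z - P)))) =
      0 := by
  set Φ : E3 → ℝ := ψ ∘ (chart Q L).symm with hΦ
  have hΦ1 : ContDiff ℝ 1 Φ := hψ.comp (contDiff_chart_symm Q L)
  have hΦc : HasCompactSupport Φ := hc.comp_homeomorph _
  have hi : IntegrableOn (fun x => fderiv ℝ Φ x (u x)) Ω := by
    have hf : MemLp (fderiv ℝ Φ) 2 (volume.restrict Ω) :=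
      (hΦ1.continuous_fderiv one_ne_zero).memLp_of_hasCompactSupport (hΦc.fderiv ℝ)
    refine memLp_one_iff_integrable.1 <| MemLp.of_bilin (fun (T : E3 →L[ℝ] ℝ) x => T x) 1 hf hu.2.1
      ?_ (Eventually.of_forall fun x => ?_)
    · exact (ContinuousLinearMap.id ℝ (E3 →L[ℝ] ℝ)).aestronglyMeasurable_comp₂ hf.1 hu.2.1.1
    · simpa using (fderiv ℝ Φ x).le_opNNNorm (u x)
  have hfd : ∀ z v, fderiv ℝ Φ (chart Q L z) v = fderiv ℝ ψ z (ptEquiv.symm (L.symm v)) := by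
    intro z v
    rw [← fderiv_comp_chart_symm Q L (hψ.differentiable one_ne_zero)]
    simp [hΦ]
  have hzero := hu.integral_fderiv_apply_eq_zero hdiv hΦ1 hΦc
  rw [h.setIntegral_eq_add hi] at hzero
  swap
  · intro z hz
    have hz' : z ∉ tsupport ψ := fun hm => hz (hs z hm)
    simp [hfd, fderiv_of_notMem_tsupport ℝ hz']
  simp only [hfd] at hzero
  rw [← hzero]
  congr 1
  have hH : ∫ z in chart Q L ⁻¹' S ∩ {z | ‖z.1‖ < σ ∧ |z.2| < τ},
      fderiv ℝ ψ z (ptEquiv.symm (L.symm (u (chart Q L z)))) =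
      ∫ z in chart Q L ⁻¹' S ∩ {z | ‖z.1‖ < σ ∧ |z.2| < τ},
        fderiv ℝ ψ z (ptEquiv.symm (L.symm (V + A (chart Q L z - P)))) := by
    refine integral_congr_ae ?_
    filter_upwards [ae_restrict_preimage Q L h.isOpen_body hrig _] with z h1
    rw [h1]
  rw [hH]
  -- The part over the body may be extended to the whole region above the graph of `b`, with the
  -- rigid field in place of `u`, since `ψ` vanishes outside the cylinder.
  have hsub : chart Q L ⁻¹' S ∩ {z | ‖z.1‖ < σ ∧ |z.2| < τ} ⊆ {z | b z.1 < z.2} :=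
    fun z hz => (h.mem_body z.1 z.2 hz.2.1 hz.2.2).1 hz.1
  refine setIntegral_eq_of_subset_of_forall_sdiff_eq_zero
    (isOpen_lt (h.contDiff_body.continuous.comp continuous_fst) continuous_snd).measurableSet
    hsub fun z hz => ?_
  have hz' : z ∉ tsupport ψ := fun hm =>
    hz.2 ⟨(h.mem_body z.1 z.2 (hs z hm).1 (hs z hm).2).2 hz.1, hs z hm⟩
  simp [fderiv_of_notMem_tsupport ℝ hz']

end IsGapChart

/-- A smooth function vanishing near `(-∞, 1)` and equal to `x` for `x ≥ 2`. -/
noncomputable def softRamp (x : ℝ) : ℝ := x * Real.smoothTransition (x - 1)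

theorem contDiff_softRamp : ContDiff ℝ 1 softRamp :=
  contDiff_id.mul (Real.smoothTransition.contDiff.comp (contDiff_id.sub contDiff_const))

theorem softRamp_of_le {x : ℝ} (hx : x ≤ 1) : softRamp x = 0 := by
  simp [softRamp, Real.smoothTransition.zero_of_nonpos (show x - 1 ≤ 0 by linarith)]

theorem softRamp_of_ge {x : ℝ} (hx : 2 ≤ x) : softRamp x = x := by
  simp [softRamp, Real.smoothTransition.one_of_one_le (show 1 ≤ x - 1 by linarith)]

theorem abs_softRamp_le {x : ℝ} : |softRamp x| ≤ |x| := by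
  rw [softRamp, abs_mul]
  refine mul_le_of_le_one_right (abs_nonneg _) ?_
  rw [abs_of_nonneg (Real.smoothTransition.nonneg _)]
  exact Real.smoothTransition.le_one _

theorem deriv_softRamp_of_lt {x : ℝ} (hx : x < 1) : deriv softRamp x = 0 := by
  have : softRamp =ᶠ[𝓝 x] fun _ => 0 :=
    (eventually_lt_nhds hx).mono fun y hy => softRamp_of_le hy.le
  rw [this.deriv_eq, deriv_const]

theorem deriv_softRamp_of_gt {x : ℝ} (hx : 2 < x) : deriv softRamp x = 1 := by
  have : softRamp =ᶠ[𝓝 x] id := (eventually_gt_nhds hx).mono fun y hy => softRamp_of_ge hy.le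
  rw [this.deriv_eq, deriv_id]

theorem exists_abs_deriv_softRamp_le : ∃ C : ℝ, ∀ x, |deriv softRamp x| ≤ C := by
  have hc : Continuous (deriv softRamp) := contDiff_softRamp.continuous_deriv le_rfl
  obtain ⟨C, hC⟩ := (isCompact_Icc (a := (1 : ℝ)) (b := 2)).exists_bound_of_continuousOn
    hc.continuousOn
  refine ⟨max C 1, fun x => ?_⟩
  rcases lt_or_ge x 1 with h1 | h1
  · rw [deriv_softRamp_of_lt h1]; simp
  rcases lt_or_ge 2 x with h2 | h2
  · rw [deriv_softRamp_of_gt h2]; simp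
  · exact (hC x ⟨h1, h2⟩).trans (le_max_left _ _)

/-! ### Volume of the gap and Cauchy–Schwarz -/

theorem volume_gapRegion_le {a b : E2 → ℝ} (ha : Continuous a) (hb : Continuous b) {σ d : ℝ}
    (hσ : 0 ≤ σ) (hd : 0 ≤ d) (hab : ∀ y, ‖y‖ < σ → b y - a y ≤ d) :
    volume (gapRegion a b σ) ≤ ENNReal.ofReal (d * (σ ^ 2 * Real.pi)) := by
  rw [Measure.volume_eq_prod, Measure.prod_apply (isOpen_gapRegion ha hb σ).measurableSet]
  have hle : ∀ y, volume (Prod.mk y ⁻¹' gapRegion a b σ) ≤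
      (Metric.ball (0 : E2) σ).indicator (fun _ => ENNReal.ofReal d) y := by
    intro y
    by_cases hy : ‖y‖ < σ
    · rw [Set.indicator_of_mem (by simpa using hy)]
      have : Prod.mk y ⁻¹' gapRegion a b σ ⊆ Set.Ioo (a y) (b y) := fun t ht => ht.2
      refine (measure_mono this).trans ?_
      rw [Real.volume_Ioo]
      exact ENNReal.ofReal_le_ofReal (hab y hy)
    · have : Prod.mk y ⁻¹' gapRegion a b σ = ∅ := by
        ext t
        simpa [gapRegion] using fun h => absurd h hy
      simp [this]
  refine (lintegral_mono hle).trans ?_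
  rw [lintegral_indicator Metric.isOpen_ball.measurableSet, lintegral_const,
    Measure.restrict_apply_univ, EuclideanSpace.volume_ball_fin_two, ENNReal.ofReal_mul hd,
    ENNReal.ofReal_mul (by positivity), ENNReal.ofReal_pow hσ]

/-- Cauchy–Schwarz in the measure-preserving coordinates. The factor `√m` is the gain from the small
volume of the gap. -/
theorem integral_norm_le_sqrt_mul_L2norm {W : Type*} [NormedAddCommGroup W] {Q : E3}
    {L : E3 ≃ₗᵢ[ℝ] E3} {G : Set (E2 × ℝ)} {B : Set E3} (hGB : ∀ z ∈ G, chart Q L z ∈ B)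
    {f : E3 → W} (hf : MemLp f 2 (volume.restrict B)) (hB : MeasurableSet B) {m : ℝ} (hm : 0 ≤ m)
    (hG : volume G ≤ ENNReal.ofReal m) :
    IntegrableOn (fun z => f (chart Q L z)) G ∧
      ∫ z in G, ‖f (chart Q L z)‖ ≤ √m * L2norm f B := by
  have hmp := (measurePreserving_chart Q L).restrict_preimage hB
  have hle : volume.restrict G ≤ volume.restrict (chart Q L ⁻¹' B) :=
    Measure.restrict_mono hGB le_rfl
  have hfc : MemLp (fun z => f (chart Q L z)) 2 (volume.restrict (chart Q L ⁻¹' B)) :=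
    hf.comp_measurePreserving hmp
  have hfG : MemLp (fun z => f (chart Q L z)) 2 (volume.restrict G) := hfc.mono_measure hle
  have hfin : IsFiniteMeasure (volume.restrict G) :=
    ⟨by rw [Measure.restrict_apply_univ]; exact hG.trans_lt ENNReal.ofReal_lt_top⟩
  have hint : IntegrableOn (fun z => f (chart Q L z)) G :=
    memLp_one_iff_integrable.1 (hfG.mono_exponent (by norm_num))
  refine ⟨hint, ?_⟩
  have h1 := eLpNorm_le_eLpNorm_mul_rpow_measure_univ (p := 1) (q := 2) (by norm_num) hfG.1
  have h2 : eLpNorm (fun z => f (chart Q L z)) 2 (volume.restrict G) ≤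
      eLpNorm f 2 (volume.restrict B) := by
    refine (eLpNorm_mono_measure _ hle).trans ?_
    exact (eLpNorm_comp_measurePreserving hf.1 hmp).le
  have h3 : (volume.restrict G) Set.univ ^ (1 / (1 : ENNReal).toReal - 1 / (2 : ENNReal).toReal) ≤
      ENNReal.ofReal √m := by
    rw [Measure.restrict_apply_univ, Real.sqrt_eq_rpow, ← ENNReal.ofReal_rpow_of_nonneg hm
      (by norm_num)]
    norm_num
    exact ENNReal.rpow_le_rpow hG (by norm_num)
  have h4 := h1.trans (mul_le_mul' h2 h3)
  rw [integral_norm_eq_lintegral_enorm hint.1, ← eLpNorm_one_eq_lintegral_enorm]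
  refine (ENNReal.toReal_mono (ENNReal.mul_ne_top hf.2.ne ENNReal.ofReal_ne_top) h4).trans ?_
  rw [ENNReal.toReal_mul, ENNReal.toReal_ofReal (Real.sqrt_nonneg _), mul_comm]
  rfl

namespace IsGapChart

variable {Ω S : Set E3} {Q : E3} {L : E3 ≃ₗᵢ[ℝ] E3} {a b : E2 → ℝ} {σ τ τ' : ℝ}
  {Du : E3 → E3 →L[ℝ] E3} {D2u : E3 → E3 →L[ℝ] E3 →L[ℝ] E3}

/-- Integration by parts in the gap against a field with compact support in the gap. -/
theorem integral_gap_second_of_tsupport (h : IsGapChart Ω S Q L a b σ τ τ')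
    (hw : HasWeakGradient (Ω \ closure S) Du D2u)
    (hDu : MemLp Du 2 (volume.restrict (Ω \ closure S)))
    (hD2u : MemLp D2u 2 (volume.restrict (Ω \ closure S))) {ψ : E2 × ℝ → E3}
    (hψ : ContDiff ℝ 1 ψ) (hc : HasCompactSupport ψ) (hs : tsupport ψ ⊆ gapRegion a b σ) :
    ∫ z in gapRegion a b σ, ⟪fderiv ℝ ψ z (0, 1), Du (chart Q L z) (vert L)⟫ =
      - ∫ z in gapRegion a b σ, ⟪ψ z, D2u (chart Q L z) (vert L) (vert L)⟫ := by
  have hF : IsOpen (Ω \ closure S) := h.isOpen_wall.sdiff isClosed_closure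
  have hGF : gapRegion a b σ ⊆ chart Q L ⁻¹' (Ω \ closure S) := fun z hz =>
    h.chart_mem_of_mem_gapRegion hz
  have hmeas : MeasurableSet (chart Q L ⁻¹' (Ω \ closure S)) :=
    (hF.preimage (chart Q L).continuous).measurableSet
  have key := hw.integral_inner_apply hF hDu hD2u (hψ.comp (contDiff_chart_symm Q L))
    (hc.comp_homeomorph (chart Q L).symm)
    (by
      rw [tsupport_comp_chart_symm]
      rintro _ ⟨z, hz, rfl⟩
      exact hGF (hs hz)) (vert L) (vert L)
  have hfd : ∀ z, fderiv ℝ (ψ ∘ (chart Q L).symm) (chart Q L z) (vert L) =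
      fderiv ℝ ψ z (0, 1) := fun z =>
    fderiv_comp_chart_symm Q L (hψ.differentiable one_ne_zero) z (0, 1)
  rw [setIntegral_chart Q L, setIntegral_chart Q L] at key
  simp only [hfd, Function.comp_apply, Homeomorph.symm_apply_apply] at key
  rw [setIntegral_eq_of_subset_of_forall_sdiff_eq_zero hmeas hGF,
    setIntegral_eq_of_subset_of_forall_sdiff_eq_zero hmeas hGF] at key
  · exact key
  · intro z hz
    simp [image_eq_zero_of_notMem_tsupport fun hm => hz.2 (hs hm)]
  · intro z hz
    simp [fderiv_of_notMem_tsupport ℝ fun hm => hz.2 (hs hm)]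

/-- The weight vanishing at both ends of the vertical segments of the gap. -/
noncomputable def _root_.gapWeight (a b : E2 → ℝ) (z : E2 × ℝ) : ℝ :=
  (z.2 - a z.1) * (b z.1 - z.2) / 2

theorem _root_.abs_softRamp_mul_div_le {n : ℝ} (hn : 0 < n) (s : ℝ) :
    |softRamp (n * s) / n| ≤ |s| := by
  rw [abs_div, abs_of_pos hn, div_le_iff₀ hn]
  refine abs_softRamp_le.trans ?_
  rw [abs_mul, abs_of_pos hn, mul_comm]

/-- The weight has vertical derivative `(a + b)/2 - t` and vanishes on both graphs, so no boundary
term should appear. Since `D2u` can only be tested with compact support in the fluid, the weight `θ`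
is replaced by `softRamp (n θ) / n`. This vanishes near both graphs, has vertical derivative bounded
uniformly in `n`, and at each point of the gap agrees with `θ` once `n` is large. Dominated
convergence gives the limit. -/
theorem integral_gap_second (h : IsGapChart Ω S Q L a b σ τ τ')
    (hw : HasWeakGradient (Ω \ closure S) Du D2u)
    (hDu : MemLp Du 2 (volume.restrict (Ω \ closure S)))
    (hD2u : MemLp D2u 2 (volume.restrict (Ω \ closure S))) {v : E2 → E3}
    (hv : ContDiff ℝ 1 v) (hc : HasCompactSupport v) (hs : ∀ y ∈ tsupport v, ‖y‖ < σ)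
    (hσ : 0 < σ) (hτ' : 0 ≤ τ') :
    ∫ z in gapRegion a b σ, ⟪((a z.1 + b z.1) / 2 - z.2) • v z.1, Du (chart Q L z) (vert L)⟫ =
      - ∫ z in gapRegion a b σ,
        ⟪gapWeight a b z • v z.1, D2u (chart Q L z) (vert L) (vert L)⟫ := by
  have hac := h.contDiff_wall
  have hbc := h.contDiff_body
  have hGm := (isOpen_gapRegion hac.continuous hbc.continuous σ).measurableSet
  have hθ1 : ContDiff ℝ 1 (gapWeight a b) := by
    unfold gapWeight
    have h1 : ContDiff ℝ 1 fun z : E2 × ℝ => a z.1 := hac.comp contDiff_fst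
    have h2 : ContDiff ℝ 1 fun z : E2 × ℝ => b z.1 := hbc.comp contDiff_fst
    exact ((contDiff_snd.sub h1).mul (h2.sub contDiff_snd)).div_const 2
  have hθd : ∀ z, fderiv ℝ (gapWeight a b) z (0, 1) = (a z.1 + b z.1) / 2 - z.2 := by
    intro z
    have h1 := (hθ1.differentiable one_ne_zero (z.1, z.2)).hasFDerivAt.comp_hasDerivAt z.2
      ((hasDerivAt_const z.2 z.1).prodMk (hasDerivAt_id z.2))
    have h2 : HasDerivAt (fun t => (t - a z.1) * (b z.1 - t) / 2)
        ((1 * (b z.1 - z.2) + (z.2 - a z.1) * (0 - 1)) / 2) z.2 :=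
      ((((hasDerivAt_id z.2).sub_const _).mul
        ((hasDerivAt_const z.2 (b z.1)).sub (hasDerivAt_id z.2))).div_const 2)
    have h3 := h1.unique h2
    rw [show fderiv ℝ (gapWeight a b) z (0, 1) = _ from h3]
    ring
  let Θ : ℕ → E2 × ℝ → E3 := fun n z =>
    (softRamp ((n + 1 : ℝ) * gapWeight a b z) / (n + 1 : ℝ)) • v z.1
  have hΘ1 : ∀ n, ContDiff ℝ 1 (Θ n) := fun n =>
    ((contDiff_softRamp.comp (contDiff_const.mul hθ1)).div_const _).smul (hv.comp contDiff_fst)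
  have hΘd : ∀ n z, fderiv ℝ (Θ n) z (0, 1) =
      (deriv softRamp ((n + 1 : ℝ) * gapWeight a b z) * ((a z.1 + b z.1) / 2 - z.2)) • v z.1 := by
    intro n z
    have hn : (n + 1 : ℝ) ≠ 0 := by positivity
    have h1 := ((hΘ1 n).differentiable one_ne_zero (z.1, z.2)).hasFDerivAt.comp_hasDerivAt z.2
      ((hasDerivAt_const z.2 z.1).prodMk (hasDerivAt_id z.2))
    have h0 := (hθ1.differentiable one_ne_zero (z.1, z.2)).hasFDerivAt.comp_hasDerivAt z.2
      ((hasDerivAt_const z.2 z.1).prodMk (hasDerivAt_id z.2))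
    have h0' : HasDerivAt (fun t => gapWeight a b (z.1, t)) ((a z.1 + b z.1) / 2 - z.2) z.2 := by
      rw [← hθd]; exact h0
    have h2 := ((((contDiff_softRamp.differentiable one_ne_zero _).hasDerivAt.comp z.2
      (h0'.const_mul (n + 1 : ℝ))).div_const (n + 1 : ℝ)).smul_const (v z.1))
    have h3 := h1.unique h2
    rw [show fderiv ℝ (Θ n) z (0, 1) = _ from h3]
    congr 1
    field_simp
  have hsub : ∀ n : ℕ, tsupport (Θ n) ⊆
      {z | z.1 ∈ tsupport v ∧ 1 ≤ (n + 1 : ℝ) * gapWeight a b z} := by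
    intro n
    refine closure_minimal (fun z hz => ?_) ?_
    · refine ⟨subset_tsupport _ fun h0 => hz (by simp [Θ, h0]), ?_⟩
      by_contra! hlt
      exact hz (by simp [Θ, softRamp_of_le hlt.le])
    · exact ((isClosed_tsupport v).preimage continuous_fst).and
        (isClosed_le continuous_const (continuous_const.mul hθ1.continuous))
  have hgap : ∀ n : ℕ, {z | z.1 ∈ tsupport v ∧ 1 ≤ (n + 1 : ℝ) * gapWeight a b z} ⊆
      gapRegion a b σ := by
    rintro n z ⟨hz1, hz2⟩
    have hσz := hs _ hz1
    have hle := h.wall_le_body hσz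
    have hn : (0 : ℝ) < n + 1 := by positivity
    have hpos : 0 < gapWeight a b z := pos_of_mul_pos_right (one_pos.trans_le hz2) hn.le
    have hpos' : 0 < (z.2 - a z.1) * (b z.1 - z.2) := by unfold gapWeight at hpos; linarith
    -- A positive product allows both factors to be negative. That would put the body graph strictly
    -- below the wall graph, which `wall_le_body` excludes.
    rcases mul_pos_iff.1 hpos' with h1 | h1
    · exact ⟨hσz, by linarith, by linarith⟩
    · linarith
  have hΘc : ∀ n, HasCompactSupport (Θ n) := by
    intro n
    refine HasCompactSupport.of_support_subset_isCompact
      (hc.isCompact.prod (isCompact_Icc (a := -τ') (b := τ'))) fun z hz => ?_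
    have hm := hsub n (subset_tsupport _ hz)
    have := abs_le.1 (h.abs_lt_of_mem_gapRegion (hgap n hm)).le
    exact ⟨hm.1, this⟩
  have hid := fun n => h.integral_gap_second_of_tsupport hw hDu hD2u (hΘ1 n) (hΘc n)
    ((hsub n).trans (hgap n))
  obtain ⟨M, hM⟩ := hv.continuous.bounded_above_of_compact_support hc
  obtain ⟨C, hC⟩ := exists_abs_deriv_softRamp_le
  have hM0 : 0 ≤ M := (norm_nonneg _).trans (hM 0)
  have hC0 : 0 ≤ C := (abs_nonneg _).trans (hC 0)
  have hFm : MeasurableSet (Ω \ closure S) :=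
    (h.isOpen_wall.sdiff isClosed_closure).measurableSet
  have hvol := volume_gapRegion_le hac.continuous hbc.continuous (d := 2 * τ') hσ.le
    (by positivity) fun y hy => by
      have := abs_le.1 (h.wall_le y hy)
      have := abs_le.1 (h.body_le y hy)
      linarith
  have hi1 := (integral_norm_le_sqrt_mul_L2norm (fun z hz => h.chart_mem_of_mem_gapRegion hz)
    (hDu.clm_apply_const (vert L)) hFm (by positivity) hvol).1
  have hi2 := (integral_norm_le_sqrt_mul_L2norm (fun z hz => h.chart_mem_of_mem_gapRegion hz)
    ((hD2u.clm_apply_const (vert L)).clm_apply_const (vert L)) hFm (by positivity) hvol).1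
  have hmid : ∀ z ∈ gapRegion a b σ, |(a z.1 + b z.1) / 2 - z.2| ≤ 2 * τ' := by
    intro z hz
    have := abs_le.1 (h.wall_le _ hz.1)
    have := abs_le.1 (h.body_le _ hz.1)
    have := abs_le.1 (h.abs_lt_of_mem_gapRegion hz).le
    exact abs_le.2 ⟨by linarith, by linarith⟩
  have hwt : ∀ z ∈ gapRegion a b σ, 0 < gapWeight a b z ∧ gapWeight a b z ≤ 2 * τ' * τ' := by
    intro z hz
    have h1 := abs_le.1 (h.wall_le _ hz.1)
    have h2 := abs_le.1 (h.body_le _ hz.1)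
    have h3 := abs_le.1 (h.abs_lt_of_mem_gapRegion hz).le
    have h4 : 0 < z.2 - a z.1 := by linarith [hz.2.1]
    have h5 : 0 < b z.1 - z.2 := by linarith [hz.2.2]
    refine ⟨by unfold gapWeight; positivity, ?_⟩
    have h6 : (z.2 - a z.1) * (b z.1 - z.2) ≤ (2 * τ') * (2 * τ') :=
      mul_le_mul (by linarith) (by linarith) h5.le (by linarith)
    unfold gapWeight
    linarith
  have hN : Tendsto (fun n : ℕ => (n : ℝ) + 1) atTop atTop :=
    tendsto_atTop_add_const_right _ _ tendsto_natCast_atTop_atTop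
  have hlim1 : Tendsto (fun n => ∫ z in gapRegion a b σ,
      ⟪fderiv ℝ (Θ n) z (0, 1), Du (chart Q L z) (vert L)⟫) atTop
      (𝓝 (∫ z in gapRegion a b σ,
        ⟪((a z.1 + b z.1) / 2 - z.2) • v z.1, Du (chart Q L z) (vert L)⟫)) := by
    refine tendsto_integral_of_dominated_convergence
      (fun z => C * (2 * τ') * M * ‖Du (chart Q L z) (vert L)‖) (fun n => ?_)
      (hi1.norm.const_mul _) (fun n => ?_) ?_
    · exact (((hΘ1 n).continuous_fderiv one_ne_zero).clm_apply
        continuous_const).aestronglyMeasurable.inner hi1.1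
    · filter_upwards [ae_restrict_mem hGm] with z hz
      refine (norm_inner_le_norm _ _).trans ?_
      rw [hΘd, norm_smul, norm_mul, Real.norm_eq_abs, Real.norm_eq_abs]
      gcongr
      · exact hC _
      · exact hmid z hz
      · exact hM _
    · filter_upwards [ae_restrict_mem hGm] with z hz
      refine tendsto_const_nhds.congr' ?_
      -- Beyond argument 2 the ramp is the identity, so at each fixed point the sequence is
      -- eventually constant.
      filter_upwards [(hN.atTop_mul_const (hwt z hz).1).eventually_gt_atTop 2] with n hn
      rw [hΘd, deriv_softRamp_of_gt hn, one_mul]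
  have hlim2 : Tendsto (fun n => ∫ z in gapRegion a b σ,
      ⟪Θ n z, D2u (chart Q L z) (vert L) (vert L)⟫) atTop
      (𝓝 (∫ z in gapRegion a b σ,
        ⟪gapWeight a b z • v z.1, D2u (chart Q L z) (vert L) (vert L)⟫)) := by
    refine tendsto_integral_of_dominated_convergence
      (fun z => 2 * τ' * τ' * M * ‖D2u (chart Q L z) (vert L) (vert L)‖) (fun n => ?_)
      (hi2.norm.const_mul _) (fun n => ?_) ?_
    · exact (hΘ1 n).continuous.aestronglyMeasurable.inner hi2.1
    · filter_upwards [ae_restrict_mem hGm] with z hz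
      refine (norm_inner_le_norm _ _).trans ?_
      simp only [Θ]
      rw [norm_smul, Real.norm_eq_abs]
      gcongr
      · refine (abs_softRamp_mul_div_le (by positivity) _).trans ?_
        rw [abs_of_pos (hwt z hz).1]
        exact (hwt z hz).2
      · exact hM _
    · filter_upwards [ae_restrict_mem hGm] with z hz
      refine tendsto_const_nhds.congr' ?_
      filter_upwards [(hN.atTop_mul_const (hwt z hz).1).eventually_gt_atTop 2] with n hn
      have hn0 : (n + 1 : ℝ) ≠ 0 := by positivity
      simp only [Θ]
      rw [softRamp_of_ge hn.le, mul_div_cancel_left₀ _ hn0]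
  exact tendsto_nhds_unique hlim1 (hlim2.neg.congr fun n => (hid n).symm)

end IsGapChart

/-! ### Radial cutoff functions in the plane -/

/-- A smooth cutoff function on the half-line: `1` up to `1/4` and `0` from `1/2` on. -/
noncomputable def cutoffProfile (s : ℝ) : ℝ := Real.smoothTransition (2 - 4 * s)

theorem contDiff_cutoffProfile {n : ℕ∞} : ContDiff ℝ n cutoffProfile :=
  Real.smoothTransition.contDiff.comp (contDiff_const.sub (contDiff_const.mul contDiff_id))

theorem cutoffProfile_of_ge {s : ℝ} (hs : 1 / 2 ≤ s) : cutoffProfile s = 0 :=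
  Real.smoothTransition.zero_of_nonpos (by linarith)

theorem deriv_cutoffProfile_of_gt {s : ℝ} (hs : 1 / 2 < s) : deriv cutoffProfile s = 0 := by
  have : cutoffProfile =ᶠ[𝓝 s] fun _ => 0 :=
    (eventually_gt_nhds hs).mono fun y hy => cutoffProfile_of_ge hy.le
  rw [this.deriv_eq, deriv_const]

theorem deriv_cutoffProfile_of_lt {s : ℝ} (hs : s < 1 / 4) : deriv cutoffProfile s = 0 := by
  have : cutoffProfile =ᶠ[𝓝 s] fun _ => 1 :=
    (eventually_lt_nhds hs).mono fun y hy =>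
      Real.smoothTransition.one_of_one_le (by linarith)
  rw [this.deriv_eq, deriv_const]

theorem exists_abs_deriv_cutoffProfile_le : ∃ M, 0 < M ∧ ∀ s, |deriv cutoffProfile s| ≤ M := by
  have hc : Continuous (deriv cutoffProfile) :=
    (contDiff_cutoffProfile (n := 1)).continuous_deriv le_rfl
  obtain ⟨C, hC⟩ := (isCompact_Icc (a := (0 : ℝ)) (b := 1)).exists_bound_of_continuousOn
    hc.continuousOn
  have hC0 : 0 ≤ C := (norm_nonneg _).trans (hC 0 (by simp))
  refine ⟨C + 1, by positivity, fun x => ?_⟩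
  rcases lt_or_ge x 0 with h1 | h1
  · rw [deriv_cutoffProfile_of_lt (by linarith), abs_zero]; linarith
  rcases lt_or_ge 1 x with h2 | h2
  · rw [deriv_cutoffProfile_of_gt (by linarith), abs_zero]; linarith
  · exact (hC x ⟨h1, h2⟩).trans (by linarith)

/-- The radial cutoff function at scale `σ`. -/
noncomputable def radialCutoff (σ : ℝ) (y : E2) : ℝ := cutoffProfile (‖y‖ ^ 2 / σ ^ 2)

/-- The factor `κ` in `∇η(y) = κ(y) y` for `η = radialCutoff σ`. -/
noncomputable def radialSlope (σ : ℝ) (y : E2) : ℝ :=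
  deriv cutoffProfile (‖y‖ ^ 2 / σ ^ 2) * (2 / σ ^ 2)

theorem contDiff_radialCutoff (σ : ℝ) : ContDiff ℝ 1 (radialCutoff σ) :=
  contDiff_cutoffProfile.comp ((contDiff_norm_sq ℝ).div_const _)

theorem contDiff_radialSlope (σ : ℝ) : ContDiff ℝ 1 (radialSlope σ) := by
  have h : ContDiff ℝ 1 (deriv cutoffProfile) :=
    ((contDiff_succ_iff_deriv (n := 1)).1 (contDiff_cutoffProfile (n := 2))).2.2
  exact (h.comp ((contDiff_norm_sq ℝ).div_const _)).mul contDiff_const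

theorem fderiv_radialCutoff (σ : ℝ) (y w : E2) :
    fderiv ℝ (radialCutoff σ) y w = radialSlope σ y * ⟪y, w⟫ := by
  have h1 : HasFDerivAt (fun y : E2 => ‖y‖ ^ 2 / σ ^ 2) ((σ ^ 2)⁻¹ • (2 • innerSL ℝ y)) y := by
    simpa [div_eq_inv_mul] using (hasStrictFDerivAt_norm_sq y).hasFDerivAt.const_mul ((σ ^ 2)⁻¹)
  have h2 := (((contDiff_cutoffProfile (n := 1)).differentiable one_ne_zero
    (‖y‖ ^ 2 / σ ^ 2)).hasDerivAt.comp_hasFDerivAt y h1).fderiv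
  rw [show fderiv ℝ (radialCutoff σ) y = _ from h2]
  simp [radialSlope]
  ring

theorem radialCutoff_neg (σ : ℝ) (y : E2) : radialCutoff σ (-y) = radialCutoff σ y := by
  simp [radialCutoff]

theorem radialSlope_neg (σ : ℝ) (y : E2) : radialSlope σ (-y) = radialSlope σ y := by
  simp [radialSlope]

theorem radialCutoff_nonneg (σ : ℝ) (y : E2) : 0 ≤ radialCutoff σ y :=
  Real.smoothTransition.nonneg _

theorem radialCutoff_le_one (σ : ℝ) (y : E2) : radialCutoff σ y ≤ 1 :=
  Real.smoothTransition.le_one _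

/-- The threshold `1/2`, rather than 1, keeps the closed support strictly inside the disc. -/
theorem tsupport_subset_of_eq_zero {V : Type*} [Zero V] {f : E2 → V} {σ : ℝ} (hσ : 0 < σ)
    (hf : ∀ y : E2, 1 / 2 < ‖y‖ ^ 2 / σ ^ 2 → f y = 0) :
    HasCompactSupport f ∧ ∀ y ∈ tsupport f, ‖y‖ < σ := by
  have hcl : IsClosed {y : E2 | ‖y‖ ^ 2 / σ ^ 2 ≤ 1 / 2} :=
    isClosed_le (by fun_prop) continuous_const
  have hsub : tsupport f ⊆ {y : E2 | ‖y‖ ^ 2 / σ ^ 2 ≤ 1 / 2} :=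
    closure_minimal (fun y hy => not_lt.1 fun h => hy (hf y h)) hcl
  have hlt : ∀ y ∈ tsupport f, ‖y‖ < σ := by
    intro y hy
    have h1 : ‖y‖ ^ 2 / σ ^ 2 ≤ 1 / 2 := hsub hy
    rw [div_le_iff₀ (by positivity)] at h1
    exact lt_of_pow_lt_pow_left₀ 2 hσ.le (by nlinarith [sq_pos_of_pos hσ])
  refine ⟨HasCompactSupport.of_support_subset_isCompact
    (isCompact_closedBall (0 : E2) σ) fun y hy => ?_, hlt⟩
  exact mem_closedBall_zero_iff.2 (hlt y (subset_tsupport _ hy)).le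

theorem radialCutoff_eq_zero {σ : ℝ} {y : E2} (h : 1 / 2 < ‖y‖ ^ 2 / σ ^ 2) :
    radialCutoff σ y = 0 := cutoffProfile_of_ge h.le

theorem radialSlope_eq_zero {σ : ℝ} {y : E2} (h : 1 / 2 < ‖y‖ ^ 2 / σ ^ 2) :
    radialSlope σ y = 0 := by
  simp [radialSlope, deriv_cutoffProfile_of_gt h]

theorem eq_zero_of_forall_of_le {V : Type*} [Zero V] {f : E2 → V} {σ : ℝ} (hσ : 0 < σ)
    (hf : ∀ y : E2, 1 / 2 < ‖y‖ ^ 2 / σ ^ 2 → f y = 0) {y : E2} (hy : σ ≤ ‖y‖) : f y = 0 := by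
  refine hf y ?_
  rw [lt_div_iff₀ (by positivity)]
  nlinarith [pow_le_pow_left₀ hσ.le hy 2, sq_pos_of_pos hσ]

theorem abs_radialSlope_le {M σ : ℝ} (hM : ∀ s, |deriv cutoffProfile s| ≤ M) (y : E2) :
    |radialSlope σ y| ≤ M * (2 / σ ^ 2) := by
  rw [radialSlope, abs_mul, abs_of_nonneg (show 0 ≤ 2 / σ ^ 2 by positivity)]
  gcongr
  exact hM _

theorem integral_eq_zero_of_odd {f : E2 → ℝ} (hf : ∀ y, f (-y) = -f y) : ∫ y, f y = 0 := by
  have h := integral_neg_eq_self f (volume : Measure E2)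
  simp_rw [hf] at h
  rw [integral_neg] at h
  linarith

/-- Scaling isolates the power of `σ`. The remaining integral is a fixed positive number, so the
final constants do not depend on `σ`. -/
theorem integral_radialCutoff {σ : ℝ} (hσ : 0 < σ) :
    ∫ y, radialCutoff σ y = σ ^ 2 * ∫ y : E2, cutoffProfile (‖y‖ ^ 2) := by
  have h := Measure.integral_comp_smul (volume : Measure E2)
    (fun y : E2 => cutoffProfile (‖y‖ ^ 2)) σ⁻¹
  rw [show (fun y => radialCutoff σ y) = fun y : E2 => cutoffProfile (‖σ⁻¹ • y‖ ^ 2) by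
    ext y; rw [radialCutoff, norm_smul, mul_pow]; simp [div_eq_inv_mul], h]
  simp [abs_of_pos hσ]

theorem integral_radialCutoff_mul_norm_sq {σ : ℝ} (hσ : 0 < σ) :
    ∫ y, radialCutoff σ y * ‖y‖ ^ 2 =
      σ ^ 4 * ∫ y : E2, cutoffProfile (‖y‖ ^ 2) * ‖y‖ ^ 2 := by
  have h := Measure.integral_comp_smul (volume : Measure E2)
    (fun y : E2 => cutoffProfile (‖y‖ ^ 2) * ‖y‖ ^ 2) σ⁻¹
  have e : (fun y => radialCutoff σ y * ‖y‖ ^ 2) =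
      fun y : E2 => σ ^ 2 * (cutoffProfile (‖σ⁻¹ • y‖ ^ 2) * ‖σ⁻¹ • y‖ ^ 2) := by
    ext y
    rw [radialCutoff, norm_smul, mul_pow]
    simp only [norm_inv, Real.norm_eq_abs, inv_pow, sq_abs, div_eq_inv_mul]
    field_simp
  rw [e, integral_const_mul, h]
  simp only [finrank_euclideanSpace, Fintype.card_fin, inv_pow, inv_inv, smul_eq_mul, abs_pow,
    sq_abs]
  ring

/-- Rotation of the plane by a right angle. -/
noncomputable def quarterTurn : E2 ≃ₗᵢ[ℝ] E2 :=
  LinearIsometry.toLinearIsometryEquiv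
    { toFun := fun y => !₂[-y 1, y 0]
      map_add' := fun x y => by ext i; fin_cases i <;> simp [add_comm]
      map_smul' := fun c x => by ext i; fin_cases i <;> simp
      norm_map' := fun y => by
        simp [EuclideanSpace.norm_eq, Fin.sum_univ_two, add_comm] } rfl

theorem inner_sq_add_inner_quarterTurn_sq (l y : E2) :
    ⟪l, y⟫ ^ 2 + ⟪l, quarterTurn y⟫ ^ 2 = ‖l‖ ^ 2 * ‖y‖ ^ 2 := by
  have : quarterTurn y = !₂[-y 1, y 0] := rfl
  rw [this, ← real_inner_self_eq_norm_sq, ← real_inner_self_eq_norm_sq]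
  simp only [PiLp.inner_apply, Fin.sum_univ_two]
  simp
  ring

theorem integrable_mul_of_radialCutoff {σ : ℝ} (hσ : 0 < σ) {f : E2 → ℝ} (hf : Continuous f) :
    Integrable fun y => radialCutoff σ y * f y :=
  ((contDiff_radialCutoff σ).continuous.mul hf).integrable_of_hasCompactSupport
    (tsupport_subset_of_eq_zero hσ fun _ h => radialCutoff_eq_zero h).1.mul_right

theorem integrable_mul_of_radialSlope {σ : ℝ} (hσ : 0 < σ) {f : E2 → ℝ} (hf : Continuous f) :
    Integrable fun y => radialSlope σ y * f y :=
  ((contDiff_radialSlope σ).continuous.mul hf).integrable_of_hasCompactSupport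
    (tsupport_subset_of_eq_zero hσ fun _ h => radialSlope_eq_zero h).1.mul_right

/-- The left side is unchanged when `y` is turned by a right angle, and the two resulting squares
add up to `‖l‖² ‖y‖²`. -/
theorem integral_radialCutoff_mul_inner_sq {σ : ℝ} (hσ : 0 < σ) (l : E2) :
    ∫ y, radialCutoff σ y * ⟪l, y⟫ ^ 2 = ‖l‖ ^ 2 / 2 * ∫ y, radialCutoff σ y * ‖y‖ ^ 2 := by
  have h1 : ∫ y, radialCutoff σ y * ⟪l, quarterTurn y⟫ ^ 2 =
      ∫ y, radialCutoff σ y * ⟪l, y⟫ ^ 2 := by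
    have := quarterTurn.measurePreserving.integral_comp
      quarterTurn.toHomeomorph.measurableEmbedding (fun y => radialCutoff σ y * ⟪l, y⟫ ^ 2)
    rw [← this]
    simp [radialCutoff]
  have h2 : ∫ y, radialCutoff σ y * (⟪l, y⟫ ^ 2 + ⟪l, quarterTurn y⟫ ^ 2) =
      ‖l‖ ^ 2 * ∫ y, radialCutoff σ y * ‖y‖ ^ 2 := by
    rw [← integral_const_mul]
    refine integral_congr_ae (Eventually.of_forall fun y => ?_)
    simp only [inner_sq_add_inner_quarterTurn_sq]
    ring
  simp_rw [mul_add] at h2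
  have hq : Continuous quarterTurn := quarterTurn.continuous
  rw [integral_add (integrable_mul_of_radialCutoff hσ (by fun_prop))
    (integrable_mul_of_radialCutoff hσ (by fun_prop)), h1] at h2
  linarith

theorem integral_cutoffProfile_pos {f : E2 → ℝ} (hf : Continuous f) (hpos : ∀ y, y ≠ 0 → 0 < f y)
    (hf0 : ∀ y, 0 ≤ f y) : 0 < ∫ y : E2, cutoffProfile (‖y‖ ^ 2) * f y := by
  have hc : Continuous fun y : E2 => cutoffProfile (‖y‖ ^ 2) * f y :=
    ((contDiff_cutoffProfile (n := 1)).continuous.comp (by fun_prop)).mul hf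
  have hi : Integrable fun y : E2 => cutoffProfile (‖y‖ ^ 2) * f y := by
    simpa [radialCutoff] using integrable_mul_of_radialCutoff one_pos hf
  -- At norm `1/2` the squared norm is `1/4`, the largest argument up to which the profile is
  -- declared to be 1.
  set y₀ : E2 := EuclideanSpace.single 0 (1 / 2) with hy₀
  have hn : ‖y₀‖ = 1 / 2 := by simp [hy₀]
  refine hc.integral_pos_of_hasCompactSupport_nonneg_nonzero ?_ ?_ (x := y₀) ?_
  · exact (tsupport_subset_of_eq_zero (σ := 1) one_pos fun y h => by
      rw [cutoffProfile_of_ge (by simpa using h.le), zero_mul]).1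
  · exact fun y => mul_nonneg (Real.smoothTransition.nonneg _) (hf0 y)
  · rw [hn, show cutoffProfile ((1 / 2) ^ 2) = 1 from
      Real.smoothTransition.one_of_one_le (by norm_num), one_mul]
    exact (hpos _ fun h => by rw [h] at hn; norm_num at hn).ne'

/-! ### Integral identities in the gap -/

/-- A smooth function on the line equal to `1` on `[-τ', τ']` and supported in `(-τ, τ)`. -/
theorem exists_vertical_cutoff {τ τ' : ℝ} (h0 : 0 < τ') (h : τ' < τ) :
    ∃ χ : ℝ → ℝ, ContDiff ℝ 1 χ ∧ HasCompactSupport χ ∧ (∀ t, |t| ≤ τ' → χ t = 1) ∧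
      (∀ t, |t| < τ' → deriv χ t = 0) ∧ ∀ t ∈ tsupport χ, |t| < τ := by
  let B : ContDiffBump (0 : ℝ) := ⟨τ', (τ' + τ) / 2, h0, by linarith⟩
  have h1 : ∀ t, |t| ≤ τ' → B t = 1 := fun t ht => B.one_of_mem_closedBall (by simpa [B] using ht)
  refine ⟨B, B.contDiff, B.hasCompactSupport, h1, fun t ht => ?_, fun t ht => ?_⟩
  · have : (B : ℝ → ℝ) =ᶠ[𝓝 t] fun _ => 1 :=
      (continuous_abs.continuousAt.eventually_lt continuousAt_const ht).mono
        fun s hs => h1 s hs.le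
    rw [this.deriv_eq, deriv_const]
  · rw [B.tsupport_eq] at ht
    have : |t| ≤ (τ' + τ) / 2 := by simpa [B] using ht
    linarith

theorem fderiv_apply_vertical {V : Type*} [NormedAddCommGroup V] [NormedSpace ℝ V]
    {f : E2 × ℝ → V} {z : E2 × ℝ} {f' : V} (hf : DifferentiableAt ℝ f z)
    (h : HasDerivAt (fun t => f (z.1, t)) f' z.2) : fderiv ℝ f z (0, 1) = f' := by
  have h1 := (show HasFDerivAt f (fderiv ℝ f z) (z.1, z.2) from
    hf.hasFDerivAt).comp_hasDerivAt z.2 ((hasDerivAt_const z.2 z.1).prodMk (hasDerivAt_id z.2))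
  exact h1.unique h

theorem chart_sub (Q : E3) (L : E3 ≃ₗᵢ[ℝ] E3) (h : ℝ) (z : E2 × ℝ) :
    chart Q L z - (Q + h • vert L) = hor L z.1 + (z.2 - h) • vert L := by
  rw [chart_eq, sub_smul]
  abel

namespace IsGapChart

variable {Ω S : Set E3} {Q : E3} {L : E3 ≃ₗᵢ[ℝ] E3} {a b : E2 → ℝ} {σ τ τ' h : ℝ}
  {u : E3 → E3} {Du : E3 → E3 →L[ℝ] E3} {D2u : E3 → E3 →L[ℝ] E3 →L[ℝ] E3} {V : E3}
  {A : E3 →L[ℝ] E3}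

/-- Integration by parts in the gap against the field `p(y, t) v(y)`. -/
theorem integral_gap_smul (hg : IsGapChart Ω S Q L a b σ τ τ') (hτ' : 0 < τ')
    (hu : MemW120 Ω u Du)
    (hrig : ∀ᵐ x ∂(volume.restrict S), u x = V + A (x - (Q + h • vert L)))
    {v : E2 → E3} (hv : ContDiff ℝ 1 v) (hc : HasCompactSupport v)
    (hs : ∀ y ∈ tsupport v, ‖y‖ < σ) {p : E2 × ℝ → ℝ} (hp : ContDiff ℝ 1 p)
    {p' : E2 × ℝ → ℝ} (hp' : ∀ z, HasDerivAt (fun t => p (z.1, t)) (p' z) z.2) :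
    ∫ z in gapRegion a b σ, (p' z * ⟪v z.1, u (chart Q L z)⟫ +
      p z * ⟪v z.1, Du (chart Q L z) (vert L)⟫) =
    ∫ y, p (y, b y) * ⟪v y, V + A (hor L y) + (b y - h) • A (vert L)⟫ := by
  obtain ⟨χ, hχ, hχc, hχ1, hχd, hχs⟩ := exists_vertical_cutoff hτ' hg.lt
  -- The cutoff `χ` only provides compact support. It equals 1 on the gap and on the graph of `b`,
  -- so it leaves no trace in the identity.
  let ψ : E2 × ℝ → E3 := fun z => (χ z.2 * p z) • v z.1
  have hψ : ContDiff ℝ 1 ψ := ((hχ.comp contDiff_snd).mul hp).smul (hv.comp contDiff_fst)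
  have hsub : tsupport ψ ⊆ tsupport v ×ˢ tsupport χ := by
    refine closure_minimal (fun z hz => ⟨subset_tsupport _ fun h0 => hz ?_,
      subset_tsupport _ fun h0 => hz ?_⟩) ((isClosed_tsupport v).prod (isClosed_tsupport χ))
    · simp [ψ, h0]
    · simp [ψ, h0]
  have hψc : HasCompactSupport ψ := HasCompactSupport.of_support_subset_isCompact
    (hc.isCompact.prod hχc.isCompact) ((subset_tsupport _).trans hsub)
  have key := hg.integral_gap_vertical hu hrig hψ hψc fun z hz =>
    ⟨hs _ (hsub hz).1, hχs _ (hsub hz).2⟩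
  have hGm := (isOpen_gapRegion hg.contDiff_wall.continuous
    hg.contDiff_body.continuous σ).measurableSet
  rw [setIntegral_congr_fun hGm (g := fun z => p' z * ⟪v z.1, u (chart Q L z)⟫ +
      p z * ⟪v z.1, Du (chart Q L z) (vert L)⟫)] at key
  · rw [key]
    refine integral_congr_ae (Eventually.of_forall fun y => ?_)
    simp only [ψ, chart_sub, map_add, map_smul, add_assoc]
    by_cases hy : ‖y‖ < σ
    · rw [hχ1 _ (hg.body_le y hy), one_mul, real_inner_smul_left]
    · rw [image_eq_zero_of_notMem_tsupport fun hm => hy (hs y hm)]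
      simp
  · intro z hz
    have hτ := hg.abs_lt_of_mem_gapRegion hz
    have hd : fderiv ℝ ψ z (0, 1) = p' z • v z.1 := by
      refine fderiv_apply_vertical (hψ.differentiable one_ne_zero z) ?_
      have h1 := (((hχ.differentiable one_ne_zero z.2).hasDerivAt.mul (hp' z)).smul_const (v z.1))
      rw [hχd _ hτ, hχ1 _ hτ.le, zero_mul, zero_add, one_mul] at h1
      exact h1
    simp only [hd, ψ, hχ1 _ hτ.le, one_mul, real_inner_smul_left]

/-- The flux identity, with the part above the gap computed explicitly. -/
theorem inner_vert_mul_integral_radialCutoff (hg : IsGapChart Ω S Q L a b σ τ τ') (hσ : 0 < σ)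
    (hτ' : 0 < τ') (hh : |h| ≤ τ') (hu : MemW120 Ω u Du) (hdiv : DivFree Ω Du)
    (hrig : ∀ᵐ x ∂(volume.restrict S), u x = V + A (x - (Q + h • vert L)))
    (hA : ∀ x y, ⟪x, A y⟫ = -⟪y, A x⟫) :
    ⟪vert L, V⟫ * ∫ y, radialCutoff σ y =
      (∫ z in gapRegion a b σ, radialSlope σ z.1 * ⟪hor L z.1, u (chart Q L z)⟫) -
      ∫ y, radialSlope σ y * ((b y - h) * ⟪hor L y, V⟫ +
        (b y - h) ^ 2 / 2 * ⟪hor L y, A (vert L)⟫) := by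
  obtain ⟨χ, hχ, hχc, hχ1, hχd, hχs⟩ := exists_vertical_cutoff hτ' hg.lt
  have hbc := hg.contDiff_body.continuous
  have hηs := tsupport_subset_of_eq_zero hσ fun _ h => radialCutoff_eq_zero h
  have hηc := contDiff_radialCutoff σ
  have hκc := contDiff_radialSlope σ
  let ψ : E2 × ℝ → ℝ := fun z => radialCutoff σ z.1 * χ z.2
  have hψ : ContDiff ℝ 1 ψ := (hηc.comp contDiff_fst).mul (hχ.comp contDiff_snd)
  have hsub : tsupport ψ ⊆ tsupport (radialCutoff σ) ×ˢ tsupport χ := by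
    refine closure_minimal (fun z hz => ⟨subset_tsupport _ fun h0 => hz ?_,
      subset_tsupport _ fun h0 => hz ?_⟩) ((isClosed_tsupport _).prod (isClosed_tsupport χ))
    · simp [ψ, h0]
    · simp [ψ, h0]
  have hψc : HasCompactSupport ψ := HasCompactSupport.of_support_subset_isCompact
    (hηs.1.isCompact.prod hχc.isCompact) ((subset_tsupport _).trans hsub)
  have key := hg.integral_gap_flux hu hdiv hrig hψ hψc fun z hz =>
    ⟨hηs.2 _ (hsub hz).1, hχs _ (hsub hz).2⟩
  have hfd : ∀ z v, fderiv ℝ ψ z (ptEquiv.symm (L.symm v)) =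
      radialSlope σ z.1 * χ z.2 * ⟪hor L z.1, v⟫ +
        radialCutoff σ z.1 * deriv χ z.2 * ⟪vert L, v⟫ := by
    intro z v
    obtain ⟨w, rfl⟩ : ∃ w, v = L (ptEquiv w) := ⟨ptEquiv.symm (L.symm v), by simp⟩
    have h1 : HasFDerivAt (fun z : E2 × ℝ => radialCutoff σ z.1)
        ((fderiv ℝ (radialCutoff σ) z.1).comp (ContinuousLinearMap.fst ℝ E2 ℝ)) z :=
      (hηc.differentiable one_ne_zero z.1).hasFDerivAt.comp z hasFDerivAt_fst
    have h2 : HasFDerivAt (fun z : E2 × ℝ => χ z.2)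
        (deriv χ z.2 • (ContinuousLinearMap.snd ℝ E2 ℝ)) z :=
      (hχ.differentiable one_ne_zero z.2).hasDerivAt.comp_hasFDerivAt z hasFDerivAt_snd
    rw [show fderiv ℝ ψ z = _ from (h1.mul h2).fderiv, map_ptEquiv, inner_add_right,
      inner_add_right, real_inner_smul_right, real_inner_smul_right, inner_hor_hor, inner_hor_vert,
      real_inner_comm _ (vert L),
      inner_hor_vert, inner_vert_vert, ← map_ptEquiv]
    simp [fderiv_radialCutoff]
    ring
  have hAself : ∀ x, ⟪x, A x⟫ = 0 := fun x => by linarith [hA x x]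
  simp only [hfd] at key
  have hGm := (isOpen_gapRegion hg.contDiff_wall.continuous hbc σ).measurableSet
  rw [setIntegral_congr_fun hGm (g := fun z =>
    radialSlope σ z.1 * ⟪hor L z.1, u (chart Q L z)⟫)] at key
  swap
  · intro z hz
    have hτ := hg.abs_lt_of_mem_gapRegion hz
    simp [hχd _ hτ, hχ1 _ hτ.le]
  set α : E2 → ℝ := fun y => ⟪hor L y, V⟫ with hα
  set β : E2 → ℝ := fun y => ⟪hor L y, A (vert L)⟫ with hβ
  have hαc : Continuous α := by fun_prop
  have hβc : Continuous β := by fun_prop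
  -- Skewness removes the diagonal terms and turns `⟪e, A y⟫` into `-⟪y, A e⟫`.
  have hint : ∀ z : E2 × ℝ, radialSlope σ z.1 * χ z.2 *
      ⟪hor L z.1, V + A (chart Q L z - (Q + h • vert L))⟫ +
      radialCutoff σ z.1 * deriv χ z.2 * ⟪vert L, V + A (chart Q L z - (Q + h • vert L))⟫ =
      radialSlope σ z.1 * (χ z.2 * (α z.1 + (z.2 - h) * β z.1)) +
        radialCutoff σ z.1 * (deriv χ z.2 * (⟪vert L, V⟫ - β z.1)) := by
    intro z
    simp only [chart_sub, map_add, map_smul, inner_add_right, real_inner_smul_right, hAself, hα,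
      hβ, hA (vert L) (hor L z.1)]
    ring
  simp only [hint] at key
  have hχ' : Continuous (deriv χ) := hχ.continuous_deriv le_rfl
  have hχi : Integrable χ := hχ.continuous.integrable_of_hasCompactSupport hχc
  have hχti : Integrable fun t => χ t * (t - h) :=
    (hχ.continuous.mul (by fun_prop)).integrable_of_hasCompactSupport hχc.mul_right
  have hχdi : Integrable (deriv χ) := hχ'.integrable_of_hasCompactSupport hχc.deriv
  rw [setIntegral_above hbc] at key
  swap
  · have e : (fun z : E2 × ℝ => radialSlope σ z.1 * (χ z.2 * (α z.1 + (z.2 - h) * β z.1)) +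
        radialCutoff σ z.1 * (deriv χ z.2 * (⟪vert L, V⟫ - β z.1))) = fun z : E2 × ℝ =>
        ((radialSlope σ z.1 * α z.1) * χ z.2 + (radialSlope σ z.1 * β z.1) * (χ z.2 * (z.2 - h))) +
        (radialCutoff σ z.1 * (⟪vert L, V⟫ - β z.1)) * deriv χ z.2 := by ext z; ring
    rw [e]
    exact (((integrable_mul_of_radialSlope hσ hαc).mul_prod hχi).add
      ((integrable_mul_of_radialSlope hσ hβc).mul_prod hχti)).add
      ((integrable_mul_of_radialCutoff hσ (f := fun y => ⟪vert L, V⟫ - β y)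
        (by fun_prop)).mul_prod hχdi)
  -- These moments depend on the choice of `χ`. They are independent of `y` and multiply odd
  -- functions of `y`, so they drop out at the end.
  set X₀ := ∫ t in Set.Ioi h, χ t with hX₀
  set X₁ := ∫ t in Set.Ioi h, χ t * (t - h) with hX₁
  have hline : ∀ y, ∫ t in Set.Ioi (b y), (radialSlope σ y * (χ t * (α y + (t - h) * β y)) +
      radialCutoff σ y * (deriv χ t * (⟪vert L, V⟫ - β y))) =
      ((radialSlope σ y * (X₀ * α y + X₁ * β y)) -
        radialSlope σ y * ((b y - h) * α y + (b y - h) ^ 2 / 2 * β y)) -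
      (⟪vert L, V⟫ * radialCutoff σ y - radialCutoff σ y * β y) := by
    intro y
    by_cases hy : ‖y‖ < σ
    swap
    · rw [eq_zero_of_forall_of_le hσ (fun _ h => radialCutoff_eq_zero h) (not_lt.1 hy),
        eq_zero_of_forall_of_le hσ (fun _ h => radialSlope_eq_zero h) (not_lt.1 hy)]
      simp
    have hby := hg.body_le y hy
    -- Both `h` and `b y` lie in `[-τ', τ']`, so moving the lower limit from `h` to `b y` changes
    -- the moments by elementary integrals of 1 and `t - h`.
    have hone : ∀ t ∈ Set.uIcc h (b y), χ t = 1 := by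
      intro t ht
      refine hχ1 t (abs_le.2 ?_)
      have h1 := abs_le.1 hby
      have h2 := abs_le.1 hh
      exact Set.uIcc_subset_Icc h2 h1 ht
    have h0 : ∫ t in Set.Ioi (b y), χ t = X₀ - (b y - h) := by
      have := intervalIntegral.integral_Ioi_sub_Ioi' (hχi.integrableOn (s := Set.Ioi h))
        (hχi.integrableOn (s := Set.Ioi (b y)))
      rw [intervalIntegral.integral_congr (g := fun _ => (1 : ℝ)) hone] at this
      simp only [intervalIntegral.integral_const, smul_eq_mul, mul_one] at this
      linarith
    have h1 : ∫ t in Set.Ioi (b y), χ t * (t - h) = X₁ - (b y - h) ^ 2 / 2 := by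
      have := intervalIntegral.integral_Ioi_sub_Ioi' (hχti.integrableOn (s := Set.Ioi h))
        (hχti.integrableOn (s := Set.Ioi (b y)))
      rw [intervalIntegral.integral_congr (g := fun t => t - h)
        (fun t ht => by simp only [hone t ht, one_mul])] at this
      rw [intervalIntegral.integral_comp_sub_right (fun t => t) h] at this
      simp only [integral_id, sub_self] at this
      linarith
    have h2 : ∫ t in Set.Ioi (b y), deriv χ t = -1 := by
      rw [hχc.integral_Ioi_deriv_eq hχ, hχ1 _ hby]
    have e : (fun t => radialSlope σ y * (χ t * (α y + (t - h) * β y)) +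
        radialCutoff σ y * (deriv χ t * (⟪vert L, V⟫ - β y))) = fun t =>
        (radialSlope σ y * α y) * χ t + (radialSlope σ y * β y) * (χ t * (t - h)) +
        (radialCutoff σ y * (⟪vert L, V⟫ - β y)) * deriv χ t := by ext t; ring
    have j : Integrable fun t => (radialSlope σ y * α y) * χ t +
        (radialSlope σ y * β y) * (χ t * (t - h)) := (hχi.const_mul _).add (hχti.const_mul _)
    rw [e, integral_add j.integrableOn
      (hχdi.const_mul _).integrableOn, integral_add (hχi.const_mul _).integrableOn
      (hχti.const_mul _).integrableOn, integral_const_mul, integral_const_mul,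
      integral_const_mul, h0, h1, h2]
    ring
  simp only [hline] at key
  have i1 := integrable_mul_of_radialSlope hσ (f := fun y => X₀ * α y + X₁ * β y) (by fun_prop)
  have i2 := integrable_mul_of_radialSlope hσ
    (f := fun y => (b y - h) * α y + (b y - h) ^ 2 / 2 * β y) (by fun_prop)
  have i3 : Integrable fun y => ⟪vert L, V⟫ * radialCutoff σ y := by
    simpa [mul_comm] using integrable_mul_of_radialCutoff hσ
      (f := fun _ => ⟪vert L, V⟫) continuous_const
  have i4 := integrable_mul_of_radialCutoff hσ hβc
  have i12 : Integrable fun y => radialSlope σ y * (X₀ * α y + X₁ * β y) -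
      radialSlope σ y * ((b y - h) * α y + (b y - h) ^ 2 / 2 * β y) := i1.sub i2
  have i34 : Integrable fun y => ⟪vert L, V⟫ * radialCutoff σ y - radialCutoff σ y * β y :=
    i3.sub i4
  rw [integral_sub i12 i34, integral_sub i1 i2, integral_sub i3 i4,
    integral_const_mul,
    integral_eq_zero_of_odd (f := fun y => radialSlope σ y * (X₀ * α y + X₁ * β y)) fun y => by
      simp only [radialSlope_neg, hα, hβ, map_neg, inner_neg_left]; ring,
    integral_eq_zero_of_odd (f := fun y => radialCutoff σ y * β y) fun y => by
      simp only [radialCutoff_neg, hβ, map_neg, inner_neg_left]; ring] at key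
  linarith

end IsGapChart

/-! ### Estimates in the gap -/

theorem abs_integral_le_of_ball {f : E2 → ℝ} {σ C : ℝ} (hσ : 0 ≤ σ)
    (h0 : ∀ y, σ ≤ ‖y‖ → f y = 0) (hC : ∀ y, ‖y‖ < σ → |f y| ≤ C) :
    |∫ y, f y| ≤ C * (σ ^ 2 * Real.pi) := by
  have hv : volume (Metric.ball (0 : E2) σ) = ENNReal.ofReal (σ ^ 2 * Real.pi) := by
    rw [EuclideanSpace.volume_ball_fin_two, ENNReal.ofReal_mul (by positivity),
      ENNReal.ofReal_pow hσ]
  rw [← setIntegral_eq_integral_of_forall_compl_eq_zero (s := Metric.ball (0 : E2) σ)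
    fun y hy => h0 y (by simpa using hy)]
  have := norm_setIntegral_le_of_norm_le_const (μ := (volume : Measure E2)) (f := f) (C := C)
    (s := Metric.ball (0 : E2) σ) (by rw [hv]; exact ENNReal.ofReal_lt_top)
    fun y hy => hC y (by simpa using hy)
  rwa [Measure.real, hv, ENNReal.toReal_ofReal (by positivity), Real.norm_eq_abs] at this

theorem abs_setIntegral_le_L2norm {W : Type*} [NormedAddCommGroup W] {Q : E3}
    {L : E3 ≃ₗᵢ[ℝ] E3} {G : Set (E2 × ℝ)} (hGm : MeasurableSet G) {B : Set E3}
    (hGB : ∀ z ∈ G, chart Q L z ∈ B) {f : E3 → W} (hf : MemLp f 2 (volume.restrict B))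
    (hB : MeasurableSet B) {m : ℝ} (hm : 0 ≤ m) (hG : volume G ≤ ENNReal.ofReal m)
    {F : E2 × ℝ → ℝ} {C : ℝ} (hC : 0 ≤ C) (hF : ∀ z ∈ G, |F z| ≤ C * ‖f (chart Q L z)‖) :
    |∫ z in G, F z| ≤ C * (√m * L2norm f B) := by
  obtain ⟨hi, hle⟩ := integral_norm_le_sqrt_mul_L2norm hGB hf hB hm hG
  calc |∫ z in G, F z| ≤ ∫ z in G, C * ‖f (chart Q L z)‖ := by
        rw [← Real.norm_eq_abs]
        exact norm_integral_le_of_norm_le (hi.norm.const_mul C) <|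
          (ae_restrict_mem hGm).mono fun z hz => hF z hz
    _ = C * ∫ z in G, ‖f (chart Q L z)‖ := integral_const_mul _ _
    _ ≤ C * (√m * L2norm f B) := by gcongr

theorem MemLp.restrict_mono_set {W : Type*} [NormedAddCommGroup W] {f : E3 → W} {B F : Set E3}
    (hf : MemLp f 2 (volume.restrict F)) (h : B ⊆ F) : MemLp f 2 (volume.restrict B) :=
  hf.mono_measure (Measure.restrict_mono h le_rfl)

theorem L2norm_nonneg {W : Type*} [NormedAddCommGroup W] (f : E3 → W) (B : Set E3) :
    0 ≤ L2norm f B := ENNReal.toReal_nonneg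

namespace IsGapChart

variable {Ω S B : Set E3} {Q : E3} {L : E3 ≃ₗᵢ[ℝ] E3} {a b : E2 → ℝ} {σ τ τ' h K m : ℝ}
  {u : E3 → E3} {Du : E3 → E3 →L[ℝ] E3} {D2u : E3 → E3 →L[ℝ] E3 →L[ℝ] E3} {V : E3}
  {A : E3 →L[ℝ] E3}

/-- The velocity at the tip of the body is controlled by the gradient in the gap and by the
angular velocity. -/
theorem norm_mul_integral_radialCutoff_le (hg : IsGapChart Ω S Q L a b σ τ τ') (hσ : 0 < σ)
    (hτ' : 0 < τ') (hu : MemW120 Ω u Du)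
    (hrig : ∀ᵐ x ∂(volume.restrict S), u x = V + A (x - (Q + h • vert L)))
    (hK : 0 ≤ K) (hb : ∀ y, ‖y‖ < σ → |b y - h| ≤ K * ‖y‖ ^ 2)
    (hGB : ∀ z ∈ gapRegion a b σ, chart Q L z ∈ B) (hBm : MeasurableSet B) (hBΩ : B ⊆ Ω)
    (hm : 0 ≤ m) (hG : volume (gapRegion a b σ) ≤ ENNReal.ofReal m) :
    ‖V‖ * ∫ y, radialCutoff σ y ≤
      ‖A (vert L)‖ * (K * σ ^ 2) * (σ ^ 2 * Real.pi) + √m * L2norm Du B := by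
  have hbc := hg.contDiff_body.continuous
  have hGm := (isOpen_gapRegion hg.contDiff_wall.continuous hbc σ).measurableSet
  have hη := tsupport_subset_of_eq_zero hσ (f := fun y => radialCutoff σ y • V)
    fun _ h => by rw [radialCutoff_eq_zero h, zero_smul]
  have hDuB : MemLp Du 2 (volume.restrict B) :=
    MemLp.restrict_mono_set hu.2.2.1 hBΩ
  -- With `p = 1` this is the increment of `u` across the gap tested with `η V`. The term `A y` is
  -- odd and integrates to zero, leaving `‖V‖² ∫ η` and a term of size `K σ² ‖V‖ ‖A e‖`.
  have key := hg.integral_gap_smul hτ' hu hrig (v := fun y => radialCutoff σ y • V)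
    ((contDiff_radialCutoff σ).smul contDiff_const)
    hη.1 hη.2 (p := fun _ => 1) contDiff_const (p' := fun _ => 0) fun z => hasDerivAt_const _ _
  simp only [zero_mul, zero_add, one_mul, real_inner_smul_left, inner_add_right,
    real_inner_smul_right, mul_add, mul_left_comm (b _ - h)] at key
  have i1 := integrable_mul_of_radialCutoff hσ (f := fun _ => ⟪V, V⟫) continuous_const
  have i2 := integrable_mul_of_radialCutoff hσ (f := fun y => ⟪V, A (hor L y)⟫) (by fun_prop)
  have i3 := integrable_mul_of_radialCutoff hσ
    (f := fun y => (b y - h) * ⟪V, A (vert L)⟫) (by fun_prop)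
  have i12 : Integrable fun y => radialCutoff σ y * ⟪V, V⟫ +
    radialCutoff σ y * ⟪V, A (hor L y)⟫ := i1.add i2
  rw [integral_add i12 i3, integral_add i1 i2, integral_eq_zero_of_odd
    (f := fun y => radialCutoff σ y * ⟪V, A (hor L y)⟫) (fun y => by
      simp only [radialCutoff_neg, map_neg, inner_neg_right]; ring), add_zero,
    integral_mul_const, real_inner_self_eq_norm_sq] at key
  have e1 := abs_setIntegral_le_L2norm hGm hGB hDuB hBm hm hG (C := ‖V‖)
    (F := fun z => radialCutoff σ z.1 * ⟪V, Du (chart Q L z) (vert L)⟫) (norm_nonneg _)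
    fun z _ => by
      rw [abs_mul, abs_of_nonneg (radialCutoff_nonneg _ _)]
      refine (mul_le_of_le_one_left (abs_nonneg _) (radialCutoff_le_one _ _)).trans ?_
      refine (abs_real_inner_le_norm _ _).trans ?_
      gcongr
      simpa [norm_vert] using (Du (chart Q L z)).le_opNorm (vert L)
  have e2 := abs_integral_le_of_ball hσ.le
    (f := fun y => radialCutoff σ y * ((b y - h) * ⟪V, A (vert L)⟫))
    (C := K * σ ^ 2 * (‖V‖ * ‖A (vert L)‖))
    (fun y hy => by
      rw [eq_zero_of_forall_of_le hσ (fun _ h => radialCutoff_eq_zero h) hy, zero_mul])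
    (fun y hy => by
      rw [abs_mul, abs_of_nonneg (radialCutoff_nonneg _ _)]
      refine (mul_le_of_le_one_left (abs_nonneg _) (radialCutoff_le_one _ _)).trans ?_
      rw [abs_mul]
      have := hb y hy
      gcongr
      · exact this.trans (by gcongr)
      · exact abs_real_inner_le_norm _ _)
  rcases (norm_nonneg V).eq_or_lt with hV | hV
  · rw [← hV, zero_mul]
    have := L2norm_nonneg Du B
    positivity
  · have h1 := abs_le.1 e1
    have h2 := abs_le.1 e2
    refine le_of_mul_le_mul_left ?_ hV
    nlinarith

/-- The angular velocity is controlled by the gradient in the gap. -/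
theorem norm_map_vert_mul_le (hg : IsGapChart Ω S Q L a b σ τ τ') (hσ : 0 < σ)
    (hτ' : 0 < τ') (hu : MemW120 Ω u Du)
    (hrig : ∀ᵐ x ∂(volume.restrict S), u x = V + A (x - (Q + h • vert L)))
    (hA : ∀ x y, ⟪x, A y⟫ = -⟪y, A x⟫)
    (hGB : ∀ z ∈ gapRegion a b σ, chart Q L z ∈ B) (hBm : MeasurableSet B) (hBΩ : B ⊆ Ω)
    (hm : 0 ≤ m) (hG : volume (gapRegion a b σ) ≤ ENNReal.ofReal m) :
    ‖A (vert L)‖ / 2 * ∫ y, radialCutoff σ y * ‖y‖ ^ 2 ≤ σ * (√m * L2norm Du B) := by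
  have hbc := hg.contDiff_body.continuous
  have hGm := (isOpen_gapRegion hg.contDiff_wall.continuous hbc σ).measurableSet
  have hDuB : MemLp Du 2 (volume.restrict B) :=
    MemLp.restrict_mono_set hu.2.2.1 hBΩ
  set W := A (vert L) with hW
  have hAself : ⟪vert L, W⟫ = 0 := by linarith [hA (vert L) (vert L)]
  -- By skewness `A e` is orthogonal to `e`, hence represented by a plane vector `l`.
  obtain ⟨l, hl⟩ : ∃ l, W = hor L l := by
    obtain ⟨w, hw⟩ : ∃ w, W = L (ptEquiv w) := ⟨ptEquiv.symm (L.symm W), by simp⟩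
    rw [map_ptEquiv] at hw
    rw [hw, inner_add_right, real_inner_smul_right, real_inner_comm, inner_hor_vert,
      inner_vert_vert] at hAself
    exact ⟨w.1, by rw [hw, show w.2 = 0 by linarith, zero_smul, add_zero]⟩
  have hβ : ∀ y, ⟪hor L y, W⟫ = ⟪l, y⟫ := fun y => by
    rw [hl, inner_hor_hor, real_inner_comm]
  have hη := tsupport_subset_of_eq_zero hσ (f := fun y => (radialCutoff σ y * ⟪l, y⟫) • vert L)
    fun _ h => by rw [radialCutoff_eq_zero h, zero_mul, zero_smul]
  -- The vertical component of the rigid velocity at the body is `⟪e, V⟫ - ⟪l, y⟫`. Against `η ⟪l,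
  -- y⟫` the constant drops out by oddness and the square remains.
  have key := hg.integral_gap_smul hτ' hu hrig
    (v := fun y => (radialCutoff σ y * ⟪l, y⟫) • vert L)
    (((contDiff_radialCutoff σ).mul (contDiff_const.inner ℝ contDiff_id)).smul contDiff_const)
    hη.1 hη.2 (p := fun _ => 1) contDiff_const (p' := fun _ => 0) fun z => hasDerivAt_const _ _
  have hint : ∀ y, (radialCutoff σ y * ⟪l, y⟫) * ⟪vert L, V + A (hor L y) + (b y - h) • W⟫ =
      radialCutoff σ y * (⟪l, y⟫ * ⟪vert L, V⟫) - radialCutoff σ y * ⟪l, y⟫ ^ 2 := by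
    intro y
    rw [inner_add_right, inner_add_right, real_inner_smul_right, hAself, hA (vert L) (hor L y),
      hβ]
    ring
  simp only [zero_mul, zero_add, one_mul, real_inner_smul_left, ← hW, hint] at key
  rw [integral_sub (integrable_mul_of_radialCutoff hσ (by fun_prop))
    (integrable_mul_of_radialCutoff hσ (by fun_prop)), integral_eq_zero_of_odd
    (f := fun y => radialCutoff σ y * (⟪l, y⟫ * ⟪vert L, V⟫)) (fun y => by
      simp only [radialCutoff_neg, inner_neg_right]; ring),
    integral_radialCutoff_mul_inner_sq hσ, zero_sub] at key
  have hlW : ‖W‖ = ‖l‖ := by rw [hl, norm_hor]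
  have e1 := abs_setIntegral_le_L2norm hGm hGB hDuB hBm hm hG (C := ‖l‖ * σ)
    (F := fun z => radialCutoff σ z.1 * ⟪l, z.1⟫ * ⟪vert L, Du (chart Q L z) (vert L)⟫)
    (by positivity)
    fun z hz => by
      rw [mul_assoc, abs_mul, abs_of_nonneg (radialCutoff_nonneg _ _)]
      refine (mul_le_of_le_one_left (abs_nonneg _) (radialCutoff_le_one _ _)).trans ?_
      rw [abs_mul]
      gcongr
      · refine (abs_real_inner_le_norm _ _).trans ?_
        have := hz.1.le
        gcongr
      · refine (abs_real_inner_le_norm _ _).trans ?_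
        rw [norm_vert, one_mul]
        simpa [norm_vert] using (Du (chart Q L z)).le_opNorm (vert L)
  rw [hlW]
  rcases (norm_nonneg l).eq_or_lt with hV | hV
  · rw [← hV, zero_div, zero_mul]
    have := L2norm_nonneg Du B
    positivity
  · have h1 := abs_le.1 e1
    refine le_of_mul_le_mul_left ?_ hV
    nlinarith

end IsGapChart

theorem abs_integral_radialSlope_mul_le {σ C M : ℝ} (hσ : 0 < σ)
    (hM : ∀ s, |deriv cutoffProfile s| ≤ M) {f : E2 → ℝ} (hC : ∀ y, ‖y‖ < σ → |f y| ≤ C) :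
    |∫ y, radialSlope σ y * f y| ≤ M * (2 / σ ^ 2) * C * (σ ^ 2 * Real.pi) := by
  have hM0 : 0 ≤ M := (abs_nonneg _).trans (hM 0)
  refine abs_integral_le_of_ball hσ.le (fun y hy => ?_) fun y hy => ?_
  · rw [eq_zero_of_forall_of_le hσ (fun _ h => radialSlope_eq_zero h) hy, zero_mul]
  · rw [abs_mul]
    have := abs_radialSlope_le (σ := σ) hM y
    have := hC y hy
    gcongr

/-- Against an odd weight, only the odd part of a function contributes. -/
theorem integral_radialSlope_mul_odd {σ : ℝ} (hσ : 0 < σ) {α s : E2 → ℝ} (hα : Continuous α)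
    (hs : Continuous s) (hodd : ∀ y, α (-y) = -α y) :
    ∫ y, radialSlope σ y * (α y * s y) =
      ∫ y, radialSlope σ y * (α y * ((s y - s (-y)) / 2)) := by
  have h1 : ∫ y, radialSlope σ y * (α y * s (-y)) = - ∫ y, radialSlope σ y * (α y * s y) := by
    rw [← integral_neg_eq_self (fun y => radialSlope σ y * (α y * s (-y))), ← integral_neg]
    refine integral_congr_ae (Eventually.of_forall fun y => ?_)
    simp only [radialSlope_neg, hodd, neg_neg]
    ring
  have i1 := integrable_mul_of_radialSlope hσ (f := fun y => α y * s y) (by fun_prop)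
  have i2 := integrable_mul_of_radialSlope hσ (f := fun y => α y * s (-y)) (by fun_prop)
  have e : (fun y => radialSlope σ y * (α y * ((s y - s (-y)) / 2))) = fun y =>
      (1 / 2) * (radialSlope σ y * (α y * s y) - radialSlope σ y * (α y * s (-y))) := by
    ext y; ring
  rw [e, integral_const_mul, integral_sub i1 i2, h1]
  ring

theorem _root_.ContDiff.radialSlope_smul_hor (σ : ℝ) (L : E3 ≃ₗᵢ[ℝ] E3) :
    ContDiff ℝ 1 fun y => radialSlope σ y • hor L y :=
  (contDiff_radialSlope σ).smul (hor L).contDiff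

namespace IsGapChart

variable {Ω S B : Set E3} {Q : E3} {L : E3 ≃ₗᵢ[ℝ] E3} {a b : E2 → ℝ} {σ τ τ' h K m M : ℝ}
  {u : E3 → E3} {Du : E3 → E3 →L[ℝ] E3} {D2u : E3 → E3 →L[ℝ] E3 →L[ℝ] E3} {V : E3}
  {A : E3 →L[ℝ] E3}

/-- The flux identity after two vertical integrations by parts in the gap. -/
theorem flux_identity (hg : IsGapChart Ω S Q L a b σ τ τ') (hσ : 0 < σ)
    (hτ' : 0 < τ') (hh : |h| ≤ τ') (hu : MemW120 Ω u Du) (hdiv : DivFree Ω Du)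
    (hrig : ∀ᵐ x ∂(volume.restrict S), u x = V + A (x - (Q + h • vert L)))
    (hA : ∀ x y, ⟪x, A y⟫ = -⟪y, A x⟫)
    (hw : HasWeakGradient (Ω \ closure S) Du D2u)
    (hD2u : MemLp D2u 2 (volume.restrict (Ω \ closure S))) :
    ⟪vert L, V⟫ * ∫ y, radialCutoff σ y =
      -(∫ y, radialSlope σ y * (⟪hor L y, V⟫ * ((a y + b y) / 2))) +
      (∫ y, radialSlope σ y * (⟪hor L y, A (vert L)⟫ * ((b y - h) * (h - a y) / 2))) -
      ∫ z in gapRegion a b σ, ⟪gapWeight a b z • (radialSlope σ z.1 • hor L z.1),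
        D2u (chart Q L z) (vert L) (vert L)⟫ := by
  have hac := hg.contDiff_wall
  have hbc := hg.contDiff_body
  have hac' := hac.continuous
  have hbc' := hbc.continuous
  have hGm := (isOpen_gapRegion hac' hbc' σ).measurableSet
  have hDuF : MemLp Du 2 (volume.restrict (Ω \ closure S)) :=
    MemLp.restrict_mono_set hu.2.2.1 Set.sdiff_subset
  have hκs := tsupport_subset_of_eq_zero hσ (f := fun y => radialSlope σ y • hor L y)
    fun _ h => by rw [radialSlope_eq_zero h, zero_smul]
  have hvc := ContDiff.radialSlope_smul_hor σ L
  have hp : ContDiff ℝ 1 fun z : E2 × ℝ => z.2 - (a z.1 + b z.1) / 2 :=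
    contDiff_snd.sub (((hac.comp contDiff_fst).add (hbc.comp contDiff_fst)).div_const 2)
  have hvol := volume_gapRegion_le hac' hbc' (d := 2 * τ') hσ.le
    (by positivity) fun y hy => by
      have := abs_le.1 (hg.wall_le y hy)
      have := abs_le.1 (hg.body_le y hy)
      linarith
  have hui := (integral_norm_le_sqrt_mul_L2norm
    (fun z hz => (hg.chart_mem_of_mem_gapRegion hz).1) hu.2.1 hg.isOpen_wall.measurableSet
    (by positivity) hvol).1
  have hqi := (integral_norm_le_sqrt_mul_L2norm
    (fun z hz => (hg.chart_mem_of_mem_gapRegion hz).1) (hu.2.2.1.clm_apply_const (vert L))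
    hg.isOpen_wall.measurableSet (by positivity) hvol).1
  obtain ⟨C, hC⟩ := hvc.continuous.bounded_above_of_compact_support hκs.1
  have hC0 : 0 ≤ C := (norm_nonneg _).trans (hC 0)
  have i1 : IntegrableOn (fun z => ⟪radialSlope σ z.1 • hor L z.1, u (chart Q L z)⟫)
      (gapRegion a b σ) := by
    refine Integrable.mono' (hui.norm.const_mul C)
      ((hvc.continuous.comp continuous_fst).aestronglyMeasurable.inner hui.1)
      (Eventually.of_forall fun z => (norm_inner_le_norm _ _).trans ?_)
    gcongr
    exact hC _
  have i2 : IntegrableOn (fun z => (z.2 - (a z.1 + b z.1) / 2) *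
      ⟪radialSlope σ z.1 • hor L z.1, Du (chart Q L z) (vert L)⟫) (gapRegion a b σ) := by
    refine Integrable.mono' (hqi.norm.const_mul (2 * τ' * C))
      (hp.continuous.aestronglyMeasurable.mul
        ((hvc.continuous.comp continuous_fst).aestronglyMeasurable.inner hqi.1)) ?_
    filter_upwards [ae_restrict_mem hGm] with z hz
    rw [norm_mul, mul_assoc, Real.norm_eq_abs]
    have h1 := abs_le.1 (hg.wall_le _ hz.1)
    have h2 := abs_le.1 (hg.body_le _ hz.1)
    have h3 := abs_le.1 (hg.abs_lt_of_mem_gapRegion hz).le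
    gcongr
    · exact abs_le.2 ⟨by linarith, by linarith⟩
    · refine (norm_inner_le_norm _ _).trans ?_
      gcongr
      exact hC _
  have h1 := hg.inner_vert_mul_integral_radialCutoff hσ hτ' hh hu hdiv hrig hA
  -- The primitive of 1 in `t` is normalized to vanish at the midpoint of the segment. The remaining
  -- factor is then minus the derivative of `gapWeight`, which permits a second integration by parts
  -- without boundary terms.
  have h2 := hg.integral_gap_smul hτ' hu hrig hvc hκs.1 hκs.2 hp (p' := fun _ => 1)
    fun z => (hasDerivAt_id' z.2).sub_const ((a z.1 + b z.1) / 2)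
  have h3 := hg.integral_gap_second hw hDuF hD2u hvc hκs.1 hκs.2 hσ hτ'.le
  have h4 : ∫ z in gapRegion a b σ, ⟪((a z.1 + b z.1) / 2 - z.2) •
      (radialSlope σ z.1 • hor L z.1), Du (chart Q L z) (vert L)⟫ =
      - ∫ z in gapRegion a b σ, (z.2 - (a z.1 + b z.1) / 2) *
        ⟪radialSlope σ z.1 • hor L z.1, Du (chart Q L z) (vert L)⟫ := by
    rw [← integral_neg]
    refine integral_congr_ae (Eventually.of_forall fun z => ?_)
    simp only [real_inner_smul_left]
    ring
  simp only [one_mul] at h2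
  rw [integral_add i1 i2] at h2
  rw [h4] at h3
  have hAself : ∀ x, ⟪x, A x⟫ = 0 := fun x => by linarith [hA x x]
  -- The first group cancels the explicit terms of the flux identity, and the term with the constant
  -- `h` is odd. What survives is quadratic in the graphs for `A e`, and involves only the mean
  -- height for `V`.
  have hsum : ∀ y, (b y - (a y + b y) / 2) *
      ⟪radialSlope σ y • hor L y, V + A (hor L y) + (b y - h) • A (vert L)⟫ =
      radialSlope σ y * ((b y - h) * ⟪hor L y, V⟫ +
        (b y - h) ^ 2 / 2 * ⟪hor L y, A (vert L)⟫) +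
      (radialSlope σ y * (h * ⟪hor L y, V⟫) -
      radialSlope σ y * (⟪hor L y, V⟫ * ((a y + b y) / 2)) +
      radialSlope σ y * (⟪hor L y, A (vert L)⟫ * ((b y - h) * (h - a y) / 2))) := by
    intro y
    simp only [real_inner_smul_left, inner_add_right, real_inner_smul_right, hAself]
    ring
  simp only [hsum] at h2
  have j1 := integrable_mul_of_radialSlope hσ (f := fun y => (b y - h) * ⟪hor L y, V⟫ +
    (b y - h) ^ 2 / 2 * ⟪hor L y, A (vert L)⟫) (by fun_prop)
  have j2 := integrable_mul_of_radialSlope hσ (f := fun y => h * ⟪hor L y, V⟫) (by fun_prop)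
  have j3 := integrable_mul_of_radialSlope hσ
    (f := fun y => ⟪hor L y, V⟫ * ((a y + b y) / 2)) (by fun_prop)
  have j4 := integrable_mul_of_radialSlope hσ
    (f := fun y => ⟪hor L y, A (vert L)⟫ * ((b y - h) * (h - a y) / 2)) (by fun_prop)
  have j23 : Integrable fun y => radialSlope σ y * (h * ⟪hor L y, V⟫) -
    radialSlope σ y * (⟪hor L y, V⟫ * ((a y + b y) / 2)) := j2.sub j3
  have j234 : Integrable fun y => radialSlope σ y * (h * ⟪hor L y, V⟫) -
    radialSlope σ y * (⟪hor L y, V⟫ * ((a y + b y) / 2)) +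
      radialSlope σ y * (⟪hor L y, A (vert L)⟫ * ((b y - h) * (h - a y) / 2)) := j23.add j4
  rw [integral_add j1 j234, integral_add j23 j4, integral_sub j2 j3, integral_eq_zero_of_odd
    (f := fun y => radialSlope σ y * (h * ⟪hor L y, V⟫)) fun y => by
      simp only [radialSlope_neg, map_neg, inner_neg_left]; ring] at h2
  simp only [real_inner_smul_left (hor L _)] at h1 h2 h3 ⊢
  linarith

/-- The vertical velocity at the tip of the body is controlled by the second derivatives in the
gap and by the velocity and the angular velocity of the body. -/
theorem abs_inner_vert_mul_le (hg : IsGapChart Ω S Q L a b σ τ τ') (hσ : 0 < σ)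
    (hτ' : 0 < τ') (hh : 0 ≤ h) (hhτ : h ≤ τ') (hu : MemW120 Ω u Du) (hdiv : DivFree Ω Du)
    (hrig : ∀ᵐ x ∂(volume.restrict S), u x = V + A (x - (Q + h • vert L)))
    (hA : ∀ x y, ⟪x, A y⟫ = -⟪y, A x⟫)
    (hw : HasWeakGradient (Ω \ closure S) Du D2u)
    (hD2u : MemLp D2u 2 (volume.restrict (Ω \ closure S)))
    (hK : 0 ≤ K) (hKσ : K * σ ^ 2 ≤ h / 2) (ha : ∀ y, ‖y‖ < σ → |a y| ≤ K * ‖y‖ ^ 2)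
    (hb : ∀ y, ‖y‖ < σ → |b y - h| ≤ K * ‖y‖ ^ 2)
    (ha3 : ∀ y, ‖y‖ < σ → |a y - a (-y)| ≤ 2 * K * ‖y‖ ^ 3)
    (hb3 : ∀ y, ‖y‖ < σ → |b y - b (-y)| ≤ 2 * K * ‖y‖ ^ 3)
    (hM : ∀ s, |deriv cutoffProfile s| ≤ M)
    (hGB : ∀ z ∈ gapRegion a b σ, chart Q L z ∈ B) (hBm : MeasurableSet B)
    (hBF : B ⊆ Ω \ closure S)
    (hm : 0 ≤ m) (hG : volume (gapRegion a b σ) ≤ ENNReal.ofReal m) :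
    |⟪vert L, V⟫| * ∫ y, radialCutoff σ y ≤
      M * (2 / σ ^ 2) * ((‖V‖ * σ) * (K * σ ^ 3)) * (σ ^ 2 * Real.pi) +
      M * (2 / σ ^ 2) * ((‖A (vert L)‖ * σ) * (K * σ ^ 2 * h)) * (σ ^ 2 * Real.pi) +
      (2 * h ^ 2 * (M * (2 / σ ^ 2) * σ)) * (√m * L2norm D2u B) := by
  have hM0 : 0 ≤ M := (abs_nonneg _).trans (hM 0)
  have hac' := hg.contDiff_wall.continuous
  have hbc' := hg.contDiff_body.continuous
  have hGm := (isOpen_gapRegion hac' hbc' σ).measurableSet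
  have hD2B := MemLp.restrict_mono_set (f := D2u) hD2u hBF
  have key := hg.flux_identity hσ hτ' (by rwa [abs_of_nonneg hh]) hu hdiv hrig hA hw hD2u
  have hsmall : ∀ y : E2, ‖y‖ < σ → K * ‖y‖ ^ 2 ≤ h / 2 := fun y hy =>
    (by gcongr : K * ‖y‖ ^ 2 ≤ K * σ ^ 2).trans hKσ
  have hhor : ∀ (X : E3) (y : E2), ‖y‖ < σ → |⟪hor L y, X⟫| ≤ ‖X‖ * σ := by
    intro X y hy
    refine (abs_real_inner_le_norm _ _).trans ?_
    rw [norm_hor, mul_comm]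
    gcongr
  -- Here the absence of symmetry is paid for. The mean height is of order `σ²` apart from a
  -- constant, but only its odd part, of order `K σ³`, meets the odd weight.
  rw [integral_radialSlope_mul_odd hσ (α := fun y => ⟪hor L y, V⟫)
    (s := fun y => (a y + b y) / 2) (by fun_prop) (by fun_prop)
    (fun y => by simp only [map_neg, inner_neg_left])] at key
  have e1 := abs_integral_radialSlope_mul_le hσ hM
    (f := fun y => ⟪hor L y, V⟫ * (((a y + b y) / 2 - (a (-y) + b (-y)) / 2) / 2))
    (C := (‖V‖ * σ) * (K * σ ^ 3)) fun y hy => by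
      rw [abs_mul]
      gcongr
      · exact hhor V y hy
      · have h1 := abs_le.1 (ha3 y hy)
        have h2 := abs_le.1 (hb3 y hy)
        have h3 : K * ‖y‖ ^ 3 ≤ K * σ ^ 3 := by gcongr
        exact abs_le.2 ⟨by linarith, by linarith⟩
  have e2 := abs_integral_radialSlope_mul_le hσ hM
    (f := fun y => ⟪hor L y, A (vert L)⟫ * ((b y - h) * (h - a y) / 2))
    (C := (‖A (vert L)‖ * σ) * (K * σ ^ 2 * h)) fun y hy => by
      rw [abs_mul]
      gcongr
      · exact hhor _ y hy
      · have h1 := abs_le.1 (ha y hy)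
        have h2 : |b y - h| ≤ K * σ ^ 2 := (hb y hy).trans (by gcongr)
        have h3 := hsmall y hy
        have h4 : |h - a y| ≤ 2 * h := abs_le.2 ⟨by linarith, by linarith⟩
        rw [abs_div, abs_mul, abs_two]
        rw [div_le_iff₀ two_pos]
        exact (mul_le_mul h2 h4 (abs_nonneg _) (by positivity)).trans_eq (by ring)
  have e3 := abs_setIntegral_le_L2norm (f := D2u) hGm hGB hD2B hBm hm hG
    (C := 2 * h ^ 2 * (M * (2 / σ ^ 2) * σ))
    (F := fun z => ⟪gapWeight a b z • (radialSlope σ z.1 • hor L z.1),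
      D2u (chart Q L z) (vert L) (vert L)⟫) (by positivity) fun z hz => by
      refine (abs_real_inner_le_norm _ _).trans ?_
      rw [norm_smul, norm_smul, norm_hor, Real.norm_eq_abs, Real.norm_eq_abs]
      have h1 := abs_le.1 (ha _ hz.1)
      have h2 := abs_le.1 (hb _ hz.1)
      have h3 := hsmall _ hz.1
      have h4 : 0 < z.2 - a z.1 := by linarith [hz.2.1]
      have h5 : 0 < b z.1 - z.2 := by linarith [hz.2.2]
      -- Since `K σ² ≤ h/2`, each graph deviates by at most `h/2`, so the gap is at most `2h` thick.
      have h6 : (z.2 - a z.1) * (b z.1 - z.2) ≤ (2 * h) * (2 * h) :=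
        mul_le_mul (by linarith [hz.2.2]) (by linarith [hz.2.1]) h5.le (by linarith)
      have h7 : |gapWeight a b z| ≤ 2 * h ^ 2 := by
        have : 0 < gapWeight a b z := by unfold gapWeight; positivity
        rw [abs_of_pos this]
        unfold gapWeight
        rw [div_le_iff₀ two_pos]
        exact h6.trans_eq (by ring)
      gcongr
      · exact abs_radialSlope_le hM _
      · exact hz.1.le
      · have h8 := ((D2u (chart Q L z)) (vert L)).le_opNorm (vert L)
        have h9 := (D2u (chart Q L z)).le_opNorm (vert L)
        rw [norm_vert, mul_one] at h8 h9
        exact h8.trans h9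
  have hI : 0 ≤ ∫ y, radialCutoff σ y := integral_nonneg fun y => radialCutoff_nonneg σ y
  rw [← abs_of_nonneg hI, ← abs_mul, key]
  refine (abs_sub _ _).trans (add_le_add ((abs_add_le _ _).trans (add_le_add ?_ e2)) e3)
  rwa [abs_neg]

end IsGapChart

/-! ### Local graphs -/

set_option maxSynthPendingDepth 3 in
/-- A `C³` function with vanishing value and gradient at the origin and bounded second and third
derivatives is quadratically small, and its odd part is cubically small. -/
theorem graph_bounds {K r : ℝ} {g : E2 → ℝ} (hg : ContDiffOn ℝ 3 g (Metric.ball 0 r))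
    (h0 : g 0 = 0) (h1 : fderiv ℝ g 0 = 0)
    (hK : ∀ y ∈ Metric.ball (0 : E2) r,
      ‖iteratedFDeriv ℝ 2 g y‖ ≤ K ∧ ‖iteratedFDeriv ℝ 3 g y‖ ≤ K) {y : E2} (hy : ‖y‖ < r) :
    |g y| ≤ K * ‖y‖ ^ 2 ∧ |g y - g (-y)| ≤ 2 * K * ‖y‖ ^ 3 := by
  have hgat : ∀ x : E2, ‖x‖ < r → ContDiffAt ℝ 3 g x := fun x hx =>
    hg.contDiffAt (Metric.isOpen_ball.mem_nhds (by simpa using hx))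
  have hd1 : ∀ x : E2, ‖x‖ < r → DifferentiableAt ℝ g x := fun x hx =>
    (hgat x hx).differentiableAt (by norm_num)
  have hc2 : ∀ x : E2, ‖x‖ < r → ContDiffAt ℝ 2 (fderiv ℝ g) x := fun x hx =>
    (hgat x hx).fderiv_right (by norm_num)
  have hc3 : ∀ x : E2, ‖x‖ < r → ContDiffAt ℝ 1 (fderiv ℝ (fderiv ℝ g)) x := fun x hx =>
    (hc2 x hx).fderiv_right (by norm_num)
  have hd2 : ∀ x : E2, ‖x‖ < r → DifferentiableAt ℝ (fderiv ℝ g) x := fun x hx =>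
    (hc2 x hx).differentiableAt (by norm_num)
  have hd3 : ∀ x : E2, ‖x‖ < r → DifferentiableAt ℝ (fderiv ℝ (fderiv ℝ g)) x := fun x hx =>
    (hc3 x hx).differentiableAt (by norm_num)
  have hb2 : ∀ x : E2, ‖x‖ < r → ‖fderiv ℝ (fderiv ℝ g) x‖ ≤ K := fun x hx => by
    rw [← norm_iteratedFDeriv_one, norm_iteratedFDeriv_fderiv]
    exact (hK x (by simpa using hx)).1
  have hb3 : ∀ x : E2, ‖x‖ < r → ‖fderiv ℝ (fderiv ℝ (fderiv ℝ g)) x‖ ≤ K := fun x hx => by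
    rw [← norm_iteratedFDeriv_one, norm_iteratedFDeriv_fderiv, norm_iteratedFDeriv_fderiv]
    exact (hK x (by simpa using hx)).2
  have hK0 : 0 ≤ K := (norm_nonneg _).trans (hK y (by simpa using hy)).1
  have hball : ∀ x ∈ Metric.closedBall (0 : E2) ‖y‖, ‖x‖ ≤ ‖y‖ := fun x hx => by simpa using hx
  have hconv := convex_closedBall (0 : E2) ‖y‖
  have hm0 : (0 : E2) ∈ Metric.closedBall (0 : E2) ‖y‖ := by simp
  have hmy : y ∈ Metric.closedBall (0 : E2) ‖y‖ := by simp
  have hgrad : ∀ x ∈ Metric.closedBall (0 : E2) ‖y‖, ‖fderiv ℝ g x‖ ≤ K * ‖y‖ := by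
    intro x hx
    have := hconv.norm_image_sub_le_of_norm_fderiv_le (f := fderiv ℝ g) (C := K)
      (fun z hz => hd2 z ((hball z hz).trans_lt hy))
      (fun z hz => hb2 z ((hball z hz).trans_lt hy)) hm0 hx
    rw [h1, sub_zero, sub_zero] at this
    exact this.trans (by gcongr; exact hball x hx)
  refine ⟨?_, ?_⟩
  · have := hconv.norm_image_sub_le_of_norm_fderiv_le (f := g)
      (fun z hz => hd1 z ((hball z hz).trans_lt hy)) hgrad hm0 hmy
    rw [h0, sub_zero, sub_zero, Real.norm_eq_abs] at this
    exact this.trans_eq (by ring)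
  · have hneg : ∀ x ∈ Metric.closedBall (0 : E2) ‖y‖, -x ∈ Metric.closedBall (0 : E2) ‖y‖ :=
      fun x hx => by simpa using hx
    have hnegd : ∀ x : E2, HasFDerivAt (fun x : E2 => -x) (-ContinuousLinearMap.id ℝ E2) x :=
      fun x => (hasFDerivAt_id x).neg
    -- The function `g x - g (-x)` has gradient `∇g(x) + ∇g(-x)`, whose derivative is `D²g(x) -
    -- D²g(-x)`. The third-derivative bound makes the latter of size `2K‖y‖`, and two applications
    -- of the mean value inequality from the origin give the cubic bound.
    have hH : ∀ x ∈ Metric.closedBall (0 : E2) ‖y‖,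
        HasFDerivAt (fun x => fderiv ℝ g x + fderiv ℝ g (-x))
          (fderiv ℝ (fderiv ℝ g) x - fderiv ℝ (fderiv ℝ g) (-x)) x := by
      intro x hx
      have e1 := (hd2 x ((hball x hx).trans_lt hy)).hasFDerivAt
      have e2 := (hd2 (-x) ((hball _ (hneg x hx)).trans_lt hy)).hasFDerivAt.comp x (hnegd x)
      refine (e1.add e2).congr_fderiv ?_
      ext v w
      simp [sub_eq_add_neg]
    have hHb : ∀ x ∈ Metric.closedBall (0 : E2) ‖y‖,
        ‖fderiv ℝ (fderiv ℝ g) x - fderiv ℝ (fderiv ℝ g) (-x)‖ ≤ 2 * K * ‖y‖ := by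
      intro x hx
      have := hconv.norm_image_sub_le_of_norm_fderiv_le (f := fderiv ℝ (fderiv ℝ g)) (C := K)
        (fun z hz => hd3 z ((hball z hz).trans_lt hy))
        (fun z hz => hb3 z ((hball z hz).trans_lt hy)) (hneg x hx) hx
      refine this.trans ?_
      rw [sub_neg_eq_add, ← two_smul ℝ x, norm_smul, Real.norm_two]
      nlinarith [mul_le_mul_of_nonneg_left (hball x hx) hK0]
    have hGb : ∀ x ∈ Metric.closedBall (0 : E2) ‖y‖,
        ‖fderiv ℝ g x + fderiv ℝ g (-x)‖ ≤ 2 * K * ‖y‖ * ‖y‖ := by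
      intro x hx
      have := hconv.norm_image_sub_le_of_norm_hasFDerivWithin_le
        (fun z hz => (hH z hz).hasFDerivWithinAt) hHb hm0 hx
      rw [neg_zero, h1, add_zero, sub_zero, sub_zero] at this
      exact this.trans (by gcongr; exact hball x hx)
    have hG : ∀ x ∈ Metric.closedBall (0 : E2) ‖y‖,
        HasFDerivAt (fun x => g x - g (-x)) (fderiv ℝ g x + fderiv ℝ g (-x)) x := by
      intro x hx
      have e1 := (hd1 x ((hball x hx).trans_lt hy)).hasFDerivAt
      have e2 := (hd1 (-x) ((hball _ (hneg x hx)).trans_lt hy)).hasFDerivAt.comp x (hnegd x)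
      refine (e1.sub e2).congr_fderiv ?_
      ext v
      simp
    have := hconv.norm_image_sub_le_of_norm_hasFDerivWithin_le
      (fun z hz => (hG z hz).hasFDerivWithinAt) hGb hm0 hmy
    rw [neg_zero, sub_self, sub_zero, sub_zero, Real.norm_eq_abs] at this
    exact this.trans_eq (by ring)

/-- In the coordinates `chart x₀ L`, inside the cylinder `|y| < r`, `|t| < r`, the set `D` lies
above the graph of `g`. -/
structure IsLocalGraph (K r : ℝ) (D : Set E3) (x₀ : E3) (L : E3 ≃ₗᵢ[ℝ] E3) (g : E2 → ℝ) :
    Prop where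
  nonneg : 0 ≤ K
  contDiffOn : ContDiffOn ℝ 1 g (Metric.ball 0 r)
  quad_le : ∀ y, ‖y‖ < r → |g y| ≤ K * ‖y‖ ^ 2
  odd_le : ∀ y, ‖y‖ < r → |g y - g (-y)| ≤ 2 * K * ‖y‖ ^ 3
  mem_iff : ∀ y t, ‖y‖ < r → |t| < r → (chart x₀ L (y, t) ∈ D ↔ g y < t)

theorem UniformC3With.exists_isLocalGraph {K r : ℝ} (hr : 0 < r) {D : Set E3}
    (h : UniformC3With K r D) {x₀ : E3} (hx : x₀ ∈ frontier D) :
    ∃ L g, IsLocalGraph K r D x₀ L g := by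
  obtain ⟨R, g, hR, hg, h0, h1, hK, hD⟩ := h x₀ hx
  refine ⟨R.linearIsometryEquiv, g, (norm_nonneg _).trans (hK 0 (by simpa using hr)).1,
    hg.of_le (by norm_num), fun y hy => (graph_bounds hg h0 h1 hK hy).1,
    fun y hy => (graph_bounds hg h0 h1 hK hy).2, fun y t hy ht => ?_⟩
  have hpt : horiz (ptEquiv (y, t)) = y ∧ ptEquiv (y, t) 2 = t := by
    have := ptEquiv.symm_apply_apply (y, t)
    rw [ptEquiv_symm_apply, Prod.mk.injEq] at this
    exact this
  have hRc : chart x₀ R.linearIsometryEquiv (y, t) = R (ptEquiv (y, t)) := by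
    have := R.map_vadd 0 (ptEquiv (y, t))
    rw [hR, vadd_eq_add, add_zero, vadd_eq_add] at this
    rw [this, chart_apply, add_comm]
  rw [hRc, hD _ (by rwa [hpt.1]) (by rwa [hpt.2]), hpt.1, hpt.2]

theorem exists_eq_hor_add (L : E3 ≃ₗᵢ[ℝ] E3) (v : E3) :
    ∃ y, v = hor L y + ⟪v, vert L⟫ • vert L := by
  obtain ⟨w, rfl⟩ : ∃ w, v = L (ptEquiv w) := ⟨ptEquiv.symm (L.symm v), by simp⟩
  refine ⟨w.1, ?_⟩
  rw [map_ptEquiv, inner_add_left, inner_hor_vert, real_inner_smul_left, inner_vert_vert, zero_add,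
    mul_one]

namespace IsLocalGraph

variable {K r : ℝ} {D : Set E3} {x₀ : E3} {L : E3 ≃ₗᵢ[ℝ] E3} {g : E2 → ℝ}

/-- Along a ray the height changes linearly in `t` while the graph deviates only quadratically, so
the sign of the normal component decides for small `t`. -/
theorem eventually_mem_iff (h : IsLocalGraph K r D x₀ L g) (hr : 0 < r) {v : E3}
    (hv : ⟪v, vert L⟫ ≠ 0) :
    ∀ᶠ t : ℝ in 𝓝[>] 0, (x₀ + t • v ∈ D ↔ 0 < ⟪v, vert L⟫) := by
  obtain ⟨y, hy⟩ := exists_eq_hor_add L v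
  set s := ⟪v, vert L⟫ with hs
  have h1 : ∀ᶠ t : ℝ in 𝓝[>] 0, ‖t • y‖ < r :=
    nhdsWithin_le_nhds <| (show Continuous fun t : ℝ => ‖t • y‖ by fun_prop).continuousAt.eventually
      (gt_mem_nhds (by simpa using hr))
  have h2 : ∀ᶠ t : ℝ in 𝓝[>] 0, |t * s| < r :=
    nhdsWithin_le_nhds <| (show Continuous fun t : ℝ => |t * s| by fun_prop).continuousAt.eventually
      (gt_mem_nhds (by simpa using hr))
  have h3 : ∀ᶠ t : ℝ in 𝓝[>] 0, K * ‖y‖ ^ 2 * t < |s| :=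
    nhdsWithin_le_nhds <| (show Continuous fun t : ℝ => K * ‖y‖ ^ 2 * t by
      fun_prop).continuousAt.eventually (gt_mem_nhds (by simpa using hv))
  filter_upwards [h1, h2, h3, self_mem_nhdsWithin] with t h1 h2 h3 ht
  have ht : 0 < t := ht
  have e : x₀ + t • v = chart x₀ L (t • y, t * s) := by
    rw [chart_eq]
    conv_lhs => rw [hy]
    simp [mul_smul]
  rw [e, h.mem_iff _ _ h1 h2]
  have hg := abs_le.1 (h.quad_le _ h1)
  rw [norm_smul, mul_pow, Real.norm_eq_abs, sq_abs] at hg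
  have h4 : K * (t ^ 2 * ‖y‖ ^ 2) < t * |s| := by
    have := mul_lt_mul_of_pos_left h3 ht
    linarith
  constructor
  · intro hlt
    by_contra! hle
    rw [abs_of_nonpos hle] at h4
    linarith
  · intro hpos
    rw [abs_of_pos hpos] at h4
    linarith

/-- A `C¹` function on the whole plane describing the same local graph. -/
theorem exists_contDiff (h : IsLocalGraph K r D x₀ L g) (hr : 0 < r) :
    ∃ g' : E2 → ℝ, ContDiff ℝ 1 g' ∧ ∀ y, ‖y‖ < r / 2 → g' y = g y := by
  let B : ContDiffBump (0 : E2) := ⟨r / 2, 3 * r / 4, by linarith, by linarith⟩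
  refine ⟨fun y => B y * g y, contDiff_iff_contDiffAt.2 fun y => ?_, fun y hy => ?_⟩
  · by_cases hy : ‖y‖ < r
    · exact B.contDiff.contDiffAt.mul
        (h.contDiffOn.contDiffAt (Metric.isOpen_ball.mem_nhds (by simpa using hy)))
    · have hz : (fun y => B y * g y) =ᶠ[𝓝 y] fun _ => 0 := by
        have : y ∈ (tsupport B)ᶜ := by
          rw [B.tsupport_eq]
          simp only [B, Set.mem_compl_iff, Metric.mem_closedBall, dist_zero_right]
          linarith
        filter_upwards [(isClosed_tsupport B).isOpen_compl.mem_nhds this] with z hz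
        rw [image_eq_zero_of_notMem_tsupport hz, zero_mul]
      exact contDiffAt_const.congr_of_eventuallyEq hz
  · have : B y = 1 := B.one_of_mem_closedBall (by simpa [B] using hy.le)
    simp [this]

end IsLocalGraph

/-- If the unit vectors differed, `v = n - e` would have positive product with `n` and negative
product with `e`. -/
theorem eq_of_forall_inner_nonneg {n e : E3} (hn : ‖n‖ = 1) (he : ‖e‖ = 1)
    (h : ∀ v : E3, 0 < ⟪v, n⟫ → 0 ≤ ⟪v, e⟫) : n = e := by
  by_contra hne
  have hlt : ⟪n, e⟫ < 1 := (inner_lt_one_iff_real_of_norm_eq_one hn he).2 hne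
  have h1 : ⟪n - e, n⟫ = 1 - ⟪n, e⟫ := by
    rw [inner_sub_left, real_inner_self_eq_norm_sq, hn, real_inner_comm]; norm_num
  have h2 : ⟪n - e, e⟫ = ⟪n, e⟫ - 1 := by
    rw [inner_sub_left, real_inner_self_eq_norm_sq, he]; norm_num
  have := h (n - e) (by rw [h1]; linarith)
  rw [h2] at this
  linarith

/-- In the expansion of `‖h • e + t • v‖²` the term linear in `t` is `2 h t ⟪v, e⟫`. A negative
coefficient would bring the norm below `h` for small `t`. -/
theorem inner_nonneg_of_eventually_le_norm {e v : E3} {h : ℝ} (he : ‖e‖ = 1) (hh : 0 < h)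
    (hv : ∀ᶠ t : ℝ in 𝓝[>] 0, h ≤ ‖h • e + t • v‖) : 0 ≤ ⟪v, e⟫ := by
  by_contra! hneg
  have h1 : ∀ᶠ t : ℝ in 𝓝[>] 0, t * ‖v‖ ^ 2 < -(2 * h * ⟪v, e⟫) :=
    nhdsWithin_le_nhds <| (show Continuous fun t : ℝ => t * ‖v‖ ^ 2 by
      fun_prop).continuousAt.eventually (gt_mem_nhds (by
        show (0 : ℝ) * ‖v‖ ^ 2 < _
        nlinarith [mul_pos hh (neg_pos.2 hneg)]))
  obtain ⟨t, ⟨h2, h3⟩, ht⟩ := ((hv.and h1).and self_mem_nhdsWithin).exists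
  have ht : 0 < t := ht
  have h4 : ‖h • e + t • v‖ ^ 2 = h ^ 2 + 2 * (h * t * ⟪v, e⟫) + t ^ 2 * ‖v‖ ^ 2 := by
    rw [norm_add_sq_real, norm_smul, norm_smul, he, real_inner_smul_left, real_inner_smul_right,
      real_inner_comm, Real.norm_eq_abs, Real.norm_eq_abs, mul_one, sq_abs, mul_pow, sq_abs]
    ring
  have h5 : h ^ 2 ≤ ‖h • e + t • v‖ ^ 2 := by gcongr
  nlinarith

/-- The open ball of radius `h` about `P` misses `∂Ω`. It is connected and contains `P ∈ Ω`, hence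
lies in `Ω`. -/
theorem IsGapFrame.le_dist_of_notMem {Ω S : Set E3} {P Q e : E3} {h : ℝ}
    (hf : IsGapFrame Ω S P Q e h) (hΩ : IsOpen Ω) (hSΩ : S ⊆ Ω) (hh : 0 < h) {x : E3}
    (hx : x ∉ Ω) : h ≤ dist x P := by
  by_contra! hlt
  have hPS : P ∈ closure S := hf.mem_body.1
  have hmin : ∀ y ∈ frontier Ω, h ≤ dist P y := fun y hy =>
    closure_minimal (t := {x | h ≤ dist x y}) (fun x hx => hf.minimal x hx y hy)
      (isClosed_le continuous_const (by fun_prop)) hPS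
  have hPΩ : P ∈ Ω := by
    by_contra hP
    have hfr : P ∈ frontier Ω := ⟨closure_mono hSΩ hPS, fun h => hP (interior_subset h)⟩
    have := hmin P hfr
    rw [dist_self] at this
    linarith
  have hball : ∀ y ∈ Metric.ball P h, y ∉ frontier Ω := fun y hy hyf =>
    (Metric.mem_ball'.1 hy).not_ge (hmin y hyf)
  rcases isPreconnected_iff_subset_of_disjoint.1 (convex_ball P h).isPreconnected Ω (closure Ω)ᶜ
    hΩ isClosed_closure.isOpen_compl
    (fun y hy => by
      by_contra hc
      simp only [Set.mem_union, Set.mem_compl_iff, not_or, not_not] at hc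
      exact hball y hy ⟨hc.2, fun hi => hc.1 (interior_subset hi)⟩)
    (Set.eq_empty_of_forall_notMem fun y hy => hy.2.2 (subset_closure hy.2.1)) with hs | hs
  · exact hx (hs hlt)
  · exact hs (Metric.mem_ball_self hh) (subset_closure hPΩ)

/-- The two boundary pieces facing each other in the gap are graphs over the same plane. -/
theorem IsGapFrame.exists_isLocalGraph {K r : ℝ} (hr : 0 < r) {Ω S : Set E3} {P Q e : E3} {h : ℝ}
    (hf : IsGapFrame Ω S P Q e h) (hΩ : IsOpen Ω) (hSΩ : S ⊆ Ω) (hΩ3 : UniformC3With K r Ω)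
    (hS3 : UniformC3With K r S) :
    ∃ (L L' : E3 ≃ₗᵢ[ℝ] E3) (a g : E2 → ℝ), IsLocalGraph K r Ω Q L a ∧
      IsLocalGraph K r S P L' g ∧ vert L' = vert L ∧ P = Q + h • vert L ∧
      (0 < h → vert L = e) := by
  obtain ⟨L, a, ha⟩ := hΩ3.exists_isLocalGraph hr hf.mem_wall
  obtain ⟨L', g, hg⟩ := hS3.exists_isLocalGraph hr hf.mem_body
  have hh : 0 ≤ h := hf.dist_eq ▸ dist_nonneg
  rcases hh.eq_or_lt with h0 | hpos
  · have hPQ : P = Q := by rw [hf.axis, ← h0, zero_smul, add_zero]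
    -- At a contact point, a direction pointing strictly into `S` and strictly out of `Ω` would
    -- contradict `S ⊆ Ω`.
    have hv : vert L' = vert L := by
      refine eq_of_forall_inner_nonneg (norm_vert _) (norm_vert _) fun v hv => ?_
      by_contra! hneg
      obtain ⟨t, h1, h2⟩ := ((hg.eventually_mem_iff hr hv.ne').and
        (ha.eventually_mem_iff hr hneg.ne)).exists
      exact lt_asymm hneg (h2.1 (hPQ ▸ hSΩ (h1.2 hv)))
    exact ⟨L, L', a, g, ha, hg, hv, by rw [hPQ, ← h0, zero_smul, add_zero],
      fun h1 => absurd h0 h1.ne⟩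
  · have hL' : vert L' = e := by
      -- Moving from `P` into the body cannot bring a point closer to `Q` than `h`, so the inner
      -- half-space of `S` at `P` lies in `{⟪v, e⟫ ≥ 0}`.
      refine eq_of_forall_inner_nonneg (norm_vert _) hf.unit fun v hv => ?_
      refine inner_nonneg_of_eventually_le_norm hf.unit hpos ?_
      filter_upwards [hg.eventually_mem_iff hr hv.ne'] with t ht
      have := hf.minimal _ (ht.2 hv) Q hf.mem_wall
      rwa [dist_eq_norm, hf.axis, add_assoc, add_sub_cancel_left] at this
    have hL : vert L = e := by
      refine eq_of_forall_inner_nonneg (norm_vert _) hf.unit fun v hv => ?_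
      refine inner_nonneg_of_eventually_le_norm hf.unit hpos ?_
      -- At `Q` the outward directions are used. Points just outside `Ω` stay at distance at least
      -- `h` from `P`.
      have hv' : ⟪-v, vert L⟫ < 0 := by rw [inner_neg_left]; linarith
      filter_upwards [ha.eventually_mem_iff hr hv'.ne] with t ht
      have := hf.le_dist_of_notMem hΩ hSΩ hpos fun hm => lt_asymm hv' (ht.1 hm)
      rw [dist_comm, dist_eq_norm, hf.axis] at this
      have e1 : h • e + t • v = Q + h • e - (Q + t • -v) := by rw [smul_neg]; abel
      rwa [e1]
    exact ⟨L, L', a, g, ha, hg, hL'.trans hL.symm, by rw [hL]; exact hf.axis, fun _ => hL⟩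

/-- The two local charts share their normal but not their horizontal axes. Composing the body graph
with the plane isometry between the two frames puts both over one plane. The bounds survive, as the
isometry is linear and preserves norms. -/
theorem IsGapFrame.exists_isGapChart {K r : ℝ} (hr : 0 < r) {Ω S : Set E3} {P Q e : E3} {h : ℝ}
    (hf : IsGapFrame Ω S P Q e h) (hΩ : IsOpen Ω) (hS : IsOpen S) (hSΩ : S ⊆ Ω)
    (hΩ3 : UniformC3With K r Ω) (hS3 : UniformC3With K r S) :
    ∃ (L : E3 ≃ₗᵢ[ℝ] E3) (a b : E2 → ℝ), 0 ≤ K ∧ P = Q + h • vert L ∧ (0 < h → vert L = e) ∧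
      (∀ σ, σ ≤ r / 2 → K * σ ^ 2 + h ≤ r / 4 → IsGapChart Ω S Q L a b σ (r / 2) (r / 4)) ∧
      ∀ y, ‖y‖ < r / 2 → |a y| ≤ K * ‖y‖ ^ 2 ∧ |b y - h| ≤ K * ‖y‖ ^ 2 ∧
        |a y - a (-y)| ≤ 2 * K * ‖y‖ ^ 3 ∧ |b y - b (-y)| ≤ 2 * K * ‖y‖ ^ 3 := by
  obtain ⟨L, L', a₀, g₀, ha₀, hg₀, hLL', hP, hLe⟩ :=
    hf.exists_isLocalGraph hr hΩ hSΩ hΩ3 hS3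
  obtain ⟨a, ha, haeq⟩ := ha₀.exists_contDiff hr
  obtain ⟨g, hg, hgeq⟩ := hg₀.exists_contDiff hr
  have hh : 0 ≤ h := hf.dist_eq ▸ dist_nonneg
  let ρ : E2 →L[ℝ] E2 := (ContinuousLinearMap.fst ℝ E2 ℝ).comp
    ((ptEquiv.symm : E3 →L[ℝ] E2 × ℝ).comp
      ((L'.symm.toContinuousLinearEquiv : E3 →L[ℝ] E3).comp (hor L)))
  have hρ : ∀ y, hor L' (ρ y) = hor L y := by
    intro y
    obtain ⟨w, hw⟩ : ∃ w, hor L y = L' (ptEquiv w) := ⟨ptEquiv.symm (L'.symm (hor L y)), by simp⟩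
    have hw1 : ρ y = w.1 := by
      change (ptEquiv.symm (L'.symm (hor L y))).1 = w.1
      rw [hw]
      simp
    have h0 : ⟪hor L y, vert L'⟫ = 0 := by rw [hLL', inner_hor_vert]
    rw [hw, map_ptEquiv, inner_add_left, inner_hor_vert, real_inner_smul_left, inner_vert_vert,
      zero_add, mul_one] at h0
    rw [hw, map_ptEquiv, h0, zero_smul, add_zero, hw1]
  have hρn : ∀ y, ‖ρ y‖ = ‖y‖ := fun y => by rw [← norm_hor L', hρ, norm_hor]
  have hhalf : ∀ {x : ℝ}, x < r / 2 → x < r := fun hx => by linarith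
  have hquad_a : ∀ y, ‖y‖ < r / 2 → |a y| ≤ K * ‖y‖ ^ 2 := fun y hy => by
    rw [haeq y hy]; exact ha₀.quad_le y (hhalf hy)
  have hquad_g : ∀ y, ‖y‖ < r / 2 → |g (ρ y)| ≤ K * ‖y‖ ^ 2 := fun y hy => by
    rw [hgeq _ (by rwa [hρn]), ← hρn y]; exact hg₀.quad_le _ (by rw [hρn]; exact hhalf hy)
  have hK := ha₀.nonneg
  refine ⟨L, a, fun y => h + g (ρ y), hK, hP, hLe, fun σ hσ hσ4 => ?_, fun y hy =>
    ⟨hquad_a y hy, by simpa using hquad_g y hy, ?_, ?_⟩⟩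
  · have hsq : ∀ y : E2, ‖y‖ < σ → K * ‖y‖ ^ 2 ≤ K * σ ^ 2 := fun y hy => by gcongr
    refine ⟨hΩ, hS, fun y t hy ht => ?_, fun y t hy ht => ?_, ha,
      contDiff_const.add (hg.comp ρ.contDiff), fun y hy => ?_, fun y hy => ?_, by linarith, hSΩ⟩
    · rw [haeq y (hy.trans_le hσ)]
      exact ha₀.mem_iff y t (hhalf (hy.trans_le hσ)) (hhalf ht)
    · have hKσ : 0 ≤ K * σ ^ 2 := by positivity
      have ht' : |t - h| < r := by
        have := abs_lt.1 ht
        exact abs_lt.2 ⟨by linarith, by linarith⟩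
      have e1 : chart Q L (y, t) = chart P L' (ρ y, t - h) := by
        rw [chart_eq, chart_eq, hρ, hLL', hP, sub_smul]
        abel
      rw [e1, hg₀.mem_iff _ _ (by rw [hρn]; exact hhalf (hy.trans_le hσ)) ht',
        hgeq _ (by rw [hρn]; exact hy.trans_le hσ), lt_sub_iff_add_lt, add_comm]
    · have := hquad_a y (hy.trans_le hσ)
      have := hsq y hy
      linarith
    · have h1 := abs_le.1 (hquad_g y (hy.trans_le hσ))
      have h2 := hsq y hy
      exact abs_le.2 ⟨by linarith, by linarith⟩
  · rw [haeq y hy, haeq (-y) (by rwa [norm_neg])]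
    exact ha₀.odd_le y (hhalf hy)
  · simp only [map_neg, add_sub_add_left_eq_sub]
    rw [hgeq _ (by rwa [hρn]), hgeq _ (by rwa [norm_neg, hρn]), ← hρn y]
    exact hg₀.odd_le _ (by rw [hρn]; exact hhalf hy)

theorem isOpen_gapCylinder (Q e : E3) (K h σ : ℝ) : IsOpen (gapCylinder Q e K h σ) :=
  (isOpen_lt (by fun_prop) continuous_const).and
    ((isOpen_lt continuous_const (by fun_prop)).and (isOpen_lt (by fun_prop) continuous_const))

theorem chart_mem_gapCylinder {Q : E3} {L : E3 ≃ₗᵢ[ℝ] E3} {a b : E2 → ℝ} {K h σ : ℝ} (hK : 0 ≤ K)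
    (ha : ∀ y, ‖y‖ < σ → |a y| ≤ K * ‖y‖ ^ 2) (hb : ∀ y, ‖y‖ < σ → |b y - h| ≤ K * ‖y‖ ^ 2)
    {z : E2 × ℝ} (hz : z ∈ gapRegion a b σ) :
    chart Q L z ∈ gapCylinder Q (vert L) K h σ := by
  have e1 : chart Q L z - Q = hor L z.1 + z.2 • vert L := by
    rw [chart_eq, add_sub_cancel_left]
  have e2 : ⟪chart Q L z - Q, vert L⟫ = z.2 := by
    rw [e1, inner_add_left, inner_hor_vert, real_inner_smul_left, inner_vert_vert]
    ring
  obtain ⟨h1, h2, h3⟩ := hz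
  have h4 := abs_le.1 (ha _ h1)
  have h5 := abs_le.1 (hb _ h1)
  have h6 : K * ‖z.1‖ ^ 2 ≤ K * σ ^ 2 := by gcongr
  have h7 : 0 ≤ K * σ ^ 2 := by positivity
  refine ⟨?_, ?_, ?_⟩
  · rw [e2, e1, add_sub_cancel_right, norm_hor]
    exact h1
  · rw [e2]; linarith
  · rw [e2]; linarith

/-! ### The vertical velocity of the tip of the body -/

namespace IsGapChart

variable {Ω S B : Set E3} {Q : E3} {L : E3 ≃ₗᵢ[ℝ] E3} {a b : E2 → ℝ} {σ τ τ' h K c s : ℝ}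
  {u : E3 → E3} {Du : E3 → E3 →L[ℝ] E3} {D2u : E3 → E3 →L[ℝ] E3 →L[ℝ] E3} {V : E3}
  {A : E3 →L[ℝ] E3}

/-- A body touching the wall has no velocity at the contact point. -/
theorem eq_zero_of_contact (hσ : 0 < σ)
    (hg : ∀ ρ, 0 < ρ → ρ ≤ σ → IsGapChart Ω S Q L a b ρ τ τ') (hτ' : 0 < τ')
    (hu : MemW120 Ω u Du)
    (hrig : ∀ᵐ x ∂(volume.restrict S), u x = V + A (x - (Q + (0 : ℝ) • vert L)))
    (hK : 0 ≤ K) (ha : ∀ y, ‖y‖ < σ → |a y| ≤ K * ‖y‖ ^ 2)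
    (hb : ∀ y, ‖y‖ < σ → |b y - 0| ≤ K * ‖y‖ ^ 2) : V = 0 := by
  have hI : 0 < ∫ y : E2, cutoffProfile (‖y‖ ^ 2) := by
    simpa using integral_cutoffProfile_pos (f := fun _ => 1) continuous_const
      (fun _ _ => one_pos) fun _ => zero_le_one
  set I := ∫ y : E2, cutoffProfile (‖y‖ ^ 2) with hIdef
  set q := √(2 * K * Real.pi) with hq
  have hq2 : q ^ 2 = 2 * K * Real.pi := Real.sq_sqrt (by positivity)
  have hq0 : 0 ≤ q := Real.sqrt_nonneg _
  have hac := (hg σ hσ le_rfl).contDiff_wall.continuous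
  have hbc := (hg σ hσ le_rfl).contDiff_body.continuous
  have main : ∀ ε : ℝ, 0 < ε →
      ‖V‖ * I ≤ (‖A (vert L)‖ * K * Real.pi + q) * ε := by
    intro ε hε
    -- Absolute continuity of the `L²` norm. The gap over a disc of radius `ρ` has volume of order
    -- `ρ⁴`, whose square root exactly balances the factor `ρ²` in front of `‖V‖`. The gain
    -- therefore comes from the gradient norm over the shrinking gap.
    obtain ⟨δ, hδ, hδε⟩ := hu.2.2.1.eLpNorm_indicator_le (by norm_num) (by norm_num) hε
    have h1 : ∀ᶠ ρ : ℝ in 𝓝[>] 0, ρ ^ 2 < ε :=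
      nhdsWithin_le_nhds <| (show Continuous fun ρ : ℝ => ρ ^ 2 by
        fun_prop).continuousAt.eventually (gt_mem_nhds (by simpa using hε))
    have h2 : ∀ᶠ ρ : ℝ in 𝓝[>] 0, (q * ρ ^ 2) ^ 2 < δ :=
      nhdsWithin_le_nhds <| (show Continuous fun ρ : ℝ => (q * ρ ^ 2) ^ 2 by
        fun_prop).continuousAt.eventually (gt_mem_nhds (by simpa using hδ))
    have h3 : ∀ᶠ ρ : ℝ in 𝓝[>] 0, ρ < σ := nhdsWithin_le_nhds (gt_mem_nhds hσ)
    obtain ⟨ρ, ⟨⟨h1, h2⟩, h3⟩, hρ⟩ := (((h1.and h2).and h3).and self_mem_nhdsWithin).exists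
    have hρ : 0 < ρ := hρ
    have hgρ := hg ρ hρ h3.le
    have hvol : volume (gapRegion a b ρ) ≤ ENNReal.ofReal ((q * ρ ^ 2) ^ 2) := by
      have := volume_gapRegion_le hac hbc hρ.le (d := 2 * (K * ρ ^ 2)) (by positivity)
        fun y hy => by
          have e1 := abs_le.1 (ha y (hy.trans h3))
          have e2 := abs_le.1 (hb y (hy.trans h3))
          have e3 : K * ‖y‖ ^ 2 ≤ K * ρ ^ 2 := by gcongr
          linarith
      refine this.trans_eq (congrArg _ ?_)
      rw [mul_pow, hq2]
      ring
    have hBm : MeasurableSet (chart Q L '' gapRegion a b ρ) :=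
      ((chart Q L).isOpenMap _ (isOpen_gapRegion hac hbc ρ)).measurableSet
    have hBΩ : chart Q L '' gapRegion a b ρ ⊆ Ω := by
      rintro _ ⟨z, hz, rfl⟩
      exact (hgρ.chart_mem_of_mem_gapRegion hz).1
    have hvolB : volume.restrict Ω (chart Q L '' gapRegion a b ρ) ≤ ENNReal.ofReal δ := by
      refine (Measure.restrict_apply_le _ _).trans ?_
      rw [← (measurePreserving_chart Q L).measure_preimage hBm.nullMeasurableSet,
        (chart Q L).injective.preimage_image]
      exact hvol.trans (ENNReal.ofReal_le_ofReal h2.le)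
    have hL2 : L2norm Du (chart Q L '' gapRegion a b ρ) ≤ ε := by
      have := (eLpNorm_indicator_eq_eLpNorm_restrict (f := Du) hBm).symm.trans_le
        (hδε _ hBm hvolB)
      rw [Measure.restrict_restrict hBm,
        Set.inter_eq_left.2 hBΩ] at this
      exact ENNReal.toReal_le_of_le_ofReal hε.le this
    have key := hgρ.norm_mul_integral_radialCutoff_le hρ hτ' hu hrig hK
      (fun y hy => hb y (hy.trans h3)) (fun z hz => Set.mem_image_of_mem _ hz) hBm hBΩ
      (sq_nonneg _) hvol
    rw [integral_radialCutoff hρ, Real.sqrt_sq (by positivity)] at key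
    refine le_of_mul_le_mul_right ?_ (pow_pos hρ 2)
    calc ‖V‖ * I * ρ ^ 2 = ‖V‖ * (ρ ^ 2 * I) := by ring
      _ ≤ _ := key
      _ = (‖A (vert L)‖ * K * Real.pi * ρ ^ 2 +
          q * L2norm Du (chart Q L '' gapRegion a b ρ)) * ρ ^ 2 := by ring
      _ ≤ (‖A (vert L)‖ * K * Real.pi * ε + q * ε) * ρ ^ 2 := by gcongr
      _ = _ := by ring
  have hlim : ‖V‖ * I ≤ 0 := by
    have ht : Tendsto (fun ε : ℝ => (‖A (vert L)‖ * K * Real.pi + q) * ε) (𝓝[>] 0) (𝓝 0) := by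
      have := (show Continuous fun ε : ℝ => (‖A (vert L)‖ * K * Real.pi + q) * ε by
        fun_prop).tendsto 0
      rw [mul_zero] at this
      exact this.mono_left nhdsWithin_le_nhds
    exact ge_of_tendsto ht (eventually_nhdsWithin_of_forall fun ε hε => main ε hε)
  by_contra hV
  have := mul_pos (norm_pos_iff.2 hV) hI
  linarith

/-- The vertical velocity estimate, in a gap of height `s ^ 2` and width `c * s`. -/
theorem exists_abs_inner_vert_le (hK : 0 ≤ K) (hc : 0 < c) (hcK : K * c ^ 2 ≤ 1 / 2) :
    ∃ C : ℝ, 0 < C ∧ ∀ {Ω S B : Set E3} {Q : E3} {L : E3 ≃ₗᵢ[ℝ] E3} {a b : E2 → ℝ}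
      {τ τ' s : ℝ} {u : E3 → E3} {Du : E3 → E3 →L[ℝ] E3} {D2u : E3 → E3 →L[ℝ] E3 →L[ℝ] E3}
      {V : E3} {A : E3 →L[ℝ] E3}, 0 < s → s ≤ 1 → 0 < τ' → s ^ 2 ≤ τ' →
      IsGapChart Ω S Q L a b (c * s) τ τ' → MemW120 Ω u Du → DivFree Ω Du →
      (∀ᵐ x ∂(volume.restrict S), u x = V + A (x - (Q + s ^ 2 • vert L))) →
      (∀ x y, ⟪x, A y⟫ = -⟪y, A x⟫) → HasWeakGradient (Ω \ closure S) Du D2u →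
      MemLp D2u 2 (volume.restrict (Ω \ closure S)) →
      (∀ y, ‖y‖ < c * s → |a y| ≤ K * ‖y‖ ^ 2 ∧ |b y - s ^ 2| ≤ K * ‖y‖ ^ 2 ∧
        |a y - a (-y)| ≤ 2 * K * ‖y‖ ^ 3 ∧ |b y - b (-y)| ≤ 2 * K * ‖y‖ ^ 3) →
      (∀ z ∈ gapRegion a b (c * s), chart Q L z ∈ B) → MeasurableSet B →
      B ⊆ Ω \ closure S →
      |⟪vert L, V⟫| ≤ C * (s ^ 3 * L2norm D2u B + s ^ 2 * L2norm Du B) := by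
  have hI : 0 < ∫ y : E2, cutoffProfile (‖y‖ ^ 2) := by
    simpa using integral_cutoffProfile_pos (f := fun _ => 1) continuous_const
      (fun _ _ => one_pos) fun _ => zero_le_one
  have hJ : 0 < ∫ y : E2, cutoffProfile (‖y‖ ^ 2) * ‖y‖ ^ 2 :=
    integral_cutoffProfile_pos (by fun_prop) (fun y hy => by positivity) fun y => by positivity
  obtain ⟨M, hM0, hM⟩ := exists_abs_deriv_cutoffProfile_le
  set I := ∫ y : E2, cutoffProfile (‖y‖ ^ 2) with hIdef
  set J := ∫ y : E2, cutoffProfile (‖y‖ ^ 2) * ‖y‖ ^ 2 with hJdef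
  set q := √(2 * Real.pi) with hq
  have hπ := Real.pi_pos
  have hq2 : q ^ 2 = 2 * Real.pi := Real.sq_sqrt (by positivity)
  have hq0 : 0 < q := Real.sqrt_pos.2 (by positivity)
  -- `CW` bounds `s ‖A e‖` and `CV` bounds `‖V‖`, both in terms of the gradient norm. The volume
  -- bound is `2 s² · π (c s)² = (q c s²)²`, which explains `q`.
  set CW := 2 * q / (c ^ 2 * J) with hCW
  set CV := (CW * (K * c ^ 4 * Real.pi) + q * c) / (c ^ 2 * I) with hCV
  set C₁ := 2 * M * K * Real.pi * c ^ 4 * CV + 2 * M * K * Real.pi * c ^ 3 * CW with hC₁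
  have hCW0 : 0 < CW := by positivity
  have hCV0 : 0 < CV := by positivity
  have hC₁0 : 0 ≤ C₁ := by positivity
  refine ⟨(C₁ + 4 * M * q) / (c ^ 2 * I), by positivity, ?_⟩
  intro Ω S B Q L a b τ τ' s u Du D2u V A hs hs1 hτ' hsτ hg hu hdiv hrig hA hw hD2u hab hGB hBm hBF
  have hσ : 0 < c * s := by positivity
  have hac := hg.contDiff_wall.continuous
  have hbc := hg.contDiff_body.continuous
  have hKσ : K * (c * s) ^ 2 ≤ s ^ 2 / 2 := by
    have := mul_le_mul_of_nonneg_right hcK (sq_nonneg s)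
    linarith [show K * (c * s) ^ 2 = K * c ^ 2 * s ^ 2 by ring]
  have hvol : volume (gapRegion a b (c * s)) ≤ ENNReal.ofReal ((q * c * s ^ 2) ^ 2) := by
    have := volume_gapRegion_le hac hbc hσ.le (d := 2 * s ^ 2) (by positivity) fun y hy => by
      obtain ⟨e1, e2, -, -⟩ := hab y hy
      have e1 := abs_le.1 e1
      have e2 := abs_le.1 e2
      have e3 : K * ‖y‖ ^ 2 ≤ K * (c * s) ^ 2 := by gcongr
      linarith
    refine this.trans_eq (congrArg _ ?_)
    linear_combination (-(c ^ 2 * s ^ 4)) * hq2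
  have hBΩ : B ⊆ Ω := hBF.trans Set.sdiff_subset
  have k1 := hg.norm_map_vert_mul_le hσ hτ' hu hrig hA hGB hBm hBΩ (sq_nonneg _) hvol
  have k2 := hg.norm_mul_integral_radialCutoff_le hσ hτ' hu hrig hK (fun y hy => (hab y hy).2.1)
    hGB hBm hBΩ (sq_nonneg _) hvol
  have k3 := hg.abs_inner_vert_mul_le hσ hτ' (by positivity) hsτ hu hdiv hrig hA hw hD2u hK hKσ
    (fun y hy => (hab y hy).1) (fun y hy => (hab y hy).2.1) (fun y hy => (hab y hy).2.2.1)
    (fun y hy => (hab y hy).2.2.2) hM hGB hBm hBF (sq_nonneg _) hvol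
  rw [integral_radialCutoff_mul_norm_sq hσ, Real.sqrt_sq (by positivity)] at k1
  rw [integral_radialCutoff hσ, Real.sqrt_sq (by positivity)] at k2 k3
  have hN₁ := L2norm_nonneg Du B
  have hN₂ := L2norm_nonneg D2u B
  set N₁ := L2norm Du B
  set N₂ := L2norm D2u B
  set W := ‖A (vert L)‖
  set v := ‖V‖
  have w1 : W * s ≤ CW * N₁ := by
    rw [hCW, div_mul_eq_mul_div, le_div_iff₀ (by positivity)]
    refine le_of_mul_le_mul_right ?_ (show 0 < c ^ 2 * s ^ 3 / 2 by positivity)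
    calc _ = W / 2 * ((c * s) ^ 4 * J) := by ring
      _ ≤ _ := k1
      _ = _ := by ring
  have w2 : v ≤ CV * N₁ := by
    rw [hCV, div_mul_eq_mul_div, le_div_iff₀ (by positivity)]
    refine le_of_mul_le_mul_right ?_ (pow_pos hs 2)
    calc _ = v * ((c * s) ^ 2 * I) := by ring
      _ ≤ _ := k2
      _ = (W * s * s * (K * c ^ 4 * Real.pi) + q * c * N₁) * s ^ 2 := by ring
      -- One factor `s` is absorbed into `‖A e‖` and the other is bounded by 1.
      _ ≤ (CW * N₁ * 1 * (K * c ^ 4 * Real.pi) + q * c * N₁) * s ^ 2 := by gcongr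
      _ = _ := by ring
  rw [div_mul_eq_mul_div, le_div_iff₀ (by positivity)]
  refine le_of_mul_le_mul_right ?_ (pow_pos hs 2)
  calc _ = |⟪vert L, V⟫| * ((c * s) ^ 2 * I) := by ring
    _ ≤ _ := k3
    _ = (2 * M * K * Real.pi * c ^ 4 * s ^ 2 * v + 2 * M * K * Real.pi * c ^ 3 * s ^ 2 * (W * s) +
        4 * M * q * s ^ 3 * N₂) * s ^ 2 := by field_simp; ring
    _ ≤ (2 * M * K * Real.pi * c ^ 4 * s ^ 2 * (CV * N₁) +
        2 * M * K * Real.pi * c ^ 3 * s ^ 2 * (CW * N₁) + 4 * M * q * s ^ 3 * N₂) * s ^ 2 := by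
      gcongr
    _ = (C₁ * (s ^ 2 * N₁) + 4 * M * q * (s ^ 3 * N₂)) * s ^ 2 := by rw [hC₁]; ring
    _ ≤ _ := by
      gcongr
      have := mul_nonneg hC₁0 (by positivity : 0 ≤ s ^ 3 * N₂)
      have := mul_nonneg (by positivity : 0 ≤ 4 * M * q) (by positivity : 0 ≤ s ^ 2 * N₁)
      linarith

end IsGapChart

theorem theorem1p2 (K r : ℝ) (hr : 0 < r) :
    ∃ Hstar Cs c₀ : ℝ, 0 < Hstar ∧ 0 < Cs ∧ 0 < c₀ ∧
      ∀ Ω S : Set E3, IsRegion Ω → IsRegion S → Bornology.IsBounded S → S ⊆ Ω →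
        UniformC3With K r Ω → UniformC3With K r S →
      ∀ (P Q e : E3) (h : ℝ), IsGapFrame Ω S P Q e h → h < Hstar →
      ∀ (u : E3 → E3) (Du : E3 → E3 →L[ℝ] E3) (D2u : E3 → E3 →L[ℝ] E3 →L[ℝ] E3)
        (ustar w xstar : E3),
        MemW120Rigid S Ω u Du ustar w xstar →
        DivFree Ω Du →
        HasWeakGradient (Ω \ closure S) Du D2u →
        MemLp D2u 2 (volume.restrict (Ω \ closure S)) →
        |⟪rigidVelocity ustar w xstar P, e⟫| ≤
          Cs * (h ^ (3 / 2 : ℝ) *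
                L2norm D2u (gapCylinder Q e K h (c₀ * h ^ (1 / 2 : ℝ)) ∩ (Ω \ closure S))
              + h * L2norm Du
                  (gapCylinder Q e K h (c₀ * h ^ (1 / 2 : ℝ)) ∩ (Ω \ closure S))) := by
  -- The constants must be fixed before any boundary point is available to show `0 ≤ K`, hence the
  -- absolute value.
  set k := |K| with hk
  have hk0 : 0 ≤ k := abs_nonneg K
  have hc : (0 : ℝ) < 1 / (2 * (1 + k)) := by positivity
  set c := 1 / (2 * (1 + k)) with hcdef
  have hc1 : c * (2 * (1 + k)) = 1 := div_mul_cancel₀ _ (by positivity)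
  have hc2 : c ≤ 1 / 2 := by nlinarith
  have hkc : k * c ^ 2 ≤ 1 / 2 := by nlinarith [mul_nonneg hk0 hc.le]
  obtain ⟨C, hC, hmain⟩ := IsGapChart.exists_abs_inner_vert_le hk0 hc hkc
  -- With `h = s²`, the first bound gives `s ≤ 1`. The second gives `K σ² + h ≤ 3h/2 < r/4`, and the
  -- third gives `s < r`, hence `c s ≤ r/2`.
  refine ⟨min 1 (min (r / 8) (r ^ 2)), C, c, by positivity, hC, hc, ?_⟩
  intro Ω S hΩ hS _ hSΩ hΩ3 hS3 P Q e h hf hH u Du D2u ustar w xstar hu hdiv hw hD2u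
  obtain ⟨hH1, hH2⟩ := lt_min_iff.1 hH
  obtain ⟨hH2, hH3⟩ := lt_min_iff.1 hH2
  obtain ⟨L, a, b, hK, hP, hLe, hchart, hbd⟩ := hf.exists_isGapChart hr hΩ.1 hS.1 hSΩ hΩ3 hS3
  rw [abs_of_nonneg hK] at hk
  rw [hk] at hmain hkc
  have hh : 0 ≤ h := hf.dist_eq ▸ dist_nonneg
  have hrig : ∀ᵐ x ∂(volume.restrict S), u x =
      rigidVelocity ustar w xstar P + crossCLM w (x - (Q + h • vert L)) := by
    filter_upwards [hu.2.2] with x hx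
    rw [hx, rigidVelocity_eq_add _ _ _ P, ← hP]
  rcases hh.eq_or_lt with h0 | hpos
  · subst h0
    -- For `σ ≤ 1` one has `K σ² ≤ K σ`, and the last bound makes this at most `r/4`, as the charts
    -- require at `h = 0`.
    set ρ := min (r / 2) (min 1 (r / (4 * (1 + K)))) with hρ
    have hρ0 : 0 < ρ := by positivity
    have hV : rigidVelocity ustar w xstar P = 0 := by
      refine IsGapChart.eq_zero_of_contact hρ0 (fun σ hσ hσρ => hchart σ
        (hσρ.trans (min_le_left _ _)) ?_) (by positivity) hu.1 hrig hK
        (fun y hy => (hbd y (hy.trans_le (min_le_left _ _))).1)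
        fun y hy => (hbd y (hy.trans_le (min_le_left _ _))).2.1
      have h1 : σ ≤ 1 := hσρ.trans ((min_le_right _ _).trans (min_le_left _ _))
      have h2 : σ ≤ r / (4 * (1 + K)) := hσρ.trans ((min_le_right _ _).trans (min_le_right _ _))
      rw [le_div_iff₀ (by positivity)] at h2
      nlinarith [mul_nonneg hK hσ.le, mul_nonneg (mul_nonneg hK hσ.le) (sub_nonneg.2 h1)]
    rw [hV, inner_zero_left, abs_zero, Real.zero_rpow (by norm_num)]
    simp
  -- Writing `h = s²` turns the fractional powers of `h` into integer powers of `s`.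
  · obtain ⟨s, hs, rfl⟩ : ∃ s : ℝ, 0 < s ∧ s ^ 2 = h := ⟨√h, Real.sqrt_pos.2 hpos, Real.sq_sqrt hh⟩
    have e1 : (s ^ 2) ^ (1 / 2 : ℝ) = s := by
      rw [← Real.sqrt_eq_rpow, Real.sqrt_sq hs.le]
    have e2 : (s ^ 2) ^ (3 / 2 : ℝ) = s ^ 3 := by
      rw [← Real.rpow_natCast s 2, ← Real.rpow_mul hs.le, ← Real.rpow_natCast s 3]
      norm_num
    have hs1 : s ≤ 1 := by nlinarith
    have hsr : s < r := lt_of_pow_lt_pow_left₀ 2 hr.le hH3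
    have hcs : c * s ≤ r / 2 := by nlinarith
    have hKs : K * (c * s) ^ 2 ≤ s ^ 2 / 2 := by
      have := mul_le_mul_of_nonneg_right hkc (sq_nonneg s)
      linarith [show K * (c * s) ^ 2 = K * c ^ 2 * s ^ 2 by ring]
    have hg := hchart (c * s) hcs (by linarith)
    have hbd' := fun y hy => hbd y (lt_of_lt_of_le hy hcs)
    rw [e1, e2, ← hLe hpos, real_inner_comm]
    refine hmain hs hs1 (by positivity) (by linarith) hg hu.1 hdiv hrig (inner_crossCLM_comm w)
      hw hD2u hbd' (fun z hz => ⟨chart_mem_gapCylinder hK (fun y hy => (hbd' y hy).1)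
        (fun y hy => (hbd' y hy).2.1) hz, hg.chart_mem_of_mem_gapRegion hz⟩) ?_
      Set.inter_subset_right
    exact ((isOpen_gapCylinder _ _ _ _ _).inter (hΩ.1.sdiff isClosed_closure)).measurableSet
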